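/- Let $n\ge 1$, let $\Gamma\subset\mathbb{R}^n$ be an open convex cone which is invariant under permutations of the coordinates and contains the ray $\{(c,\dots,c): c>0\}$, and let $f:\Gamma\to\mathbb{R}$ be a $C^1$ function which is symmetric, homogeneous of degree one and nondecreasing in each variable. For an inner product $g$ on an $n$-dimensional vector space and a symmetric bilinear form $A$ whose eigenvalues $\kappa$ with respect to $g$ lie in $\Gamma$, put $F(A)=f(\kappa)$, and let $\dot F^{kl}$ be defined by $\dot F^{kl}|_A B_{kl}=\frac{d}{ds}F(A+sB)\big|_{s=0}$ for symmetric $B$. Let $M$ be a compact smooth $n$-manifold without boundary and let $X:M\times[0,T)\to\mathbb{R}^{n+1}$ be a smooth map such that each $X(\cdot,t)$ is an embedding. Let $\nu(\cdot,t)$ be the outward unit normal, that is, $X(M,t)$ is the boundary of a bounded open set $\Omega_t$ and $\nu$ points out of $\Omega_t$; $\nu$ is smooth on $M\times[0,T)$. Let $g$ be the induced metric, $\nabla$ its Levi-Civita connection, and $h$ the second fundamental form (positive for round spheres). Assume that the principal curvatures lie in $\Gamma$ and that $$\frac{\partial X}{\partial t}=-F\nu ,\qquad F=F(h).$$ For $x\neq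 y$ set $$Z(x,y,t)=\frac{2\langle X(x,t)-X(y,t),\nu(x,t)\rangle}{\|X(x,t)-X(y,t)\|^2},\qquad \overline Z(x,t)=\sup_{y\ne x}Z(x,y,t),\qquad \underline Z(x,t)=\inf_{y\neq x}Z(x,y,t)$$ (the interior and the exterior sphere curvature). Consider the linearized flow $$\frac{\partial u}{\partial t}=\dot F^{kl}\nabla_k\nabla_l u+\dot F^{kl}h_k{}^p h_{pl}\,u. \qquad (*)$$ A continuous function $v:M\times[0,T)\to\mathbb{R}$ is a viscosity subsolution of $(*)$ if for every $(x_0,t_0)\in M\times(0,T)$ and every $C^2$ function $\phi$ on $M\times[0,T)$ with $\phi(x_0,t_0)=v(x_0,t_0)$ and $\phi(x,t)\ge v(x,t)$ for all $x$ near $x_0$ and all $t\le t_0$ near $t_0$, one has $\frac{\partial\phi}{\partial t}\le\dot F^{kl}\nabla_k\nabla_l\phi+\dot F^{kl}h_k{}^ph_{pl}\,\phi$ at $(x_0,t_0)$; it is a viscosity supersolution if the same holds with both inequalities for $\phi$ reversed. If $f$ is convex, then $\underline Z$ is finite and is a viscosity supersolution of $(*)$. If $f$ is concave, then $\overline Z$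 is finite and is a viscosity subsolution of $(*)$. -/

import Mathlib

open Set Filter Topology
open scoped Manifold ContDiff

noncomputable section

namespace NonCollapsing

/-- The speed `f` as a function of the principal curvatures: symmetric, `C¹`, homogeneous of degree
one and nondecreasing in each variable, on an open symmetric convex cone `Γ ⊆ ℝⁿ` which contains
the ray of positive multiples of `(1, …, 1)`. -/
structure IsSpeed {n : ℕ} (Γ : ConvexCone ℝ (Fin n → ℝ)) (f : (Fin n → ℝ) → ℝ) : Prop where
  isOpen : IsOpen (Γ : Set (Fin n → ℝ))
  perm_mem : ∀ (σ : Equiv.Perm (Fin n)), ∀ κ ∈ Γ, κ ∘ σ ∈ Γ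
  ray_mem : ∀ c : ℝ, 0 < c → (fun _ : Fin n => c) ∈ Γ
  symm : ∀ (σ : Equiv.Perm (Fin n)), ∀ κ ∈ Γ, f (κ ∘ σ) = f κ
  contDiffOn : ContDiffOn ℝ 1 f (Γ : Set (Fin n → ℝ))
  homogeneous : ∀ c : ℝ, 0 < c → ∀ κ ∈ Γ, f (c • κ) = c * f κ
  monotoneOn : MonotoneOn f (Γ : Set (Fin n → ℝ))

section Spectral

variable {n : ℕ}

/-- `κ` lists the eigenvalues (with multiplicity) of the bilinear form `h` with respect to the inner
product `g` on an `n`-dimensional space: some `g`-orthonormal frame diagonalizes `h` with diagonal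
entries `κ`. -/
def IsEigenvalueList (g h : EuclideanSpace ℝ (Fin n) → EuclideanSpace ℝ (Fin n) → ℝ)
    (κ : Fin n → ℝ) : Prop :=
  ∃ e : Fin n → EuclideanSpace ℝ (Fin n),
    (∀ i j, g (e i) (e j) = if i = j then 1 else 0) ∧
    (∀ i j, h (e i) (e j) = if i = j then κ i else 0)

/-- The eigenvalues of the symmetric bilinear form `h` with respect to `g`, in some order
(only permutation invariant expressions in them are used). -/
def eigenvalueList (g h : EuclideanSpace ℝ (Fin n) → EuclideanSpace ℝ (Fin n) → ℝ) : Fin n → ℝ :=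
  Classical.epsilon (IsEigenvalueList g h)

/-- The function `F` on symmetric bilinear forms defined by a symmetric function `f` of the
eigenvalues. -/
def spectralFun (f : (Fin n → ℝ) → ℝ)
    (g h : EuclideanSpace ℝ (Fin n) → EuclideanSpace ℝ (Fin n) → ℝ) : ℝ :=
  f (eigenvalueList g h)

/-- `Ḟ^{kl}|_h B_{kl} = d/ds F(h + s B)` at `s = 0`, for symmetric `B`. -/
def spectralDeriv (f : (Fin n → ℝ) → ℝ)
    (g h B : EuclideanSpace ℝ (Fin n) → EuclideanSpace ℝ (Fin n) → ℝ) : ℝ :=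
  deriv (fun s : ℝ => spectralFun f g (fun u v => h u v + s * B u v)) 0

end Spectral

section Geometry

variable {n : ℕ} {M : Type*} [TopologicalSpace M] [ChartedSpace (EuclideanSpace ℝ (Fin n)) M]

/-- The differential of `Y : M → W` at `x`. The tangent space of `M` at `x` is identified with
`ℝⁿ` through the preferred chart at `x`, as everywhere in Mathlib. -/
def differential {W : Type*} [NormedAddCommGroup W] [NormedSpace ℝ W] (Y : M → W) (x : M) :
    EuclideanSpace ℝ (Fin n) →L[ℝ] W :=
  mfderiv (𝓡 n) 𝓘(ℝ, W) Y x

/-- The matrix of second partial derivatives `∂ᵢ∂ⱼ Y` at `x` in the preferred chart at `x`, as a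
bilinear map. -/
def chartSecondDeriv {W : Type*} [NormedAddCommGroup W] [NormedSpace ℝ W] (Y : M → W) (x : M) :
    EuclideanSpace ℝ (Fin n) →L[ℝ] EuclideanSpace ℝ (Fin n) →L[ℝ] W :=
  fderiv ℝ (fderiv ℝ (Y ∘ (extChartAt (𝓡 n) x).symm)) (extChartAt (𝓡 n) x x)

/-- The metric induced by an immersion `Y`. -/
def inducedMetric (Y : M → EuclideanSpace ℝ (Fin (n + 1))) (x : M)
    (u v : EuclideanSpace ℝ (Fin n)) : ℝ :=
  inner ℝ (differential Y x u) (differential Y x v)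

/-- `(DYᵀ DY)⁻¹ DYᵀ`, i.e. `w ↦ g^{kl} ⟨w, ∂ₗ Y⟩ ∂ₖ`: the tangent vector of `M` at `x` which
represents the tangential part of `w`. -/
def tangentialPart (Y : M → EuclideanSpace ℝ (Fin (n + 1))) (x : M)
    (w : EuclideanSpace ℝ (Fin (n + 1))) : EuclideanSpace ℝ (Fin n) :=
  ((ContinuousLinearMap.adjoint (differential (n := n) Y x)).comp (differential (n := n) Y x)).inverse
    (ContinuousLinearMap.adjoint (differential (n := n) Y x) w)

/-- The second fundamental form with respect to the unit normal `ν`, with the sign for which round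
spheres with outward normal have positive curvature. -/
def secondFundamentalForm (Y ν : M → EuclideanSpace ℝ (Fin (n + 1))) (x : M)
    (u v : EuclideanSpace ℝ (Fin n)) : ℝ :=
  inner ℝ (differential ν x u) (differential Y x v)

/-- The Weingarten map `h_k^p`. -/
def weingarten (Y ν : M → EuclideanSpace ℝ (Fin (n + 1))) (x : M)
    (u : EuclideanSpace ℝ (Fin n)) : EuclideanSpace ℝ (Fin n) :=
  tangentialPart Y x (differential ν x u)

/-- The form `h_k^p h_{pl}`. -/
def squaredForm (Y ν : M → EuclideanSpace ℝ (Fin (n + 1))) (x : M)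
    (u v : EuclideanSpace ℝ (Fin n)) : ℝ :=
  secondFundamentalForm Y ν x (weingarten Y ν x u) v

/-- The principal curvatures, in some order. -/
def principalCurvatures (Y ν : M → EuclideanSpace ℝ (Fin (n + 1))) (x : M) : Fin n → ℝ :=
  eigenvalueList (inducedMetric Y x) (secondFundamentalForm Y ν x)

/-- The Hessian of `φ` for the Levi-Civita connection of the metric induced by `Y`:
`∇ᵢ∇ⱼ φ = ∂ᵢ∂ⱼ φ - Γᵢⱼᵏ ∂ₖ φ` with `Γᵢⱼᵏ = g^{kl} ⟨∂ᵢ∂ⱼ Y, ∂ₗ Y⟩`. -/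
def hessian (Y : M → EuclideanSpace ℝ (Fin (n + 1))) (φ : M → ℝ) (x : M)
    (u v : EuclideanSpace ℝ (Fin n)) : ℝ :=
  chartSecondDeriv φ x u v - differential φ x (tangentialPart Y x (chartSecondDeriv Y x u v))

/-- `ν` is the outward unit normal of the hypersurface `Y(M)`: this is the boundary of a bounded
open set `Ω`, and `ν` points out of `Ω`. -/
structure IsOutwardNormal (Y ν : M → EuclideanSpace ℝ (Fin (n + 1))) : Prop where
  norm_eq_one : ∀ x, ‖ν x‖ = 1
  orthogonal : ∀ x (u : EuclideanSpace ℝ (Fin n)), inner ℝ (differential Y x u) (ν x) = 0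
  outward : ∃ Ω : Set (EuclideanSpace ℝ (Fin (n + 1))),
    IsOpen Ω ∧ Bornology.IsBounded Ω ∧ frontier Ω = range Y ∧
    ∀ x, ∀ᶠ s : ℝ in 𝓝[>] 0, Y x - s • ν x ∈ Ω ∧ Y x + s • ν x ∉ closure Ω

/-- `X : M × [0,T) → ℝⁿ⁺¹`, written `X t x`, is a smooth family of embeddings with outward unit
normal `ν`, whose principal curvatures lie in `Γ`, and which satisfies `∂X/∂t = -F ν`. -/
structure IsEmbeddedSolution (Γ : ConvexCone ℝ (Fin n → ℝ)) (f : (Fin n → ℝ) → ℝ) (T : ℝ)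
    (X ν : ℝ → M → EuclideanSpace ℝ (Fin (n + 1))) : Prop where
  smooth : ContMDiffOn (𝓘(ℝ, ℝ).prod (𝓡 n)) 𝓘(ℝ, EuclideanSpace ℝ (Fin (n + 1))) ∞
    (fun p : ℝ × M => X p.1 p.2) (Ico 0 T ×ˢ univ)
  embedding : ∀ t ∈ Ico 0 T, IsEmbedding (X t)
  immersion : ∀ t ∈ Ico 0 T, ∀ x, Function.Injective (differential (n := n) (X t) x)
  smooth_normal : ContMDiffOn (𝓘(ℝ, ℝ).prod (𝓡 n)) 𝓘(ℝ, EuclideanSpace ℝ (Fin (n + 1))) ∞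
    (fun p : ℝ × M => ν p.1 p.2) (Ico 0 T ×ˢ univ)
  normal : ∀ t ∈ Ico 0 T, IsOutwardNormal (X t) (ν t)
  curvatures_mem : ∀ t ∈ Ico 0 T, ∀ x, principalCurvatures (X t) (ν t) x ∈ Γ
  flow : ∀ t ∈ Ico 0 T, ∀ x,
    HasDerivWithinAt (fun s => X s x)
      (-(f (principalCurvatures (X t) (ν t) x)) • ν t x) (Ico 0 T) t

/-- The right hand side `Ḟ^{kl} ∇ₖ∇ₗ φ + Ḟ^{kl} h_k^p h_{pl} φ` of the linearized flow. -/
def linearizedFlow (f : (Fin n → ℝ) → ℝ) (X ν : ℝ → M → EuclideanSpace ℝ (Fin (n + 1)))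
    (t : ℝ) (φ : M → ℝ) (x : M) : ℝ :=
  spectralDeriv f (inducedMetric (X t) x) (secondFundamentalForm (X t) (ν t) x)
      (hessian (X t) φ x) +
    spectralDeriv f (inducedMetric (X t) x) (secondFundamentalForm (X t) (ν t) x)
      (squaredForm (X t) (ν t) x) * φ x

/-- `Z(x,y,t) = 2 ⟨X(x,t) - X(y,t), ν(x,t)⟩ / ‖X(x,t) - X(y,t)‖²`. -/
def Z (X ν : ℝ → M → EuclideanSpace ℝ (Fin (n + 1))) (t : ℝ) (x y : M) : ℝ :=
  2 * inner ℝ (X t x - X t y) (ν t x) / ‖X t x - X t y‖ ^ 2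

/-- The interior sphere curvature. -/
def interiorSphereCurvature (X ν : ℝ → M → EuclideanSpace ℝ (Fin (n + 1))) (t : ℝ) (x : M) : ℝ :=
  sSup {r | ∃ y, y ≠ x ∧ r = Z X ν t x y}

/-- The exterior sphere curvature. -/
def exteriorSphereCurvature (X ν : ℝ → M → EuclideanSpace ℝ (Fin (n + 1))) (t : ℝ) (x : M) : ℝ :=
  sInf {r | ∃ y, y ≠ x ∧ r = Z X ν t x y}

/-- `v` is a (continuous) viscosity subsolution on `M × [0,T)` of `∂u/∂t = G[u]`, where
`G t φ x` is the value at `(x,t)` of a second order expression in `φ = φ(·,t)`. Test functions touch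
`v` from above at `(x₀,t₀)`, `0 < t₀`, on a neighbourhood of that point in `M × (-∞,t₀]`. -/
def IsViscositySubsolution (n : ℕ) {M : Type*} [TopologicalSpace M]
    [ChartedSpace (EuclideanSpace ℝ (Fin n)) M] (T : ℝ)
    (G : ℝ → (M → ℝ) → M → ℝ) (v : ℝ → M → ℝ) : Prop :=
  ContinuousOn (fun p : ℝ × M => v p.1 p.2) (Ico 0 T ×ˢ univ) ∧
  ∀ t₀ ∈ Ioo 0 T, ∀ (x₀ : M) (φ : ℝ → M → ℝ),
    ContMDiffOn (𝓘(ℝ, ℝ).prod (𝓡 n)) 𝓘(ℝ, ℝ) 2 (fun p : ℝ × M => φ p.1 p.2)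
      (Ico 0 T ×ˢ univ) →
    φ t₀ x₀ = v t₀ x₀ →
    (∀ᶠ p : ℝ × M in 𝓝[Iic t₀ ×ˢ univ] (t₀, x₀), v p.1 p.2 ≤ φ p.1 p.2) →
    deriv (fun t => φ t x₀) t₀ ≤ G t₀ (φ t₀) x₀

/-- Viscosity supersolutions: test functions touch from below and the inequality is reversed. -/
def IsViscositySupersolution (n : ℕ) {M : Type*} [TopologicalSpace M]
    [ChartedSpace (EuclideanSpace ℝ (Fin n)) M] (T : ℝ)
    (G : ℝ → (M → ℝ) → M → ℝ) (v : ℝ → M → ℝ) : Prop :=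
  ContinuousOn (fun p : ℝ × M => v p.1 p.2) (Ico 0 T ×ˢ univ) ∧
  ∀ t₀ ∈ Ioo 0 T, ∀ (x₀ : M) (φ : ℝ → M → ℝ),
    ContMDiffOn (𝓘(ℝ, ℝ).prod (𝓡 n)) 𝓘(ℝ, ℝ) 2 (fun p : ℝ × M => φ p.1 p.2)
      (Ico 0 T ×ˢ univ) →
    φ t₀ x₀ = v t₀ x₀ →
    (∀ᶠ p : ℝ × M in 𝓝[Iic t₀ ×ˢ univ] (t₀, x₀), φ p.1 p.2 ≤ v p.1 p.2) →
    G t₀ (φ t₀) x₀ ≤ deriv (fun t => φ t x₀) t₀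

end Geometry

end NonCollapsing

end

noncomputable section

namespace NonCollapsing

/-! Write d = X(x) - X(y) and δ = |d|². A number a bounds Z(x,·) exactly when the contact defect a δ
- 2⟨d, ν(x)⟩ is nonnegative for every y. So if φ touches the interior sphere curvature from above at
(x,t), the defect with a = φ is nonnegative in the past near that point, and the subsolution
inequality comes from a maximum principle for a function of two points. By compactness the supremum
is either attained at some y ≠ x or equal to a principal curvature at x
(`IsSmoothFlow.attained_or_eq_curvature`).

Attained case (`NormalFlowData.two_point`). The extremal sphere is tangent to the hypersurface at y,
and reflection in the hyperplane orthogonal to d carries a principal frame e at x to an orthonormal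
frame e' at y. The second derivative test is applied while x moves along e_i and y along e'_i, with
weights ∂f/∂κ_i ≥ 0, and is combined with the time derivative. Varying x alone determines the
gradient of φ; the resulting gradient terms are nonnegative multiples of κ_i - φ, and κ_i ≤ φ. What
remains is F(y) ≤ ∑ (∂f/∂κ_i) h(e'_i, e'_i), the supporting plane inequality for a concave function
of degree one (`IsConcaveSpeed.le_sum_grad`).

Osculating case (`NormalFlowData.one_point`). Here φ g - h is nonnegative nearby in the past and
vanishes at the base point on a principal direction e_a. Interchanging fourth derivatives of the
position, as in Simons' identity, relates the Hessian of h_aa to that of the h_ii, and concavity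
bounds the second derivative of the speed.

As f is only C¹, F is never differentiated twice. The speed -⟨∂X/∂t, ν⟩ is smooth because X and ν
are, and it lies below the weighted trace of h in every orthonormal frame, with equality at the base
point. The minimum of the difference gives a first order identity, hence the evolution of ν, and a
second order inequality (`spectral_second_order`).

For convex f the normal is reversed. The dual speed -f(-κ) on -Γ is concave, the exterior curvature
becomes minus the interior one, and the linearized operator is unchanged. For this reason the main
argument uses only `IsConcaveSpeed` and `IsSmoothFlow`, in which neither the positive ray nor the
direction of the normal occurs. The side on which Ω lies matters only for the sign of the normal at
the second contact point, settled topologically in `not_opposite_contact`. -/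

/-- The properties of a concave speed that the argument uses; `Γ` need not contain the positive
ray. -/
structure IsConcaveSpeed {n : ℕ} (Γ : Set (Fin n → ℝ)) (f : (Fin n → ℝ) → ℝ) : Prop where
  isOpen : IsOpen Γ
  perm_mem : ∀ (σ : Equiv.Perm (Fin n)), ∀ κ ∈ Γ, κ ∘ σ ∈ Γ
  symm : ∀ (σ : Equiv.Perm (Fin n)), ∀ κ ∈ Γ, f (κ ∘ σ) = f κ
  contDiffOn : ContDiffOn ℝ 1 f Γ
  homogeneous : ∀ c : ℝ, 0 < c → ∀ κ ∈ Γ, f (c • κ) = c * f κ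
  monotoneOn : MonotoneOn f Γ
  concaveOn : ConcaveOn ℝ Γ f

/-! ### Concave symmetric functions of degree one. -/

section Speed

variable {n : ℕ} {Γ : Set (Fin n → ℝ)} {f : (Fin n → ℝ) → ℝ}

/-- The partial derivatives of the speed. -/
def grad (f : (Fin n → ℝ) → ℝ) (κ : Fin n → ℝ) (i : Fin n) : ℝ :=
  fderiv ℝ f κ (Pi.single i 1)

lemma fderiv_eq_sum_grad (f : (Fin n → ℝ) → ℝ) (κ v : Fin n → ℝ) :
    fderiv ℝ f κ v = ∑ i, grad f κ i * v i := by
  conv_lhs => rw [← Finset.univ_sum_single v]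
  rw [map_sum]
  refine Finset.sum_congr rfl fun i _ => ?_
  have : (Pi.single i (v i) : Fin n → ℝ) = v i • Pi.single i 1 := by
    rw [← Pi.single_smul]; simp
  rw [this, map_smul, grad, smul_eq_mul, mul_comm]

namespace IsConcaveSpeed

lemma hasFDerivAt (hf : IsConcaveSpeed Γ f) {κ : Fin n → ℝ} (hκ : κ ∈ Γ) :
    HasFDerivAt f (fderiv ℝ f κ) κ :=
  ((hf.contDiffOn.contDiffAt (hf.isOpen.mem_nhds hκ)).differentiableAt (by norm_num)).hasFDerivAt

lemma hasDerivAt_line (hf : IsConcaveSpeed Γ f) {κ : Fin n → ℝ} (hκ : κ ∈ Γ) (v : Fin n → ℝ) :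
    HasDerivAt (fun s : ℝ => f (κ + s • v)) (∑ i, grad f κ i * v i) 0 := by
  have h1 : HasDerivAt (fun s : ℝ => κ + s • v) v 0 := by
    simpa using ((hasDerivAt_id (0 : ℝ)).smul_const v).const_add κ
  have h2 : HasFDerivAt f (fderiv ℝ f κ) (κ + (0 : ℝ) • v) := by simpa using hf.hasFDerivAt hκ
  rw [← fderiv_eq_sum_grad]
  exact h2.comp_hasDerivAt (0 : ℝ) h1

lemma eventually_line_mem (hf : IsConcaveSpeed Γ f) {κ : Fin n → ℝ} (hκ : κ ∈ Γ)
    (v : Fin n → ℝ) : ∀ᶠ s : ℝ in 𝓝 0, κ + s • v ∈ Γ := by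
  have : ContinuousAt (fun s : ℝ => κ + s • v) 0 := by fun_prop
  exact this.eventually_mem (by simpa using hf.isOpen.mem_nhds hκ)

lemma grad_nonneg (hf : IsConcaveSpeed Γ f) {κ : Fin n → ℝ} (hκ : κ ∈ Γ) (i : Fin n) :
    0 ≤ grad f κ i := by
  have h := (hf.hasDerivAt_line hκ (Pi.single i 1)).tendsto_slope_zero_right
  have e : ∑ j, grad f κ j * (Pi.single i 1 : Fin n → ℝ) j = grad f κ i := by
    simp [Pi.single_apply]
  rw [e] at h
  refine ge_of_tendsto h ?_
  filter_upwards [(hf.eventually_line_mem hκ (Pi.single i 1)).filter_mono nhdsWithin_le_nhds,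
    self_mem_nhdsWithin] with s hs hs0
  have hs0 : (0 : ℝ) < s := hs0
  have : f κ ≤ f (κ + s • Pi.single i 1) := by
    refine hf.monotoneOn hκ hs ?_
    refine le_add_of_nonneg_right (smul_nonneg hs0.le ?_)
    simp
  simp only [zero_add, zero_smul, add_zero, smul_eq_mul]
  exact mul_nonneg (by positivity) (by linarith)

/-- Differentiate f((1 + s)κ) = (1 + s) f(κ) at s = 0. -/
lemma euler (hf : IsConcaveSpeed Γ f) {κ : Fin n → ℝ} (hκ : κ ∈ Γ) :
    ∑ i, grad f κ i * κ i = f κ := by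
  refine (hf.hasDerivAt_line hκ κ).unique ?_
  have h : HasDerivAt (fun s : ℝ => (1 + s) * f κ) (f κ) 0 := by
    simpa using ((hasDerivAt_id (0 : ℝ)).const_add 1).mul_const (f κ)
  refine h.congr_of_eventuallyEq ?_
  filter_upwards [lt_mem_nhds (show (-1 : ℝ) < 0 by norm_num)] with s hs
  rw [← hf.homogeneous (1 + s) (by linarith) κ hκ, add_smul, one_smul]

/-- Concavity puts f below its tangent plane at κ, and Euler's identity removes the constant term of
that plane. -/
lemma le_grad (hf : IsConcaveSpeed Γ f) {κ κ' : Fin n → ℝ} (hκ : κ ∈ Γ) (hκ' : κ' ∈ Γ) :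
    f κ' ≤ ∑ i, grad f κ i * κ' i := by
  have h := (hf.hasDerivAt_line hκ (κ' - κ)).tendsto_slope_zero_right
  have key : f κ' - f κ ≤ ∑ i, grad f κ i * (κ' - κ) i := by
    refine ge_of_tendsto h ?_
    filter_upwards [self_mem_nhdsWithin,
      (gt_mem_nhds (show (0 : ℝ) < 1 by norm_num)).filter_mono nhdsWithin_le_nhds] with s hs0 hs1
    have hs0 : (0 : ℝ) < s := hs0
    have := hf.concaveOn.2 hκ hκ' (show 0 ≤ 1 - s by linarith) hs0.le (by ring)
    have e : (1 - s) • κ + s • κ' = κ + s • (κ' - κ) := by module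
    rw [e] at this
    simp only [zero_add, zero_smul, add_zero, smul_eq_mul] at this ⊢
    rw [inv_mul_eq_div, le_div_iff₀ hs0]
    linarith
  simp only [Pi.sub_apply, mul_sub, Finset.sum_sub_distrib] at key
  rw [hf.euler hκ] at key
  linarith

/-- Symmetry of f passes to its partial derivatives; consequently equal eigenvalues carry equal
weights, and weighted traces do not depend on the eigenframe. -/
lemma grad_perm (hf : IsConcaveSpeed Γ f) {κ : Fin n → ℝ} (hκ : κ ∈ Γ)
    (σ : Equiv.Perm (Fin n)) (i : Fin n) : grad f (κ ∘ σ) i = grad f κ (σ i) := by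
  have h1 := hf.hasDerivAt_line (hf.perm_mem σ κ hκ) (Pi.single i 1)
  have h2 := hf.hasDerivAt_line hκ (Pi.single (σ i) 1)
  have e1 : ∑ j, grad f (κ ∘ σ) j * (Pi.single i 1 : Fin n → ℝ) j = grad f (κ ∘ σ) i := by
    simp [Pi.single_apply]
  have e2 : ∑ j, grad f κ j * (Pi.single (σ i) 1 : Fin n → ℝ) j = grad f κ (σ i) := by
    simp [Pi.single_apply]
  rw [e1] at h1
  rw [e2] at h2
  refine h1.unique (h2.congr_of_eventuallyEq ?_)
  filter_upwards [hf.eventually_line_mem hκ (Pi.single (σ i) 1)] with s hs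
  rw [← hf.symm σ _ hs]
  congr 1
  ext j
  simp [Pi.single_apply]

/-- Jensen's inequality on a permutation orbit, along which f is constant: averaging can only
increase f. -/
lemma sum_perm_mem (hf : IsConcaveSpeed Γ f) {κ : Fin n → ℝ} (hκ : κ ∈ Γ)
    {w : Equiv.Perm (Fin n) → ℝ} (hw : ∀ σ, 0 ≤ w σ) (hw1 : ∑ σ, w σ = 1) :
    ∑ σ, w σ • (κ ∘ σ) ∈ Γ ∧ f κ ≤ f (∑ σ, w σ • (κ ∘ σ)) := by
  refine ⟨hf.concaveOn.1.sum_mem (fun σ _ => hw σ) hw1 fun σ _ => hf.perm_mem σ κ hκ, ?_⟩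
  have := hf.concaveOn.le_map_sum (t := Finset.univ) (fun σ _ => hw σ) hw1
    (fun σ _ => hf.perm_mem σ κ hκ)
  refine le_trans (le_of_eq ?_) this
  simp only [hf.symm _ _ hκ, smul_eq_mul, ← Finset.sum_mul, hw1, one_mul]

lemma continuousAt_grad (hf : IsConcaveSpeed Γ f) {κ : Fin n → ℝ} (hκ : κ ∈ Γ) (i : Fin n) :
    ContinuousAt (fun κ => grad f κ i) κ := by
  have := (hf.contDiffOn.contDiffAt (hf.isOpen.mem_nhds hκ)).fderiv_right (m := 0) (by norm_num)
  exact this.continuousAt.clm_apply continuousAt_const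

end IsConcaveSpeed

end Speed

/-! ### Orthonormal frames and changes of frame. -/

section Frames

open Matrix

variable {n : ℕ}

local notation "𝔼" => EuclideanSpace ℝ (Fin n)

/-- `e` is an orthonormal frame for the bilinear form `g`. -/
def IsFrame (g : LinearMap.BilinForm ℝ 𝔼) (e : Fin n → 𝔼) : Prop :=
  ∀ i j, g (e i) (e j) = if i = j then 1 else 0

/-- Pairing a vanishing combination with e_i isolates its i-th coefficient, so definiteness of g
plays no role. -/
lemma IsFrame.linearIndependent {g : LinearMap.BilinForm ℝ 𝔼} {e : Fin n → 𝔼}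
    (he : IsFrame g e) : LinearIndependent ℝ e := by
  rw [Fintype.linearIndependent_iff]
  intro c hc i
  have := congrArg (fun w => g w (e i)) hc
  simpa [map_sum, he _ _] using this

lemma IsFrame.expand {g : LinearMap.BilinForm ℝ 𝔼} {e : Fin n → 𝔼}
    (he : IsFrame g e) (v : 𝔼) : ∑ i, g (e i) v • e i = v := by
  have hs : ⊤ ≤ Submodule.span ℝ (Set.range e) := by
    rw [he.linearIndependent.span_eq_top_of_card_eq_finrank' (by simp)]
  obtain ⟨c, rfl⟩ := (Submodule.mem_span_range_iff_exists_fun ℝ).1 (hs (Submodule.mem_top (x := v)))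
  refine Finset.sum_congr rfl fun i _ => ?_
  congr 1
  simp [map_sum, he i _]

/-- The change of frame matrix. -/
def frameMatrix (g : LinearMap.BilinForm ℝ 𝔼) (e E : Fin n → 𝔼) : Matrix (Fin n) (Fin n) ℝ :=
  Matrix.of fun i j => g (e i) (E j)

/-- The matrix of a bilinear form in a frame. -/
def formMatrix (h : LinearMap.BilinForm ℝ 𝔼) (e : Fin n → 𝔼) : Matrix (Fin n) (Fin n) ℝ :=
  Matrix.of fun i j => h (e i) (e j)

lemma IsFrame.formMatrix_eq {g : LinearMap.BilinForm ℝ 𝔼} {e : Fin n → 𝔼}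
    (he : IsFrame g e) (h : LinearMap.BilinForm ℝ 𝔼) (E : Fin n → 𝔼) :
    formMatrix h E = (frameMatrix g e E)ᵀ * formMatrix h e * frameMatrix g e E := by
  ext i j
  have h1 := he.expand (E i)
  have h2 := he.expand (E j)
  simp only [formMatrix, Matrix.of_apply]
  conv_lhs => rw [← h1, ← h2]
  simp only [map_sum, map_smul, LinearMap.sum_apply, LinearMap.smul_apply, smul_eq_mul,
    Matrix.mul_apply, Matrix.transpose_apply, frameMatrix, Matrix.of_apply, Finset.sum_mul,
    Finset.mul_sum]
  refine Finset.sum_congr rfl fun k _ => Finset.sum_congr rfl fun l _ => by ring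

lemma IsFrame.formMatrix_self {g : LinearMap.BilinForm ℝ 𝔼} {e : Fin n → 𝔼}
    (he : IsFrame g e) : formMatrix g e = 1 := by
  ext i j
  simp [formMatrix, he i j, Matrix.one_apply]

lemma IsFrame.transpose_mul {g : LinearMap.BilinForm ℝ 𝔼} {e E : Fin n → 𝔼}
    (he : IsFrame g e) (hE : IsFrame g E) :
    (frameMatrix g e E)ᵀ * frameMatrix g e E = 1 := by
  have := he.formMatrix_eq g E
  rw [he.formMatrix_self, hE.formMatrix_self, Matrix.mul_one] at this
  exact this.symm

lemma isEigenvalueList_iff {g h : LinearMap.BilinForm ℝ 𝔼} {κ : Fin n → ℝ} :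
    IsEigenvalueList (fun u v => g u v) (fun u v => h u v) κ ↔
      ∃ e, IsFrame g e ∧ formMatrix h e = Matrix.diagonal κ := by
  refine exists_congr fun e => and_congr Iff.rfl ?_
  rw [← Matrix.ext_iff]
  refine forall_congr' fun i => forall_congr' fun j => ?_
  simp [formMatrix, Matrix.diagonal_apply]

end Frames

/-! ### Schur's inequality and independence of the eigenframe. -/

section Diagonalization

open Matrix

variable {n : ℕ} {Γ : Set (Fin n → ℝ)} {f : (Fin n → ℝ) → ℝ}

/-- Rows and columns of an orthogonal matrix are unit vectors. -/
lemma sq_mem_doublyStochastic {O : Matrix (Fin n) (Fin n) ℝ} (hO : Oᵀ * O = 1) :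
    (Matrix.of fun i j => O i j ^ 2) ∈ doublyStochastic ℝ (Fin n) := by
  have hO' : O * Oᵀ = 1 := mul_eq_one_comm.1 hO
  rw [mem_doublyStochastic_iff_sum]
  refine ⟨fun i j => sq_nonneg _, fun i => ?_, fun j => ?_⟩
  · have := congrFun (congrFun hO' i) i
    simpa [Matrix.mul_apply, sq] using this
  · have := congrFun (congrFun hO j) j
    simpa [Matrix.mul_apply, sq] using this

/-- Schur: the diagonal of a symmetric matrix is a convex combination of permutations of its
eigenvalues. -/
lemma diag_eq_sum_perm {O H : Matrix (Fin n) (Fin n) ℝ} {κ : Fin n → ℝ} (hO : Oᵀ * O = 1)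
    (hH : Oᵀ * H * O = Matrix.diagonal κ) :
    ∃ w : Equiv.Perm (Fin n) → ℝ, (∀ σ, 0 ≤ w σ) ∧ ∑ σ, w σ = 1 ∧
      (∀ σ i, w σ ≤ O i (σ i) ^ 2) ∧ (fun i => H i i) = ∑ σ, w σ • (κ ∘ σ) := by
  have hO' : O * Oᵀ = 1 := mul_eq_one_comm.1 hO
  -- Birkhoff's theorem: the matrix of squares is a convex combination of permutation matrices.
  obtain ⟨w, hw, hw1, hws⟩ :=
    exists_eq_sum_perm_of_mem_doublyStochastic (sq_mem_doublyStochastic hO)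
  have hentry : ∀ i j, O i j ^ 2 = ∑ σ, w σ * (if σ i = j then 1 else 0) := by
    intro i j
    have := congrFun (congrFun hws i) j
    simp only [Matrix.sum_apply, Matrix.smul_apply, Matrix.of_apply, smul_eq_mul] at this
    rw [← this]
    refine Finset.sum_congr rfl fun σ _ => ?_
    simp [Equiv.Perm.permMatrix, PEquiv.toMatrix_apply, Equiv.toPEquiv_apply, eq_comm]
  refine ⟨w, hw, hw1, fun σ i => ?_, ?_⟩
  -- A single nonnegative summand is at most the whole sum. This bound later shows that O has no
  -- zero entries along a permutation of positive weight.
  · rw [hentry]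
    refine le_trans (by simp) (Finset.single_le_sum (f := fun τ : Equiv.Perm (Fin n) =>
      w τ * (if τ i = σ i then (1 : ℝ) else 0)) (fun τ _ => ?_) (Finset.mem_univ σ))
    split_ifs <;> simp [hw τ]
  · have hHd : H = O * Matrix.diagonal κ * Oᵀ := by
      rw [← hH]
      calc H = (O * Oᵀ) * H * (O * Oᵀ) := by rw [hO', Matrix.one_mul, Matrix.mul_one]
        _ = _ := by simp only [Matrix.mul_assoc]
    ext i
    have : H i i = ∑ j, O i j ^ 2 * κ j := by
      rw [hHd, Matrix.mul_apply]
      simp only [Matrix.mul_diagonal, Matrix.transpose_apply]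
      exact Finset.sum_congr rfl fun j _ => by ring
    rw [this]
    simp only [hentry, Finset.sum_mul, Finset.sum_apply, Pi.smul_apply, smul_eq_mul,
      Function.comp_apply]
    rw [Finset.sum_comm]
    refine Finset.sum_congr rfl fun σ _ => ?_
    simp

lemma IsConcaveSpeed.le_diag (hf : IsConcaveSpeed Γ f) {O H : Matrix (Fin n) (Fin n) ℝ}
    {κ : Fin n → ℝ} (hO : Oᵀ * O = 1) (hH : Oᵀ * H * O = Matrix.diagonal κ) (hκ : κ ∈ Γ) :
    (fun i => H i i) ∈ Γ ∧ f κ ≤ f (fun i => H i i) := by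
  obtain ⟨w, hw, hw1, -, e⟩ := diag_eq_sum_perm hO hH
  rw [e]
  exact hf.sum_perm_mem hκ hw hw1

/-- Two diagonalizations of the same matrix: the weighted traces with the partial derivatives of
the speed agree. -/
lemma IsConcaveSpeed.sum_grad_conj (hf : IsConcaveSpeed Γ f) {O : Matrix (Fin n) (Fin n) ℝ}
    {κ κ' : Fin n → ℝ} (hO : Oᵀ * O = 1) (hκ : κ ∈ Γ)
    (hH : Oᵀ * Matrix.diagonal κ * O = Matrix.diagonal κ') (B : Matrix (Fin n) (Fin n) ℝ) :
    κ' ∈ Γ ∧ ∑ i, grad f κ' i * (Oᵀ * B * O) i i = ∑ i, grad f κ i * B i i := by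
  have hO' : O * Oᵀ = 1 := mul_eq_one_comm.1 hO
  obtain ⟨w, hw, hw1, hle, -⟩ := diag_eq_sum_perm hO hH
  have hcomm : Matrix.diagonal κ * O = O * Matrix.diagonal κ' := by
    rw [← hH, ← Matrix.mul_assoc, ← Matrix.mul_assoc, hO', Matrix.one_mul]
  -- O intertwines the two diagonal matrices, so it only connects equal eigenvalues.
  have hent : ∀ i j, O i j ≠ 0 → κ i = κ' j := by
    intro i j hij
    have := congrFun (congrFun hcomm i) j
    rw [Matrix.diagonal_mul, Matrix.mul_diagonal, mul_comm] at this
    exact mul_left_cancel₀ hij this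
  -- The weights sum to 1, so one of them is positive; along that permutation every entry of O is
  -- nonzero and the two lists agree.
  obtain ⟨σ, hσ⟩ : ∃ σ, 0 < w σ := by
    by_contra! hcon
    have : ∑ σ, w σ ≤ 0 := Finset.sum_nonpos fun σ _ => hcon σ
    linarith
  have hκσ : κ = κ' ∘ σ := by
    ext i
    refine hent i (σ i) fun h0 => ?_
    have := hle σ i
    rw [h0] at this
    simp only [ne_eq, OfNat.ofNat_ne_zero, not_false_eq_true, zero_pow] at this
    linarith
  have hκ'σ : κ' = κ ∘ σ.symm := by rw [hκσ]; ext; simp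
  have hκ' : κ' ∈ Γ := hκ'σ ▸ hf.perm_mem _ κ hκ
  refine ⟨hκ', ?_⟩
  -- Weights at equal eigenvalues agree, by invariance under the transposition exchanging them, so O
  -- also intertwines the diagonal matrices of weights. The traces then agree by cyclicity.
  have hgrad : ∀ i j, O i j * grad f κ' j = grad f κ i * O i j := by
    intro i j
    by_cases hij : O i j = 0
    · simp [hij]
    have hk : κ' (σ i) = κ' j := by
      rw [← hent i j hij, hκσ]; rfl
    have h1 : grad f κ i = grad f κ' (σ i) := by rw [hκσ, hf.grad_perm hκ']
    have h2 : grad f κ' (σ i) = grad f κ' j := by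
      have := hf.grad_perm hκ' (Equiv.swap (σ i) j) (σ i)
      have e : κ' ∘ Equiv.swap (σ i) j = κ' := by
        ext k
        simp only [Function.comp_apply, Equiv.swap_apply_def]
        split_ifs with h1 h2
        · rw [h1, hk]
        · rw [h2, hk]
        · rfl
      rw [e, Equiv.swap_apply_left] at this
      exact this
    rw [h1, h2, mul_comm]
  have hm : O * Matrix.diagonal (grad f κ') = Matrix.diagonal (grad f κ) * O := by
    ext i j
    rw [Matrix.mul_diagonal, Matrix.diagonal_mul, hgrad]
  have tr : ∀ (d : Fin n → ℝ) (C : Matrix (Fin n) (Fin n) ℝ),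
      ∑ i, d i * C i i = (Matrix.diagonal d * C).trace := by
    intro d C; simp [Matrix.trace, Matrix.diagonal_mul]
  rw [tr, tr, ← Matrix.mul_assoc, Matrix.trace_mul_comm, ← Matrix.mul_assoc, ← Matrix.mul_assoc, hm,
    Matrix.mul_assoc (Matrix.diagonal _), hO', Matrix.mul_one]

lemma exists_orthogonal_diagonalization {H : Matrix (Fin n) (Fin n) ℝ} (hH : H.IsSymm) :
    ∃ (O : Matrix (Fin n) (Fin n) ℝ) (κ : Fin n → ℝ), Oᵀ * O = 1 ∧
      Oᵀ * H * O = Matrix.diagonal κ := by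
  have hH' : H.IsHermitian := by
    rw [Matrix.IsHermitian, Matrix.conjTranspose_eq_transpose_of_trivial]; exact hH
  refine ⟨(hH'.eigenvectorUnitary : Matrix (Fin n) (Fin n) ℝ), hH'.eigenvalues, ?_, ?_⟩
  · have := Unitary.coe_star_mul_self hH'.eigenvectorUnitary
    rwa [Matrix.star_eq_conjTranspose, Matrix.conjTranspose_eq_transpose_of_trivial] at this
  · have := hH'.conjStarAlgAut_star_eigenvectorUnitary
    rw [Unitary.conjStarAlgAut_apply] at this
    simpa [Matrix.star_eq_conjTranspose, Matrix.conjTranspose_eq_transpose_of_trivial,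
      Function.comp_def] using this

end Diagonalization

/-! ### The spectral function: tangent planes and first derivative. -/

section SpectralFunction

open Matrix

variable {n : ℕ} {Γ : Set (Fin n → ℝ)} {f : (Fin n → ℝ) → ℝ}

local notation "𝔼" => EuclideanSpace ℝ (Fin n)

lemma IsFrame.exists_eigenframe {g h : LinearMap.BilinForm ℝ 𝔼} {e : Fin n → 𝔼}
    (he : IsFrame g e) (hs : ∀ u v, h u v = h v u) :
    ∃ (E : Fin n → 𝔼) (κ : Fin n → ℝ), IsFrame g E ∧ formMatrix h E = Matrix.diagonal κ := by
  have hsym : (formMatrix h e).IsSymm := by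
    ext i j; simp [formMatrix, hs (e j) (e i)]
  obtain ⟨O, κ, hO, hd⟩ := exists_orthogonal_diagonalization hsym
  have hfm : frameMatrix g e (fun j => ∑ i, O i j • e i) = O := by
    ext i j
    simp [frameMatrix, map_sum, he i _]
  refine ⟨fun j => ∑ i, O i j • e i, κ, ?_, ?_⟩
  · have := he.formMatrix_eq g (fun j => ∑ i, O i j • e i)
    rw [hfm, he.formMatrix_self, Matrix.mul_one, hO] at this
    intro i j
    have := congrFun (congrFun this i) j
    simpa only [formMatrix, Matrix.of_apply, Matrix.one_apply] using this
  · rw [he.formMatrix_eq, hfm, hd]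

/-- The entries h(E_i, E_i) are the diagonal of a matrix orthogonally conjugate to diag κ, so
Schur's theorem makes them an average of permutations of κ. -/
lemma IsConcaveSpeed.mem_of_isFrame (hf : IsConcaveSpeed Γ f) {g h : LinearMap.BilinForm ℝ 𝔼}
    {κ : Fin n → ℝ} (hκ : IsEigenvalueList (fun u v => g u v) (fun u v => h u v) κ) (hΓ : κ ∈ Γ)
    {E : Fin n → 𝔼} (hE : IsFrame g E) :
    (fun i => h (E i) (E i)) ∈ Γ ∧ f κ ≤ f fun i => h (E i) (E i) := by
  obtain ⟨e, he, hd⟩ := isEigenvalueList_iff.1 hκ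
  have := hE.formMatrix_eq h e
  rw [hd] at this
  exact hf.le_diag (H := formMatrix h E) (hE.transpose_mul he) this.symm hΓ

/-- The tangent plane inequality for the spectral function of a concave speed. -/
lemma IsConcaveSpeed.le_sum_grad (hf : IsConcaveSpeed Γ f) {g h : LinearMap.BilinForm ℝ 𝔼}
    {κ κ₀ : Fin n → ℝ} (hκ : IsEigenvalueList (fun u v => g u v) (fun u v => h u v) κ)
    (hΓ : κ ∈ Γ) (hΓ₀ : κ₀ ∈ Γ) {E : Fin n → 𝔼} (hE : IsFrame g E) :
    f κ ≤ ∑ i, grad f κ₀ i * h (E i) (E i) :=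
  let h := hf.mem_of_isFrame hκ hΓ hE
  h.2.trans (hf.le_grad hΓ₀ h.1)

/-- Each list is the diagonal of h in its own eigenframe, so the preceding inequality applies in
both directions. This makes the arbitrary choice in `eigenvalueList` harmless. -/
lemma IsConcaveSpeed.eq_of_isEigenvalueList (hf : IsConcaveSpeed Γ f)
    {g h : LinearMap.BilinForm ℝ 𝔼} {κ κ' : Fin n → ℝ}
    (hκ : IsEigenvalueList (fun u v => g u v) (fun u v => h u v) κ) (hΓ : κ ∈ Γ)
    (hκ' : IsEigenvalueList (fun u v => g u v) (fun u v => h u v) κ') :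
    κ' ∈ Γ ∧ f κ' = f κ := by
  have diag : ∀ {e : Fin n → 𝔼} {κ : Fin n → ℝ}, formMatrix h e = Matrix.diagonal κ →
      (fun i => h (e i) (e i)) = κ := by
    intro e κ hd
    ext i
    simpa [formMatrix] using congrFun (congrFun hd i) i
  obtain ⟨e, he, hd⟩ := isEigenvalueList_iff.1 hκ
  obtain ⟨e', he', hd'⟩ := isEigenvalueList_iff.1 hκ'
  obtain ⟨h1, h2⟩ := hf.mem_of_isFrame hκ hΓ he'
  rw [diag hd'] at h1 h2
  obtain ⟨-, h3⟩ := hf.mem_of_isFrame hκ' h1 he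
  rw [diag hd] at h3
  exact ⟨h1, le_antisymm h3 h2⟩

lemma IsConcaveSpeed.spectralFun_eq (hf : IsConcaveSpeed Γ f)
    {g h : LinearMap.BilinForm ℝ 𝔼} {κ : Fin n → ℝ}
    (hκ : IsEigenvalueList (fun u v => g u v) (fun u v => h u v) κ) (hΓ : κ ∈ Γ) :
    spectralFun f (fun u v => g u v) (fun u v => h u v) = f κ :=
  (hf.eq_of_isEigenvalueList hκ hΓ (Classical.epsilon_spec ⟨κ, hκ⟩)).2

/-- First order perturbation theory of the spectral function in the direction of a symmetric
form. -/
lemma IsConcaveSpeed.spectral_perturbation (hf : IsConcaveSpeed Γ f)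
    {g h B : LinearMap.BilinForm ℝ 𝔼} (hs : ∀ u v, h u v = h v u) (hB : ∀ u v, B u v = B v u)
    {e : Fin n → 𝔼} {κ : Fin n → ℝ} (he : IsFrame g e)
    (hd : formMatrix h e = Matrix.diagonal κ) (hΓ : κ ∈ Γ) :
    spectralDeriv f (fun u v => g u v) (fun u v => h u v) (fun u v => B u v) =
      ∑ i, grad f κ i * B (e i) (e i) ∧
    ∀ᶠ s in 𝓝 (0 : ℝ), ∃ κ' ∈ Γ,
      IsEigenvalueList (fun u v => g u v) (fun u v => (h + s • B) u v) κ' := by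
  -- An eigenframe of h + sB is chosen for each s separately; nothing is claimed about continuity in
  -- s.
  have hex : ∀ s : ℝ, ∃ (O : Matrix (Fin n) (Fin n) ℝ) (κ' : Fin n → ℝ), Oᵀ * O = 1 ∧
      Oᵀ * (Matrix.diagonal κ + s • formMatrix B e) * O = Matrix.diagonal κ' ∧
      IsEigenvalueList (fun u v => g u v) (fun u v => (h + s • B) u v) κ' := by
    intro s
    have hs' : ∀ u v, (h + s • B) u v = (h + s • B) v u := by
      intro u v; simp [hs u v, hB u v]
    obtain ⟨E, κ', hE, hd'⟩ := he.exists_eigenframe (h := h + s • B) hs'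
    refine ⟨frameMatrix g e E, κ', he.transpose_mul hE, ?_, isEigenvalueList_iff.2 ⟨E, hE, hd'⟩⟩
    rw [← hd', he.formMatrix_eq (h + s • B) E, ← hd]
    congr 2
  choose O κ' hO hOd hlist using hex
  set T := ∑ i, grad f κ i * B (e i) (e i) with hT
  set BM := formMatrix B e with hBM
  have hκlist : IsEigenvalueList (fun u v => g u v) (fun u v => h u v) κ :=
    isEigenvalueList_iff.2 ⟨e, he, hd⟩
  -- along ultrafilters the eigenframes converge to eigenframes of `h`
  have hlim : ∀ U : Ultrafilter ℝ, (U : Filter ℝ) ≤ 𝓝 0 → ∃ κs ∈ Γ,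
      Tendsto κ' U (𝓝 κs) ∧
      Tendsto (fun s => ∑ i, grad f (κ' s) i * ((O s)ᵀ * BM * O s) i i) U (𝓝 T) := by
    intro U hU
    -- Entries of orthogonal matrices lie in [-1, 1], so along an ultrafilter the chosen frames
    -- converge without passing to subsequences.
    have hK : IsCompact (Set.Icc (fun _ _ => -1 : Fin n → Fin n → ℝ) (fun _ _ => 1)) :=
      isCompact_Icc
    have hmem : ∀ s, (O s : Fin n → Fin n → ℝ) ∈
        Set.Icc (fun _ _ => -1 : Fin n → Fin n → ℝ) (fun _ _ => 1) := by
      intro s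
      have : ∀ i j, O s i j ^ 2 ≤ 1 := by
        intro i j
        have h1 := congrFun (congrFun (hO s) j) j
        simp only [Matrix.mul_apply, Matrix.transpose_apply, Matrix.one_apply_eq] at h1
        rw [← h1, sq]
        exact Finset.single_le_sum (f := fun k => O s k j * O s k j)
          (fun k _ => mul_self_nonneg _) (Finset.mem_univ i)
      exact ⟨fun i j => (abs_le.1 ((sq_le_one_iff_abs_le_one _).1 (this i j))).1,
        fun i j => (abs_le.1 ((sq_le_one_iff_abs_le_one _).1 (this i j))).2⟩
    obtain ⟨O₁, -, hO₁⟩ := hK.ultrafilter_le_nhds' (U.map (fun s => (O s : Fin n → Fin n → ℝ)))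
      (Filter.Eventually.of_forall (f := (U : Filter ℝ)) hmem)
    obtain ⟨O', hOt⟩ : ∃ O' : Matrix (Fin n) (Fin n) ℝ, Tendsto O U (𝓝 O') := ⟨O₁, hO₁⟩
    have hOt' : Tendsto (fun s => (O s)ᵀ) U (𝓝 (O'ᵀ)) :=
      (continuous_id.matrix_transpose.tendsto O').comp hOt
    have hst : Tendsto (fun s : ℝ => s) U (𝓝 0) := hU
    have h1 : O'ᵀ * O' = 1 := by
      refine tendsto_nhds_unique (hOt'.mul hOt) ?_
      simp only [hO]; exact tendsto_const_nhds
    have hsum : Tendsto (fun s : ℝ => Matrix.diagonal κ + s • BM) U (𝓝 (Matrix.diagonal κ)) := by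
      simpa using (hst.smul_const BM).const_add (Matrix.diagonal κ)
    have h2 : Tendsto (fun s => Matrix.diagonal (κ' s)) U
        (𝓝 (O'ᵀ * Matrix.diagonal κ * O')) := by
      have := (hOt'.mul hsum).mul hOt
      simpa only [hOd] using this
    set κs : Fin n → ℝ := fun i =>
      (O'ᵀ * Matrix.diagonal κ * O') i i with hκs
    have hent : ∀ i j, Tendsto (fun s => Matrix.diagonal (κ' s) i j) U
        (𝓝 ((O'ᵀ * Matrix.diagonal κ * O') i j)) :=
      fun i j => (tendsto_pi_nhds.1 ((tendsto_pi_nhds.1 h2) i)) j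
    have h3 : O'ᵀ * Matrix.diagonal κ * O' =
        Matrix.diagonal κs := by
      ext i j
      by_cases hij : i = j
      · subst hij; rw [Matrix.diagonal_apply_eq]
      · rw [Matrix.diagonal_apply_ne _ hij]
        refine tendsto_nhds_unique (hent i j) ?_
        simp only [Matrix.diagonal_apply_ne _ hij]; exact tendsto_const_nhds
    have h4 : Tendsto κ' U (𝓝 κs) := by
      refine tendsto_pi_nhds.2 fun i => ?_
      have := hent i i
      simpa only [Matrix.diagonal_apply_eq] using this
    obtain ⟨h5, h6⟩ := hf.sum_grad_conj h1 hΓ h3 BM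
    refine ⟨κs, h5, h4, ?_⟩
    have h7 : T = ∑ i, grad f κs i * (O'ᵀ * BM * O') i i := by
      rw [h6, hT]; rfl
    rw [h7]
    refine tendsto_finsetSum _ fun i _ => ?_
    refine Tendsto.mul ((hf.continuousAt_grad h5 i).tendsto.comp h4) ?_
    have := (hOt'.mul (tendsto_const_nhds (x := BM))).mul hOt
    exact (tendsto_pi_nhds.1 ((tendsto_pi_nhds.1 this) i)) i
  -- Along every ultrafilter converging to 0 the lists converge to a point of the open set Γ.
  have hmem : ∀ᶠ s in 𝓝 (0 : ℝ), κ' s ∈ Γ := by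
    rw [Filter.eventually_iff, Filter.mem_iff_ultrafilter]
    intro U hU
    obtain ⟨κs, h1, h2, -⟩ := hlim U hU
    exact h2.eventually (hf.isOpen.mem_nhds h1)
  have hTt : Tendsto (fun s => ∑ i, grad f (κ' s) i * ((O s)ᵀ * BM * O s) i i) (𝓝 0) (𝓝 T) := by
    rw [tendsto_iff_ultrafilter]
    intro U hU
    exact (hlim U hU).choose_spec.2.2
  -- values near zero
  have hval : ∀ᶠ s in 𝓝 (0 : ℝ),
      spectralFun f (fun u v => g u v) (fun u v => h u v + s * B u v) = f (κ' s) := by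
    filter_upwards [hmem] with s hs
    exact hf.spectralFun_eq (h := h + s • B) (hlist s) hs
  have hval0 : spectralFun f (fun u v => g u v) (fun u v => h u v + 0 * B u v) = f κ := by
    have := hf.spectralFun_eq hκlist hΓ
    simpa using this
  -- Tangent plane at κ, evaluated on h + sB in the fixed frame e.
  have hupper : ∀ᶠ s in 𝓝 (0 : ℝ), f (κ' s) - f κ ≤ s * T := by
    filter_upwards [hmem] with s hs
    have := hf.le_sum_grad (hlist s) hs hΓ he
    have e1 : ∑ i, grad f κ i * (h + s • B) (e i) (e i) = f κ + s * T := by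
      rw [← hf.euler hΓ, hT, Finset.mul_sum, ← Finset.sum_add_distrib]
      refine Finset.sum_congr rfl fun i _ => ?_
      have : h (e i) (e i) = κ i := by
        simpa [formMatrix] using congrFun (congrFun hd i) i
      simp only [LinearMap.add_apply, LinearMap.smul_apply, smul_eq_mul, this]; ring
    linarith
  -- Tangent plane at κ'(s), evaluated on h in the eigenframe of h + sB. The slope it produces
  -- converges to T, although the frames themselves need not converge.
  have hlower : ∀ᶠ s in 𝓝 (0 : ℝ),
      s * (∑ i, grad f (κ' s) i * ((O s)ᵀ * BM * O s) i i) ≤ f (κ' s) - f κ := by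
    filter_upwards [hmem] with s hs
    have hOO : (O s) * (O s)ᵀ = 1 := mul_eq_one_comm.1 (hO s)
    have h1 : (O s)ᵀᵀ * ((O s)ᵀ * Matrix.diagonal κ * O s) * (O s)ᵀ = Matrix.diagonal κ := by
      rw [Matrix.transpose_transpose]
      calc _ = (O s * (O s)ᵀ) * Matrix.diagonal κ * (O s * (O s)ᵀ) := by
              simp only [Matrix.mul_assoc]
        _ = _ := by rw [hOO, Matrix.one_mul, Matrix.mul_one]
    obtain ⟨h2, h3⟩ := hf.le_diag (O := (O s)ᵀ) (by rwa [Matrix.transpose_transpose]) h1 hΓ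
    have h4 := hf.le_grad hs h2
    have h5 : ∀ i, ((O s)ᵀ * Matrix.diagonal κ * O s) i i =
        κ' s i - s * ((O s)ᵀ * BM * O s) i i := by
      intro i
      have := congrFun (congrFun (hOd s) i) i
      rw [Matrix.mul_add, Matrix.add_mul, Matrix.mul_smul, Matrix.smul_mul, Matrix.add_apply,
        Matrix.smul_apply, Matrix.diagonal_apply_eq, smul_eq_mul] at this
      linarith
    simp only [h5, mul_sub, Finset.sum_sub_distrib] at h4
    rw [hf.euler hs] at h4
    have h6 : ∑ i, grad f (κ' s) i * (s * ((O s)ᵀ * BM * O s) i i) =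
        s * ∑ i, grad f (κ' s) i * ((O s)ᵀ * BM * O s) i i := by
      rw [Finset.mul_sum]; exact Finset.sum_congr rfl fun i _ => by ring
    rw [h6] at h4
    simp only [h5] at h3
    linarith
  refine ⟨HasDerivAt.deriv ?_, hmem.mono fun s hs => ⟨κ' s, hs, hlist s⟩⟩
  rw [hasDerivAt_iff_isLittleO]
  -- The two bounds enclose the increment between s times the moving slope and sT, so the error is
  -- at most |s| times a quantity tending to 0.
  have ho : (fun s : ℝ => s * ((∑ i, grad f (κ' s) i * ((O s)ᵀ * BM * O s) i i) - T))
      =o[𝓝 0] fun s : ℝ => s - 0 := by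
    have : Tendsto (fun s => (∑ i, grad f (κ' s) i * ((O s)ᵀ * BM * O s) i i) - T)
        (𝓝 0) (𝓝 0) := by simpa using hTt.sub_const T
    have h1 := (Asymptotics.isBigO_refl (fun s : ℝ => s) (𝓝 0)).mul_isLittleO
      ((Asymptotics.isLittleO_one_iff ℝ).2 this)
    simpa using h1
  refine Asymptotics.IsBigO.trans_isLittleO ?_ ho
  refine Asymptotics.IsBigO.of_bound 1 ?_
  filter_upwards [hval, hupper, hlower] with s h1 h2 h3
  rw [h1, hval0, one_mul, Real.norm_eq_abs, Real.norm_eq_abs, abs_le, smul_eq_mul, sub_zero]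
  rw [mul_sub, abs_of_nonpos (by linarith)]
  constructor <;> linarith

/-- The derivative of the spectral function in the direction of a symmetric form. -/
lemma IsConcaveSpeed.spectralDeriv_eq (hf : IsConcaveSpeed Γ f)
    {g h B : LinearMap.BilinForm ℝ 𝔼} (hs : ∀ u v, h u v = h v u) (hB : ∀ u v, B u v = B v u)
    {e : Fin n → 𝔼} {κ : Fin n → ℝ} (he : IsFrame g e)
    (hd : formMatrix h e = Matrix.diagonal κ) (hΓ : κ ∈ Γ) :
    spectralDeriv f (fun u v => g u v) (fun u v => h u v) (fun u v => B u v) =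
      ∑ i, grad f κ i * B (e i) (e i) :=
  (hf.spectral_perturbation hs hB he hd hΓ).1

end SpectralFunction

lemma two_le_infty : (2 : WithTop ℕ∞) ≤ ∞ := by
  exact WithTop.coe_le_coe.2 le_top

lemma one_le_infty : (1 : WithTop ℕ∞) ≤ ∞ := by
  exact WithTop.coe_le_coe.2 le_top

/-! ### Directional derivatives and tests at minima. -/

section DirectionalDerivatives

variable {V W W₁ W₂ : Type*} [NormedAddCommGroup V] [NormedSpace ℝ V]
  [NormedAddCommGroup W] [NormedSpace ℝ W] [NormedAddCommGroup W₁] [NormedSpace ℝ W₁]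
  [NormedAddCommGroup W₂] [NormedSpace ℝ W₂]

/-- The directional derivative, as an operator on functions. -/
def dirDeriv (v : V) (A : V → W) : V → W := fun z => fderiv ℝ A z v

lemma contDiffAt_dirDeriv {m k : WithTop ℕ∞} {A : V → W} {o : V} (hA : ContDiffAt ℝ k A o)
    (hm : m + 1 ≤ k) (v : V) : ContDiffAt ℝ m (dirDeriv v A) o :=
  (hA.fderiv_right hm).clm_apply contDiffAt_const

lemma contDiffAt_infty_dirDeriv {A : V → W} {o : V} (hA : ContDiffAt ℝ ∞ A o) (v : V) :
    ContDiffAt ℝ ∞ (dirDeriv v A) o :=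
  contDiffAt_dirDeriv hA (by simp) v

lemma dirDeriv_congr {A B : V → W} {o : V} (h : A =ᶠ[𝓝 o] B) (v : V) :
    dirDeriv v A =ᶠ[𝓝 o] dirDeriv v B := by
  filter_upwards [h.fderiv (𝕜 := ℝ)] with z hz
  rw [dirDeriv, dirDeriv, hz]

lemma dirDeriv_const (c : W) (v : V) : dirDeriv v (fun _ : V => c) = fun _ => 0 := by
  ext z; simp [dirDeriv]

lemma dirDeriv_add {A B : V → W} {o : V} (hA : DifferentiableAt ℝ A o)
    (hB : DifferentiableAt ℝ B o) (v : V) :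
    dirDeriv v (fun z => A z + B z) o = dirDeriv v A o + dirDeriv v B o := by
  simp [dirDeriv, fderiv_fun_add hA hB]

lemma dirDeriv_sub {A B : V → W} {o : V} (hA : DifferentiableAt ℝ A o)
    (hB : DifferentiableAt ℝ B o) (v : V) :
    dirDeriv v (fun z => A z - B z) o = dirDeriv v A o - dirDeriv v B o := by
  simp [dirDeriv, fderiv_fun_sub hA hB]

lemma dirDeriv_clm (L : W →L[ℝ] W₁) {A : V → W} {o : V} (hA : DifferentiableAt ℝ A o) (v : V) :
    dirDeriv v (fun z => L (A z)) o = L (dirDeriv v A o) := by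
  have := (L.hasFDerivAt.comp o hA.hasFDerivAt).fderiv
  change fderiv ℝ (L ∘ A) o v = _
  rw [this]; rfl

lemma eventually_differentiableAt {k : WithTop ℕ∞} {A : V → W} {o : V} (hA : ContDiffAt ℝ k A o)
    (hk : 1 ≤ k) : ∀ᶠ z in 𝓝 o, DifferentiableAt ℝ A z := by
  filter_upwards [(hA.of_le hk).eventually (by simp)] with z hz
  exact hz.differentiableAt (by simp)

lemma dirDeriv_dirDeriv_clm (L : W →L[ℝ] W₁) {A : V → W} {o : V} (hA : ContDiffAt ℝ 2 A o)
    (u v : V) : dirDeriv u (dirDeriv v (fun z => L (A z))) o = L (dirDeriv u (dirDeriv v A) o) := by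
  have h : dirDeriv v (fun z => L (A z)) =ᶠ[𝓝 o] fun z => L (dirDeriv v A z) := by
    filter_upwards [eventually_differentiableAt hA (by norm_num)] with z hz
    exact dirDeriv_clm L hz v
  rw [(dirDeriv_congr h u).self_of_nhds, dirDeriv_clm]
  exact (contDiffAt_dirDeriv hA (m := 1) (by norm_num) v).differentiableAt (by simp)

lemma dirDeriv_dirDeriv_sub {A B : V → W} {o : V} (hA : ContDiffAt ℝ 2 A o)
    (hB : ContDiffAt ℝ 2 B o) (u v : V) :
    dirDeriv u (dirDeriv v (fun z => A z - B z)) o =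
      dirDeriv u (dirDeriv v A) o - dirDeriv u (dirDeriv v B) o := by
  have h : dirDeriv v (fun z => A z - B z) =ᶠ[𝓝 o] fun z => dirDeriv v A z - dirDeriv v B z := by
    filter_upwards [eventually_differentiableAt hA (by norm_num),
      eventually_differentiableAt hB (by norm_num)] with z hz hz'
    exact dirDeriv_sub hz hz' v
  rw [(dirDeriv_congr h u).self_of_nhds, dirDeriv_sub]
  · exact (contDiffAt_dirDeriv hA (m := 1) (by norm_num) v).differentiableAt (by simp)
  · exact (contDiffAt_dirDeriv hB (m := 1) (by norm_num) v).differentiableAt (by simp)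

lemma dirDeriv_comm {A : V → W} {o : V} (hA : ContDiffAt ℝ 2 A o) (u v : V) :
    dirDeriv u (dirDeriv v A) o = dirDeriv v (dirDeriv u A) o := by
  have hd : DifferentiableAt ℝ (fderiv ℝ A) o :=
    (hA.fderiv_right (m := 1) (by norm_num)).differentiableAt (by simp)
  have e : ∀ u v : V, dirDeriv u (dirDeriv v A) o = fderiv ℝ (fderiv ℝ A) o u v := by
    intro u v
    have := (hd.hasFDerivAt.clm_apply (hasFDerivAt_const v o)).fderiv
    change fderiv ℝ (fun z => fderiv ℝ A z v) o u = _
    rw [this]; simp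
  rw [e, e]
  exact (hA.isSymmSndFDerivAt (by simp)) u v

lemma dirDeriv_comm_eventually {A : V → W} {o : V} (hA : ContDiffAt ℝ ∞ A o) (u v : V) :
    dirDeriv u (dirDeriv v A) =ᶠ[𝓝 o] dirDeriv v (dirDeriv u A) := by
  filter_upwards [(hA.of_le two_le_infty).eventually
    (by simp)] with z hz
  exact dirDeriv_comm hz u v

lemma dirDeriv_bilin (L : W →L[ℝ] W₁ →L[ℝ] W₂) {A : V → W} {B : V → W₁} {o : V}
    (hA : DifferentiableAt ℝ A o) (hB : DifferentiableAt ℝ B o) (v : V) :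
    dirDeriv v (fun z => L (A z) (B z)) o = L (dirDeriv v A o) (B o) + L (A o) (dirDeriv v B o) := by
  have := L.fderiv_of_bilinear hA hB
  change fderiv ℝ (fun z => L (A z) (B z)) o v = _
  rw [this]
  simp [dirDeriv, add_comm]

lemma dirDeriv_bilin_eventually (L : W →L[ℝ] W₁ →L[ℝ] W₂) {A : V → W} {B : V → W₁} {o : V}
    {k : WithTop ℕ∞} (hA : ContDiffAt ℝ k A o) (hB : ContDiffAt ℝ k B o) (hk : 1 ≤ k) (v : V) :
    dirDeriv v (fun z => L (A z) (B z)) =ᶠ[𝓝 o]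
      fun z => L (dirDeriv v A z) (B z) + L (A z) (dirDeriv v B z) := by
  filter_upwards [eventually_differentiableAt hA hk, eventually_differentiableAt hB hk]
    with z hz hz'
  exact dirDeriv_bilin L hz hz' v

lemma dirDeriv_dirDeriv_bilin (L : W →L[ℝ] W₁ →L[ℝ] W₂) {A : V → W} {B : V → W₁} {o : V}
    (hA : ContDiffAt ℝ 2 A o) (hB : ContDiffAt ℝ 2 B o) (u v : V) :
    dirDeriv u (dirDeriv v (fun z => L (A z) (B z))) o =
      L (dirDeriv u (dirDeriv v A) o) (B o) + L (dirDeriv v A o) (dirDeriv u B o) +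
      (L (dirDeriv u A o) (dirDeriv v B o) + L (A o) (dirDeriv u (dirDeriv v B) o)) := by
  have dA : DifferentiableAt ℝ A o := hA.differentiableAt (by simp)
  have dB : DifferentiableAt ℝ B o := hB.differentiableAt (by simp)
  have dA' : DifferentiableAt ℝ (dirDeriv v A) o :=
    (contDiffAt_dirDeriv hA (m := 1) (by norm_num) v).differentiableAt (by simp)
  have dB' : DifferentiableAt ℝ (dirDeriv v B) o :=
    (contDiffAt_dirDeriv hB (m := 1) (by norm_num) v).differentiableAt (by simp)
  rw [(dirDeriv_congr (dirDeriv_bilin_eventually L hA hB (by norm_num) v) u).self_of_nhds,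
    dirDeriv_add, dirDeriv_bilin L dA' dB, dirDeriv_bilin L dA dB']
  · exact (L.hasFDerivAt.comp o dA'.hasFDerivAt).differentiableAt.clm_apply dB
  · exact (L.hasFDerivAt.comp o dA.hasFDerivAt).differentiableAt.clm_apply dB'

/-- A negative second derivative would make the point a local maximum as well, hence the function
locally constant, with second derivative zero. -/
lemma deriv_deriv_nonneg_of_isLocalMin {r : ℝ → ℝ} {s : ℝ} (hr : ContDiffAt ℝ 2 r s)
    (hmin : IsLocalMin r s) : 0 ≤ deriv (deriv r) s := by
  by_contra! hneg
  have hmax := isLocalMax_of_deriv_deriv_neg hneg hmin.deriv_eq_zero hr.continuousAt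
  have hconst : r =ᶠ[𝓝 s] fun _ => r s := by
    filter_upwards [hmin, hmax] with z h1 h2
    exact le_antisymm h2 h1
  have : deriv (deriv r) s = 0 := by
    rw [hconst.deriv.deriv_eq]; simp
  linarith

lemma hasDerivAt_line_dirDeriv {A : V → W} {o : V} {v : V} {s : ℝ}
    (hA : DifferentiableAt ℝ A (o + s • v)) :
    HasDerivAt (fun s : ℝ => A (o + s • v)) (dirDeriv v A (o + s • v)) s := by
  have h1 : HasDerivAt (fun s : ℝ => o + s • v) v s := by
    simpa using ((hasDerivAt_id s).smul_const v).const_add o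
  exact hA.hasFDerivAt.comp_hasDerivAt s h1

lemma tendsto_line (o v : V) : Tendsto (fun s : ℝ => o + s • v) (𝓝 0) (𝓝 o) := by
  have : Continuous fun s : ℝ => o + s • v := by fun_prop
  simpa using this.tendsto 0

lemma deriv_deriv_line {A : V → W} {o : V} (hA : ContDiffAt ℝ 2 A o) (v : V) :
    deriv (deriv fun s : ℝ => A (o + s • v)) 0 = dirDeriv v (dirDeriv v A) o := by
  have h1 : (deriv fun s : ℝ => A (o + s • v)) =ᶠ[𝓝 0] fun s => dirDeriv v A (o + s • v) := by
    filter_upwards [(tendsto_line o v).eventually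
      (eventually_differentiableAt hA (by norm_num))] with s hs
    exact (hasDerivAt_line_dirDeriv hs).deriv
  rw [h1.deriv_eq]
  have h2 : DifferentiableAt ℝ (dirDeriv v A) (o + (0 : ℝ) • v) := by
    simpa using (contDiffAt_dirDeriv hA (m := 1) (by norm_num) v).differentiableAt (by simp)
  simpa using (hasDerivAt_line_dirDeriv h2).deriv

lemma dirDeriv_of_line_min {A : V → ℝ} {o v : V} (hA : ContDiffAt ℝ 2 A o)
    (hmin : ∀ᶠ s : ℝ in 𝓝 0, A o ≤ A (o + s • v)) :
    dirDeriv v A o = 0 ∧ 0 ≤ dirDeriv v (dirDeriv v A) o := by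
  have hmin' : IsLocalMin (fun s : ℝ => A (o + s • v)) 0 := by
    filter_upwards [hmin] with s hs
    simpa using hs
  have hc : ContDiffAt ℝ 2 (fun s : ℝ => A (o + s • v)) 0 := by
    have : ContDiffAt ℝ 2 A (o + (0 : ℝ) • v) := by simpa using hA
    exact ContDiffAt.comp (g := A) (0 : ℝ) this (by fun_prop)
  constructor
  · have h2 : DifferentiableAt ℝ A (o + (0 : ℝ) • v) := by
      simpa using hA.differentiableAt (by simp)
    have := hmin'.deriv_eq_zero
    rw [(hasDerivAt_line_dirDeriv h2).deriv] at this
    simpa using this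
  · rw [← deriv_deriv_line hA]
    exact deriv_deriv_nonneg_of_isLocalMin hc hmin'

/-- Test functions are compared only in the past, so the time derivative gets a sign instead of
vanishing. -/
lemma dirDeriv_nonpos_of_left_min {A : V → ℝ} {o v : V} (hA : DifferentiableAt ℝ A o)
    (hmin : ∀ᶠ s : ℝ in 𝓝[<] 0, A o ≤ A (o + s • v)) : dirDeriv v A o ≤ 0 := by
  have h2 : DifferentiableAt ℝ A (o + (0 : ℝ) • v) := by simpa using hA
  have h := (hasDerivAt_line_dirDeriv h2).tendsto_slope_zero_left
  simp only [zero_smul, add_zero, zero_add] at h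
  refine le_of_tendsto h ?_
  filter_upwards [hmin, self_mem_nhdsWithin] with s hs hs0
  have hs0 : s < 0 := hs0
  rw [smul_eq_mul]
  exact mul_nonpos_of_nonpos_of_nonneg (inv_nonpos.2 hs0.le) (by linarith)

end DirectionalDerivatives

/-! ### A smooth inverse square root near the identity. -/

section InverseSquareRoot

variable {R : Type*} [NormedRing R] [NormedAlgebra ℝ R] [CompleteSpace R] [StarRing R]
  [ContinuousStar R]

/-- A smooth inverse square root near the identity of a Banach star algebra. -/
lemma exists_smooth_inverse_sqrt : ∃ β : R → R, ContDiffAt ℝ ∞ β 1 ∧ β 1 = 1 ∧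
    ∀ᶠ x in 𝓝 (1 : R), IsSelfAdjoint x → IsSelfAdjoint (β x) ∧ β x * x * β x = 1 := by
  let sq : R → R := fun y => y * y
  have hsq : ContDiffAt ℝ ∞ sq 1 := contDiffAt_id.mul contDiffAt_id
  let e : R ≃L[ℝ] R := ContinuousLinearEquiv.smulLeft (Units.mk0 (2 : ℝ) (by norm_num))
  -- Squaring has derivative 2·id at 1, so the inverse function theorem supplies a smooth local
  -- square root γ, and β is γ after inversion.
  have he : HasFDerivAt sq (e : R →L[ℝ] R) 1 := by
    have := (hasFDerivAt_id (𝕜 := ℝ) (1 : R)).mul' (hasFDerivAt_id (𝕜 := ℝ) (1 : R))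
    refine this.congr_fderiv ?_
    ext y
    simp only [e, id, add_apply,
      ContinuousLinearMap.coe_id', MulOpposite.op_one, one_smul, ContinuousLinearEquiv.coe_coe,
      ContinuousLinearEquiv.smulLeft_apply_apply, Units.smul_def, Units.val_mk0, two_smul]
  have hn : (∞ : WithTop ℕ∞) ≠ 0 := by simp
  have hstrict := hsq.hasStrictFDerivAt' he hn
  let γ : R → R := hsq.localInverse he hn
  have h1 : sq 1 = 1 := by simp [sq]
  have hγ : ContDiffAt ℝ ∞ γ 1 := by
    have := hsq.to_localInverse he hn
    rwa [h1] at this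
  have hγ1 : γ 1 = 1 := by
    have := hsq.localInverse_apply_image he hn
    rwa [h1] at this
  have hr : ∀ᶠ y in 𝓝 (1 : R), γ y * γ y = y := by
    have := hstrict.eventually_right_inverse
    rw [h1] at this
    exact this
  have hl : ∀ᶠ y in 𝓝 (1 : R), γ (y * y) = y := hstrict.eventually_left_inverse
  have hinv : ContDiffAt ℝ ∞ (Ring.inverse : R → R) 1 := by
    simpa using contDiffAt_ringInverse ℝ (1 : Rˣ) (n := ∞)
  have hinv1 : Ring.inverse (1 : R) = 1 := Ring.inverse_one R
  have hβ : ContDiffAt ℝ ∞ (fun x => γ (Ring.inverse x)) (1 : R) :=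
    ContDiffAt.comp (1 : R) (g := γ) (by rwa [hinv1]) hinv
  have ti : Tendsto (Ring.inverse : R → R) (𝓝 1) (𝓝 1) := by
    have := hinv.continuousAt.tendsto
    rwa [hinv1] at this
  have tb : Tendsto (fun x : R => star (γ (Ring.inverse x))) (𝓝 1) (𝓝 1) := by
    have := hβ.continuousAt.star.tendsto
    rwa [hinv1, hγ1, star_one] at this
  refine ⟨fun x => γ (Ring.inverse x), hβ, by simp [hγ1], ?_⟩
  filter_upwards [ti.eventually hr, tb.eventually hl, Units.nhds (1 : Rˣ)] with x h2 h3 hu hx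
  obtain ⟨u, rfl⟩ := hu
  set b := γ (Ring.inverse (u : R)) with hb
  rw [Ring.inverse_unit] at h2
  -- Both b and star b are close to 1 and square to u⁻¹; local uniqueness of the square root
  -- identifies them.
  have hsb : star b = b := by
    rw [← h3, ← star_mul, h2, hb, Ring.inverse_unit]
    congr 1
    have hu : star (u : R) = u := hx
    have : star ((u⁻¹ : Rˣ) : R) * (u : R) = 1 := by
      conv_lhs => rw [← hu]
      rw [← star_mul, Units.mul_inv, star_one]
    exact Units.mul_eq_one_iff_eq_inv.1 this
  refine ⟨hsb, ?_⟩
  have hub : (u : R) * (b * b) = 1 := by rw [h2]; simp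
  have hbu : (b * b) * (u : R) = 1 := by rw [h2]; simp
  -- The unit u is the inverse of b², so it commutes with b.
  have hc : b * u = u * b := by
    calc b * u = (u * (b * b)) * (b * u) := by rw [hub, one_mul]
      _ = u * b * ((b * b) * u) := by simp only [mul_assoc]
      _ = u * b := by rw [hbu, mul_one]
  rw [hc, mul_assoc, hub]

end InverseSquareRoot

/-! ### Second order information on the speed without second derivatives of f. -/

section SpectralSecondOrder

variable {n : ℕ}

local notation "𝔼" => EuclideanSpace ℝ (Fin n)

/-- The standard basis vectors. -/
def stdVec (i : Fin n) : 𝔼 := EuclideanSpace.basisFun (Fin n) ℝ i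

lemma inner_stdVec (i j : Fin n) : inner ℝ (stdVec i) (stdVec j) = if i = j then (1 : ℝ) else 0 :=
  (orthonormal_iff_ite.1 (EuclideanSpace.basisFun (Fin n) ℝ).orthonormal) i j

lemma sum_stdVec (u : 𝔼) : ∑ i, u i • stdVec i = u := by
  have := (EuclideanSpace.basisFun (Fin n) ℝ).sum_repr u
  simpa [stdVec] using this

lemma stdVec_apply (i j : Fin n) : stdVec i j = if j = i then (1 : ℝ) else 0 := by
  simp [stdVec]

lemma eq_of_inner_stdVec {x y : 𝔼}
    (h : ∀ i, inner ℝ x (stdVec i) = inner ℝ y (stdVec i)) : x = y := by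
  ext i
  simpa [stdVec, EuclideanSpace.basisFun_apply, EuclideanSpace.inner_single_right] using h i

section

variable {V : Type*} [NormedAddCommGroup V] [NormedSpace ℝ V]

/-- Every cross term contains the first derivative of a, which vanishes. -/
lemma dirDeriv_mul_mul_of_eq_zero {R : Type*} [NormedRing R] [NormedAlgebra ℝ R]
    {a h : V → R} {o v : V} (ha : ContDiffAt ℝ 2 a o)
    (hh : ContDiffAt ℝ 2 h o) (ha1 : a o = 1) (hav : dirDeriv v a o = 0) :
    dirDeriv v (fun z => a z * h z * a z) o = dirDeriv v h o ∧
    dirDeriv v (dirDeriv v fun z => a z * h z * a z) o =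
      dirDeriv v (dirDeriv v a) o * h o + dirDeriv v (dirDeriv v h) o +
        h o * dirDeriv v (dirDeriv v a) o := by
  let L := ContinuousLinearMap.mul ℝ R
  have dah : ContDiffAt ℝ 2 (fun z => a z * h z) o := ha.mul hh
  have e0 : dirDeriv v (fun z => a z * h z) o = dirDeriv v h o := by
    have := dirDeriv_bilin L (ha.differentiableAt (by simp)) (hh.differentiableAt (by simp)) v
    simpa [L, hav, ha1] using this
  have e1 := dirDeriv_bilin L (dah.differentiableAt (by simp)) (ha.differentiableAt (by simp)) v
  have e2 := dirDeriv_dirDeriv_bilin L ha hh v v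
  have e3 := dirDeriv_dirDeriv_bilin L dah ha v v
  simp only [L, ContinuousLinearMap.mul_apply', hav, ha1, e0, mul_zero, zero_mul, add_zero,
    zero_add, one_mul, mul_one] at e1 e2 e3
  exact ⟨e1, by rw [e3, e2]⟩

/-- Differentiating a h a = 1 at the identity gives 2a' + h' = 0. -/
lemma dirDeriv_eq_zero_of_mul_mul_eq_one {R : Type*} [NormedRing R] [NormedAlgebra ℝ R]
    {a h : V → R} {o v : V} (ha : DifferentiableAt ℝ a o) (hh : DifferentiableAt ℝ h o)
    (ha1 : a o = 1) (hh1 : h o = 1) (hhv : dirDeriv v h o = 0)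
    (hah : (fun z => a z * h z * a z) =ᶠ[𝓝 o] fun _ => 1) : dirDeriv v a o = 0 := by
  let L := ContinuousLinearMap.mul ℝ R
  have d1 := dirDeriv_bilin L ha hh v
  have d2 := dirDeriv_bilin L (ha.mul hh) ha v
  have d3 := (dirDeriv_congr hah v).self_of_nhds
  rw [dirDeriv_const] at d3
  have d1' : dirDeriv v (a * h) o = dirDeriv v a o := by
    refine d1.trans ?_
    simp [L, hhv, hh1]
  rw [d1'] at d2
  have d4 : dirDeriv v a o + dirDeriv v a o = 0 := by
    refine Eq.trans ?_ (d2.symm.trans d3)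
    simp [L, ha1, hh1]
  rw [← two_smul ℝ] at d4
  exact (smul_eq_zero.1 d4).resolve_left (by norm_num)

/-- First and second order information on a function which is dominated by weighted traces of `H`
in the orthonormal frames of `G`, with equality at `o`. -/
lemma spectral_second_order {G H : V → (𝔼 →L[ℝ] 𝔼)} {Fn : V → ℝ} {o v : V} {w κ : Fin n → ℝ}
    (hG : ContDiffAt ℝ 2 G o) (hH : ContDiffAt ℝ 2 H o) (hF : ContDiffAt ℝ 2 Fn o)
    (hG0 : G o = 1) (hGv : dirDeriv v G o = 0) (hsa : ∀ᶠ z in 𝓝 o, IsSelfAdjoint (G z))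
    (hH0 : ∀ i, H o (stdVec i) = κ i • stdVec i) (hHsa : IsSelfAdjoint (H o))
    (hle : ∀ᶠ z in 𝓝 o, ∀ b : 𝔼 →L[ℝ] 𝔼, IsSelfAdjoint b → b * G z * b = 1 →
      Fn z ≤ ∑ i, w i * inner ℝ ((b * H z * b) (stdVec i)) (stdVec i))
    (heq : Fn o = ∑ i, w i * κ i) :
    dirDeriv v Fn o = ∑ i, w i * inner ℝ (dirDeriv v H o (stdVec i)) (stdVec i) ∧
    dirDeriv v (dirDeriv v Fn) o ≤
      ∑ i, w i * (inner ℝ (dirDeriv v (dirDeriv v H) o (stdVec i)) (stdVec i) -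
        κ i * inner ℝ (dirDeriv v (dirDeriv v G) o (stdVec i)) (stdVec i)) := by
  obtain ⟨β, hβ, hβ1, hβs⟩ := exists_smooth_inverse_sqrt (R := 𝔼 →L[ℝ] 𝔼)
  -- The map b = G^{-1/2} sends the standard basis to a smoothly moving G-orthonormal frame.
  -- Comparison in this frame makes the weighted trace minus Fn a C² function with a minimum at o.
  let b : V → (𝔼 →L[ℝ] 𝔼) := fun z => β (G z)
  have hb : ContDiffAt ℝ 2 b o :=
    ContDiffAt.comp o (g := β) (by rw [hG0]; exact hβ.of_le two_le_infty) hG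
  have hb1 : b o = 1 := by simp [b, hG0, hβ1]
  have hGt : Tendsto G (𝓝 o) (𝓝 1) := by
    have := hG.continuousAt.tendsto
    rwa [hG0] at this
  have hbG : (fun z => b z * G z * b z) =ᶠ[𝓝 o] fun _ => 1 := by
    filter_upwards [hGt.eventually hβs, hsa] with z h1 h2 using (h1 h2).2
  have hbv : dirDeriv v b o = 0 := dirDeriv_eq_zero_of_mul_mul_eq_one
    (hb.differentiableAt (by simp)) (hG.differentiableAt (by simp)) hb1 hG0 hGv hbG
  obtain ⟨-, hG2⟩ := dirDeriv_mul_mul_of_eq_zero hb hG hb1 hbv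
  obtain ⟨hH1, hH2⟩ := dirDeriv_mul_mul_of_eq_zero hb hH hb1 hbv
  set bvv := dirDeriv v (dirDeriv v b) o with hbvv
  -- Second derivative of b G b = 1 at o, where b' = 0: G'' = -2b''.
  have hGvv : dirDeriv v (dirDeriv v G) o = -(bvv + bvv) := by
    have d3 := (dirDeriv_congr (dirDeriv_congr hbG v) v).self_of_nhds
    rw [dirDeriv_const, dirDeriv_const, hG2, hG0, mul_one, one_mul] at d3
    have d4 : bvv + dirDeriv v (dirDeriv v G) o + bvv = 0 := d3
    rw [eq_neg_iff_add_eq_zero, ← d4]; abel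
  let ℓ : Fin n → (𝔼 →L[ℝ] 𝔼) →L[ℝ] ℝ := fun i =>
    (innerSL ℝ (stdVec i)).comp (ContinuousLinearMap.apply ℝ 𝔼 (stdVec i))
  have hℓ : ∀ i S, ℓ i S = inner ℝ (S (stdVec i)) (stdVec i) := by
    intro i S
    simp [ℓ, real_inner_comm]
  let ℓw : (𝔼 →L[ℝ] 𝔼) →L[ℝ] ℝ := ∑ i, w i • ℓ i
  have hℓw : ∀ S, ℓw S = ∑ i, w i * inner ℝ (S (stdVec i)) (stdVec i) := by
    intro S
    simp [ℓw, hℓ]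
  have hK : ContDiffAt ℝ 2 (fun z => b z * H z * b z) o := (hb.mul hH).mul hb
  have hΦ : ContDiffAt ℝ 2 (fun z => ℓw (b z * H z * b z)) o :=
    ℓw.contDiff.contDiffAt.comp o hK
  have hmin : ∀ᶠ z in 𝓝 o, 0 ≤ ℓw (b z * H z * b z) - Fn z := by
    filter_upwards [hGt.eventually hβs, hsa, hle] with z h1 h2 h3
    rw [hℓw]
    linarith [h3 (b z) (h1 h2).1 (h1 h2).2]
  have h0 : ℓw (b o * H o * b o) - Fn o = 0 := by
    rw [hℓw, heq, hb1, one_mul, mul_one, sub_eq_zero]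
    refine Finset.sum_congr rfl fun i _ => ?_
    rw [hH0, inner_smul_left, inner_stdVec]; simp
  obtain ⟨t1, t2⟩ := dirDeriv_of_line_min (v := v) (hΦ.sub hF) (by
    filter_upwards [(tendsto_line o v).eventually hmin] with s hs
    rw [h0]; exact hs)
  rw [dirDeriv_sub (hΦ.differentiableAt (by simp)) (hF.differentiableAt (by simp)),
    dirDeriv_clm ℓw (hK.differentiableAt (by simp)), hH1, hℓw] at t1
  rw [dirDeriv_dirDeriv_sub hΦ hF, dirDeriv_dirDeriv_clm ℓw hK, hH2, hℓw] at t2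
  refine ⟨by linarith, ?_⟩
  -- Since H o is self-adjoint and diagonal, its two products with b'' contribute 2κ_i⟨b''e_i, e_i⟩
  -- = -κ_i⟨G''e_i, e_i⟩: the correction for renormalizing the frame.
  have e : ∀ i, inner ℝ ((bvv * H o + dirDeriv v (dirDeriv v H) o + H o * bvv) (stdVec i))
      (stdVec i) = inner ℝ (dirDeriv v (dirDeriv v H) o (stdVec i)) (stdVec i) -
        κ i * inner ℝ (dirDeriv v (dirDeriv v G) o (stdVec i)) (stdVec i) := by
    intro i
    have e1 : inner ℝ ((H o * bvv) (stdVec i)) (stdVec i) =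
        κ i * inner ℝ (bvv (stdVec i)) (stdVec i) := by
      have : inner ℝ (H o (bvv (stdVec i))) (stdVec i) =
          inner ℝ (bvv (stdVec i)) (H o (stdVec i)) :=
        (ContinuousLinearMap.isSelfAdjoint_iff_isSymmetric.1 hHsa) _ _
      rw [mul_apply_eq_comp, this, hH0, inner_smul_right]
    have e2 : inner ℝ ((bvv * H o) (stdVec i)) (stdVec i) =
        κ i * inner ℝ (bvv (stdVec i)) (stdVec i) := by
      rw [mul_apply_eq_comp, hH0, map_smul, inner_smul_left]; simp
    rw [hGvv]
    simp only [add_apply, neg_apply, inner_add_left, inner_neg_left, e1, e2]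
    ring
  simp only [e] at t2
  linarith

end

/-- The endomorphism with the given matrix in the standard basis. -/
def matrixEnd (a : Fin n → Fin n → ℝ) : 𝔼 →L[ℝ] 𝔼 :=
  ∑ i, ∑ j, a i j • (EuclideanSpace.proj j : 𝔼 →L[ℝ] ℝ).smulRight (stdVec i)

lemma inner_matrixEnd (a : Fin n → Fin n → ℝ) (u w : 𝔼) :
    inner ℝ (matrixEnd a u) w = ∑ i, ∑ j, a i j * (u j * w i) := by
  have h : ∀ i, inner ℝ (stdVec i) w = w i := by
    intro i
    simp [stdVec, EuclideanSpace.basisFun_apply, EuclideanSpace.inner_single_left]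
  simp [matrixEnd, sum_inner, inner_smul_left, h]

lemma inner_matrixEnd_stdVec (a : Fin n → Fin n → ℝ) (i j : Fin n) :
    inner ℝ (matrixEnd a (stdVec j)) (stdVec i) = a i j := by
  simp [inner_matrixEnd, stdVec_apply]

lemma end_ext {S S' : 𝔼 →L[ℝ] 𝔼}
    (h : ∀ i j, inner ℝ (S (stdVec j)) (stdVec i) = inner ℝ (S' (stdVec j)) (stdVec i)) :
    S = S' := by
  have h1 : ∀ j, S (stdVec j) = S' (stdVec j) := fun j =>
    eq_of_inner_stdVec fun i => h i j
  ext1 u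
  rw [← sum_stdVec u]
  simp only [map_sum, map_smul, h1]

/-- The vectors change places because the row index of the matrix pairs with the output; for the
second fundamental form the first map, the differential of the normal, therefore receives w. -/
lemma inner_matrixEnd_bilin {W : Type*} [NormedAddCommGroup W] [InnerProductSpace ℝ W]
    (P Q : 𝔼 →L[ℝ] W) (u w : 𝔼) :
    inner ℝ (matrixEnd (fun i j => inner ℝ (P (stdVec i)) (Q (stdVec j))) u) w =
      inner ℝ (P w) (Q u) := by
  rw [inner_matrixEnd]
  conv_rhs => rw [← sum_stdVec w, ← sum_stdVec u]
  simp only [map_sum, map_smul, sum_inner, inner_smul_left]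
  refine Finset.sum_congr rfl fun i _ => ?_
  rw [inner_sum, Finset.mul_sum]
  refine Finset.sum_congr rfl fun j _ => ?_
  rw [inner_smul_right]
  simp; ring

lemma contDiffAt_matrixEnd {V : Type*} [NormedAddCommGroup V] [NormedSpace ℝ V]
    {k : WithTop ℕ∞} {a : V → Fin n → Fin n → ℝ} {o : V}
    (ha : ∀ i j, ContDiffAt ℝ k (fun z => a z i j) o) :
    ContDiffAt ℝ k (fun z => matrixEnd (a z)) o :=
  ContDiffAt.sum fun i _ => ContDiffAt.sum fun j _ => (ha i j).smul contDiffAt_const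

/-- The version of `spectral_second_order` for a map with differential `P` and Gauss map with
differential `Q`. -/
lemma spectral_second_order_forms {V W : Type*} [NormedAddCommGroup V] [NormedSpace ℝ V]
    [NormedAddCommGroup W] [InnerProductSpace ℝ W]
    {P Q : V → (𝔼 →L[ℝ] W)} {Fn : V → ℝ} {o v : V} {w κ : Fin n → ℝ}
    (hP : ContDiffAt ℝ 2 P o) (hQ : ContDiffAt ℝ 2 Q o) (hF : ContDiffAt ℝ 2 Fn o)
    (hg : ∀ i j, inner ℝ (P o (stdVec i)) (P o (stdVec j)) = if i = j then (1 : ℝ) else 0)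
    (hgv : ∀ i j, dirDeriv v (fun z => inner ℝ (P z (stdVec i)) (P z (stdVec j))) o = (0 : ℝ))
    (hh : ∀ i j, inner ℝ (Q o (stdVec i)) (P o (stdVec j)) = if i = j then κ i else 0)
    (hle : ∀ᶠ z in 𝓝 o, ∀ E : Fin n → 𝔼,
      (∀ i j, inner ℝ (P z (E i)) (P z (E j)) = if i = j then (1 : ℝ) else 0) →
      Fn z ≤ ∑ i, w i * inner ℝ (Q z (E i)) (P z (E i)))
    (heq : Fn o = ∑ i, w i * κ i) :
    dirDeriv v Fn o =
      ∑ i, w i * dirDeriv v (fun z => inner ℝ (Q z (stdVec i)) (P z (stdVec i))) o ∧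
    dirDeriv v (dirDeriv v Fn) o ≤
      ∑ i, w i * (dirDeriv v (dirDeriv v fun z => inner ℝ (Q z (stdVec i)) (P z (stdVec i))) o -
        κ i * dirDeriv v (dirDeriv v fun z => inner ℝ (P z (stdVec i)) (P z (stdVec i))) o) := by
  let G : V → (𝔼 →L[ℝ] 𝔼) := fun z =>
    matrixEnd fun i j => inner ℝ (P z (stdVec i)) (P z (stdVec j))
  let H : V → (𝔼 →L[ℝ] 𝔼) := fun z =>
    matrixEnd fun i j => inner ℝ (Q z (stdVec i)) (P z (stdVec j))
  have hG : ContDiffAt ℝ 2 G o := contDiffAt_matrixEnd fun i j =>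
    (hP.clm_apply contDiffAt_const).inner ℝ (hP.clm_apply contDiffAt_const)
  have hH : ContDiffAt ℝ 2 H o := contDiffAt_matrixEnd fun i j =>
    (hQ.clm_apply contDiffAt_const).inner ℝ (hP.clm_apply contDiffAt_const)
  let ℓ : Fin n → Fin n → (𝔼 →L[ℝ] 𝔼) →L[ℝ] ℝ := fun i j =>
    (innerSL ℝ (stdVec i)).comp (ContinuousLinearMap.apply ℝ 𝔼 (stdVec j))
  have hℓ : ∀ i j S, ℓ i j S = inner ℝ (S (stdVec j)) (stdVec i) := by
    intro i j S
    simp [ℓ, real_inner_comm]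
  have hGe : ∀ i j, (fun z => ℓ i j (G z)) = fun z => inner ℝ (P z (stdVec i)) (P z (stdVec j)) := by
    intro i j; ext z; rw [hℓ, inner_matrixEnd_stdVec]
  have hHe : ∀ i j, (fun z => ℓ i j (H z)) = fun z => inner ℝ (Q z (stdVec i)) (P z (stdVec j)) := by
    intro i j; ext z; rw [hℓ, inner_matrixEnd_stdVec]
  have hG0 : G o = 1 := end_ext fun i j => by
    rw [inner_matrixEnd_stdVec, hg, one_apply_eq_self, inner_stdVec]
    simp [eq_comm]
  have hGv : dirDeriv v G o = 0 := end_ext fun i j => by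
    rw [← hℓ, ← dirDeriv_clm _ (hG.differentiableAt (by simp)), hGe, hgv]; simp
  have hsa : ∀ z, IsSelfAdjoint (G z) := fun z => by
    refine ContinuousLinearMap.isSelfAdjoint_iff_isSymmetric.2 fun u w => ?_
    change inner ℝ (G z u) w = inner ℝ u (G z w)
    rw [inner_matrixEnd_bilin, real_inner_comm _ u, inner_matrixEnd_bilin, real_inner_comm]
  have hH0 : ∀ i, H o (stdVec i) = κ i • stdVec i := by
    intro j
    refine eq_of_inner_stdVec fun i => ?_
    have h1 := inner_matrixEnd_stdVec (fun i j => inner ℝ (Q o (stdVec i)) (P o (stdVec j))) i j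
    rw [h1, hh, inner_smul_left, inner_stdVec]
    by_cases hij : i = j
    · subst hij; simp
    · simp [hij, Ne.symm hij]
  have hHsa : IsSelfAdjoint (H o) := by
    refine ContinuousLinearMap.isSelfAdjoint_iff'.2 (end_ext fun i j => ?_)
    rw [ContinuousLinearMap.adjoint_inner_left, hH0, hH0, inner_smul_left, inner_smul_right,
      inner_stdVec]
    by_cases hij : i = j
    · subst hij; simp
    · simp [Ne.symm hij]
  have hle' : ∀ᶠ z in 𝓝 o, ∀ b : 𝔼 →L[ℝ] 𝔼, IsSelfAdjoint b → b * G z * b = 1 →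
      Fn z ≤ ∑ i, w i * inner ℝ ((b * H z * b) (stdVec i)) (stdVec i) := by
    filter_upwards [hle] with z hz b hb hbG
    have hbs : ∀ u w : 𝔼, inner ℝ (b u) w = inner ℝ u (b w) :=
      ContinuousLinearMap.isSelfAdjoint_iff_isSymmetric.1 hb
    -- The condition b G b = 1 says that the vectors b e_i are orthonormal for the metric at z, so
    -- the hypothesis applies to them.
    have := hz (fun i => b (stdVec i)) fun i j => by
      have h1 := inner_stdVec i j
      have h2 : stdVec j = (b * G z * b) (stdVec j) := by rw [hbG]; simp
      rw [h2, mul_apply_eq_comp, mul_apply_eq_comp, ← hbs,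
        real_inner_comm, inner_matrixEnd_bilin] at h1
      exact h1
    refine this.trans (le_of_eq (Finset.sum_congr rfl fun i _ => ?_))
    rw [mul_apply_eq_comp, mul_apply_eq_comp, hbs, inner_matrixEnd_bilin]
  obtain ⟨r1, r2⟩ := spectral_second_order hG hH hF hG0 hGv (Eventually.of_forall hsa) hH0 hHsa
    hle' heq
  refine ⟨r1.trans (Finset.sum_congr rfl fun i _ => ?_),
    r2.trans (le_of_eq (Finset.sum_congr rfl fun i _ => ?_))⟩
  · rw [← hℓ, ← dirDeriv_clm _ (hH.differentiableAt (by simp)), hHe]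
  · rw [← hℓ, ← dirDeriv_dirDeriv_clm _ hH, hHe, ← hℓ, ← dirDeriv_dirDeriv_clm _ hG, hGe]

end SpectralSecondOrder

/-! ### Product rules and interchange of derivatives. -/

section InnerCalculus

variable {V W : Type*} [NormedAddCommGroup V] [NormedSpace ℝ V]
  [NormedAddCommGroup W] [InnerProductSpace ℝ W]

/-- The inner product of a real inner product space as a continuous bilinear map. -/
def innerCLM (W : Type*) [NormedAddCommGroup W] [InnerProductSpace ℝ W] : W →L[ℝ] W →L[ℝ] ℝ :=
  (innerₗ W).mkContinuous₂ 1 fun x y => by simpa using norm_inner_le_norm (𝕜 := ℝ) x y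

lemma dirDeriv_inner {A B : V → W} {o : V} (hA : DifferentiableAt ℝ A o)
    (hB : DifferentiableAt ℝ B o) (v : V) :
    dirDeriv v (fun z => inner ℝ (A z) (B z)) o =
      inner ℝ (dirDeriv v A o) (B o) + inner ℝ (A o) (dirDeriv v B o) :=
  dirDeriv_bilin (innerCLM W) hA hB v

lemma dirDeriv_dirDeriv_inner {A B : V → W} {o : V}
    (hA : ContDiffAt ℝ 2 A o) (hB : ContDiffAt ℝ 2 B o) (u v : V) :
    dirDeriv u (dirDeriv v (fun z => inner ℝ (A z) (B z))) o =
      inner ℝ (dirDeriv u (dirDeriv v A) o) (B o) + inner ℝ (dirDeriv v A o) (dirDeriv u B o) +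
      (inner ℝ (dirDeriv u A o) (dirDeriv v B o) +
        inner ℝ (A o) (dirDeriv u (dirDeriv v B) o)) :=
  dirDeriv_dirDeriv_bilin (innerCLM W) hA hB u v

lemma dirDeriv_mul {A B : V → ℝ} {o : V} (hA : DifferentiableAt ℝ A o)
    (hB : DifferentiableAt ℝ B o) (v : V) :
    dirDeriv v (fun z => A z * B z) o = dirDeriv v A o * B o + A o * dirDeriv v B o :=
  dirDeriv_bilin (ContinuousLinearMap.mul ℝ ℝ) hA hB v

lemma dirDeriv_dirDeriv_mul {A B : V → ℝ} {o : V}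
    (hA : ContDiffAt ℝ 2 A o) (hB : ContDiffAt ℝ 2 B o) (u v : V) :
    dirDeriv u (dirDeriv v (fun z => A z * B z)) o =
      dirDeriv u (dirDeriv v A) o * B o + dirDeriv v A o * dirDeriv u B o +
      (dirDeriv u A o * dirDeriv v B o + A o * dirDeriv u (dirDeriv v B) o) :=
  dirDeriv_dirDeriv_bilin (ContinuousLinearMap.mul ℝ ℝ) hA hB u v

lemma dirDeriv_smul {A : V → ℝ} {B : V → W} {o : V} (hA : DifferentiableAt ℝ A o)
    (hB : DifferentiableAt ℝ B o) (v : V) :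
    dirDeriv v (fun z => A z • B z) o = dirDeriv v A o • B o + A o • dirDeriv v B o :=
  dirDeriv_bilin (ContinuousLinearMap.lsmul ℝ ℝ) hA hB v

lemma dirDeriv_dirDeriv_smul {A : V → ℝ} {B : V → W} {o : V}
    (hA : ContDiffAt ℝ 2 A o) (hB : ContDiffAt ℝ 2 B o) (u v : V) :
    dirDeriv u (dirDeriv v (fun z => A z • B z)) o =
      dirDeriv u (dirDeriv v A) o • B o + dirDeriv v A o • dirDeriv u B o +
      (dirDeriv u A o • dirDeriv v B o + A o • dirDeriv u (dirDeriv v B) o) :=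
  dirDeriv_dirDeriv_bilin (ContinuousLinearMap.lsmul ℝ ℝ) hA hB u v

lemma dirDeriv_comm₃ {A : V → W} {o : V} (hA : ContDiffAt ℝ ∞ A o) (u v : V) :
    dirDeriv u (dirDeriv u (dirDeriv v A)) o = dirDeriv v (dirDeriv u (dirDeriv u A)) o := by
  rw [(dirDeriv_congr (dirDeriv_comm_eventually hA u v) u).self_of_nhds,
    dirDeriv_comm ((contDiffAt_infty_dirDeriv hA u).of_le two_le_infty)]

lemma dirDeriv_comm₃_eventually {A : V → W} {o : V} (hA : ContDiffAt ℝ ∞ A o) (u v : V) :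
    dirDeriv u (dirDeriv u (dirDeriv v A)) =ᶠ[𝓝 o] dirDeriv v (dirDeriv u (dirDeriv u A)) :=
  (dirDeriv_congr (dirDeriv_comm_eventually hA u v) u).trans
    (dirDeriv_comm_eventually (contDiffAt_infty_dirDeriv hA u) u v)

lemma dirDeriv_comm₄ {A : V → W} {o : V} (hA : ContDiffAt ℝ ∞ A o) (u v : V) :
    dirDeriv u (dirDeriv u (dirDeriv v (dirDeriv v A))) o =
      dirDeriv v (dirDeriv v (dirDeriv u (dirDeriv u A))) o := by
  rw [dirDeriv_comm₃ (contDiffAt_infty_dirDeriv hA v) u v]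
  exact (dirDeriv_congr (dirDeriv_comm₃_eventually hA u v) v).self_of_nhds

end InnerCalculus

/-! ### Structure and evolution equations in normal coordinates. -/

section NormalCoordinates

variable {n : ℕ}

local notation "𝔼" => EuclideanSpace ℝ (Fin n)
local notation "𝕎" => EuclideanSpace ℝ (Fin (n + 1))

/-- Two vectors of `ℝⁿ⁺¹` agree if their products with a unit vector and an orthonormal frame of
its orthogonal complement agree. -/
lemma eq_of_inner_frame {N : 𝕎} {q : Fin n → 𝕎} (hN : inner ℝ N N = (1 : ℝ))
    (hqN : ∀ i, inner ℝ (q i) N = (0 : ℝ))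
    (hq : ∀ i j, inner ℝ (q i) (q j) = if i = j then (1 : ℝ) else 0) {x y : 𝕎}
    (h0 : inner ℝ x N = inner ℝ y N) (h1 : ∀ i, inner ℝ x (q i) = inner ℝ y (q i)) :
    x = y := by
  let b : Fin (n + 1) → 𝕎 := Fin.cons N q
  have hb : Orthonormal ℝ b := by
    rw [orthonormal_iff_ite]
    intro i j
    refine Fin.cases ?_ (fun i => ?_) i <;> refine Fin.cases ?_ (fun j => ?_) j
    · simpa [b] using hN
    · simp only [b, Fin.cons_zero, Fin.cons_succ]
      rw [real_inner_comm, hqN]; simp [(Fin.succ_ne_zero _).symm]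
    · simp only [b, Fin.cons_zero, Fin.cons_succ]
      rw [hqN]; simp [Fin.succ_ne_zero]
    · simp only [b, Fin.cons_succ, hq, Fin.succ_inj]
  have hs : ⊤ ≤ Submodule.span ℝ (Set.range b) := by
    rw [hb.linearIndependent.span_eq_top_of_card_eq_finrank' (by simp)]
  refine (OrthonormalBasis.mk hb hs).repr.injective ?_
  ext i
  rw [OrthonormalBasis.repr_apply_apply, OrthonormalBasis.repr_apply_apply,
    OrthonormalBasis.coe_mk, real_inner_comm, real_inner_comm y]
  refine Fin.cases ?_ (fun i => ?_) i
  · simpa [b] using h0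
  · simpa [b] using h1 i

/-- The `i`-th spatial direction in space-time. -/
def spaceDir (i : Fin n) : ℝ × 𝔼 := (0, stdVec i)

/-- The time direction in space-time. -/
def timeDir (n : ℕ) : ℝ × EuclideanSpace ℝ (Fin n) := (1, 0)

/-- A flow `p` with unit normal `N` and speed `Fn`, in coordinates which are normal at `o` and whose
coordinate directions are principal with curvatures `κ`; `w` are the coefficients of the linearized
speed. -/
structure NormalFlowData (o : ℝ × 𝔼) (p N : ℝ × 𝔼 → 𝕎) (Fn : ℝ × 𝔼 → ℝ)
    (w κ : Fin n → ℝ) : Prop where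
  smooth : ContDiffAt ℝ ∞ p o
  smooth_normal : ContDiffAt ℝ ∞ N o
  smooth_speed : ContDiffAt ℝ ∞ Fn o
  unit : ∀ᶠ z in 𝓝 o, inner ℝ (N z) (N z) = (1 : ℝ)
  orthogonal : ∀ u : 𝔼, ∀ᶠ z in 𝓝 o, inner ℝ (dirDeriv ((0 : ℝ), u) p z) (N z) = (0 : ℝ)
  flow : dirDeriv (timeDir n) p =ᶠ[𝓝 o] fun z => -(Fn z • N z)
  frame : ∀ i j, inner ℝ (dirDeriv (spaceDir i) p o) (dirDeriv (spaceDir j) p o) =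
    if i = j then (1 : ℝ) else 0
  second : ∀ i j, dirDeriv (spaceDir i) (dirDeriv (spaceDir j) p) o =
    -((if i = j then κ i else 0) • N o)
  speed_le : ∀ᶠ z in 𝓝 o, ∀ E : Fin n → 𝔼,
    (∀ i j, inner ℝ (dirDeriv ((0 : ℝ), E i) p z) (dirDeriv ((0 : ℝ), E j) p z) =
      if i = j then (1 : ℝ) else 0) →
    Fn z ≤ ∑ i, w i * inner ℝ (dirDeriv ((0 : ℝ), E i) N z) (dirDeriv ((0 : ℝ), E i) p z)
  speed_eq : Fn o = ∑ i, w i * κ i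
  nonneg : ∀ i, 0 ≤ w i

namespace NormalFlowData

variable {o : ℝ × EuclideanSpace ℝ (Fin n)}
  {p N : ℝ × EuclideanSpace ℝ (Fin n) → EuclideanSpace ℝ (Fin (n + 1))}
  {Fn : ℝ × EuclideanSpace ℝ (Fin n) → ℝ} {w κ : Fin n → ℝ}

lemma unit_self (H : NormalFlowData o p N Fn w κ) : inner ℝ (N o) (N o) = (1 : ℝ) :=
  H.unit.self_of_nhds

lemma orthogonal_self (H : NormalFlowData o p N Fn w κ) (i : Fin n) :
    inner ℝ (dirDeriv (spaceDir i) p o) (N o) = (0 : ℝ) :=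
  (H.orthogonal (stdVec i)).self_of_nhds

lemma contDiffAt_two (H : NormalFlowData o p N Fn w κ) : ContDiffAt ℝ 2 p o :=
  H.smooth.of_le two_le_infty

lemma contDiffAt_normal_two (H : NormalFlowData o p N Fn w κ) : ContDiffAt ℝ 2 N o :=
  H.smooth_normal.of_le two_le_infty

lemma ext (H : NormalFlowData o p N Fn w κ) {x y : 𝕎}
    (hN : inner ℝ x (N o) = inner ℝ y (N o))
    (hp : ∀ i, inner ℝ x (dirDeriv (spaceDir i) p o) = inner ℝ y (dirDeriv (spaceDir i) p o)) :
    x = y :=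
  eq_of_inner_frame H.unit_self H.orthogonal_self H.frame hN hp

lemma inner_dirDeriv_normal (H : NormalFlowData o p N Fn w κ) (v : ℝ × 𝔼) :
    inner ℝ (dirDeriv v N o) (N o) = (0 : ℝ) := by
  have hd := H.contDiffAt_normal_two.differentiableAt (by simp)
  have h1 := dirDeriv_inner hd hd v
  have h2 := (dirDeriv_congr (B := fun _ => (1 : ℝ)) H.unit v).self_of_nhds
  rw [h1, dirDeriv_const, real_inner_comm] at h2
  have h3 : inner ℝ (N o) (dirDeriv v N o) + inner ℝ (N o) (dirDeriv v N o) = (0 : ℝ) := h2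
  rw [real_inner_comm]; linarith

lemma inner_dirDeriv_dirDeriv_normal (H : NormalFlowData o p N Fn w κ) (v : ℝ × 𝔼) :
    inner ℝ (dirDeriv v (dirDeriv v N) o) (N o) = -inner ℝ (dirDeriv v N o) (dirDeriv v N o) := by
  have h1 := dirDeriv_dirDeriv_inner H.contDiffAt_normal_two H.contDiffAt_normal_two v v
  have h2 := (dirDeriv_congr (dirDeriv_congr (B := fun _ => (1 : ℝ)) H.unit v) v).self_of_nhds
  rw [h1, dirDeriv_const, dirDeriv_const, real_inner_comm _ (N o)] at h2
  have h3 : inner ℝ (dirDeriv v (dirDeriv v N) o) (N o) +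
      inner ℝ (dirDeriv v N o) (dirDeriv v N o) + (inner ℝ (dirDeriv v N o) (dirDeriv v N o) +
      inner ℝ (dirDeriv v (dirDeriv v N) o) (N o)) = (0 : ℝ) := h2
  linarith

/-- The second fundamental form, near `o`, in terms of second derivatives of the position. -/
lemma form_eventuallyEq (H : NormalFlowData o p N Fn w κ) (v : ℝ × 𝔼) (u : 𝔼) :
    (fun z => inner ℝ (dirDeriv v N z) (dirDeriv ((0 : ℝ), u) p z)) =ᶠ[𝓝 o]
      fun z => -inner ℝ (N z) (dirDeriv v (dirDeriv ((0 : ℝ), u) p) z) := by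
  have h2 := dirDeriv_congr (B := fun _ => (0 : ℝ)) (H.orthogonal u) v
  rw [dirDeriv_const] at h2
  filter_upwards [h2, eventually_differentiableAt (contDiffAt_infty_dirDeriv H.smooth ((0 : ℝ), u))
    one_le_infty, eventually_differentiableAt H.smooth_normal one_le_infty] with z h3 h4 h5
  rw [dirDeriv_inner h4 h5, real_inner_comm, real_inner_comm _ (dirDeriv ((0 : ℝ), u) p z)] at h3
  linarith

lemma form_self (H : NormalFlowData o p N Fn w κ) (i j : Fin n) :
    inner ℝ (dirDeriv (spaceDir i) N o) (dirDeriv (spaceDir j) p o) = if i = j then κ i else 0 := by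
  have := (H.form_eventuallyEq (spaceDir i) (stdVec j)).self_of_nhds
  refine this.trans ?_
  change -inner ℝ (N o) (dirDeriv (spaceDir i) (dirDeriv (spaceDir j) p) o) = _
  rw [H.second, inner_neg_right, inner_smul_right, H.unit_self]
  simp

lemma dirDeriv_normal (H : NormalFlowData o p N Fn w κ) (i : Fin n) :
    dirDeriv (spaceDir i) N o = κ i • dirDeriv (spaceDir i) p o := by
  refine H.ext ?_ fun j => ?_
  · rw [H.inner_dirDeriv_normal, inner_smul_left, H.orthogonal_self]; simp
  · rw [H.form_self, inner_smul_left, H.frame]; simp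

/-- At o the second derivatives of p are purely normal, which is what normal coordinates mean here.
-/
lemma dirDeriv_metric (H : NormalFlowData o p N Fn w κ) (i j k : Fin n) :
    dirDeriv (spaceDir k) (fun z => inner ℝ (dirDeriv (spaceDir i) p z)
      (dirDeriv (spaceDir j) p z)) o = (0 : ℝ) := by
  have hd : ∀ i, DifferentiableAt ℝ (dirDeriv (spaceDir i) p) o := fun i =>
    ((contDiffAt_infty_dirDeriv H.smooth (spaceDir i)).differentiableAt (by simp))
  rw [dirDeriv_inner (hd i) (hd j), H.second, H.second, inner_neg_left, inner_neg_right,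
    inner_smul_left, inner_smul_right, H.orthogonal_self, real_inner_comm, H.orthogonal_self]
  simp

/-- First and second derivatives of the speed. -/
lemma speed_second_order (H : NormalFlowData o p N Fn w κ) (k : Fin n) :
    dirDeriv (spaceDir k) Fn o = ∑ i, w i * dirDeriv (spaceDir k)
      (fun z => inner ℝ (dirDeriv (spaceDir i) N z) (dirDeriv (spaceDir i) p z)) o ∧
    dirDeriv (spaceDir k) (dirDeriv (spaceDir k) Fn) o ≤
      ∑ i, w i * (dirDeriv (spaceDir k) (dirDeriv (spaceDir k)
          fun z => inner ℝ (dirDeriv (spaceDir i) N z) (dirDeriv (spaceDir i) p z)) o -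
        κ i * dirDeriv (spaceDir k) (dirDeriv (spaceDir k)
          fun z => inner ℝ (dirDeriv (spaceDir i) p z) (dirDeriv (spaceDir i) p z)) o) := by
  let J : 𝔼 →L[ℝ] ℝ × 𝔼 := ContinuousLinearMap.inr ℝ ℝ 𝔼
  have hP : ContDiffAt ℝ 2 (fun z => (fderiv ℝ p z).comp J) o :=
    ((H.smooth.fderiv_right (m := ∞) (by simp)).of_le two_le_infty).clm_comp contDiffAt_const
  have hQ : ContDiffAt ℝ 2 (fun z => (fderiv ℝ N z).comp J) o :=
    ((H.smooth_normal.fderiv_right (m := ∞) (by simp)).of_le two_le_infty).clm_comp contDiffAt_const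
  have e : ∀ (A : ℝ × 𝔼 → 𝕎) (z : ℝ × 𝔼) (u : 𝔼),
      ((fderiv ℝ A z).comp J) u = dirDeriv ((0 : ℝ), u) A z := fun _ _ _ => rfl
  have key := spectral_second_order_forms (P := fun z => (fderiv ℝ p z).comp J)
    (Q := fun z => (fderiv ℝ N z).comp J) (Fn := Fn) (v := spaceDir k) (w := w) (κ := κ)
    hP hQ (H.smooth_speed.of_le two_le_infty) (by simp only [e]; exact H.frame)
    (by simp only [e]; exact fun i j => H.dirDeriv_metric i j k)
    (by simp only [e]; exact H.form_self) (by simp only [e]; exact H.speed_le) H.speed_eq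
  simp only [e] at key
  exact key

/-- A form of the Codazzi equation: both sides equal -⟨N, ∂_j∂_i∂_i p⟩. One side is the derivative
of h_ii = -⟨N, ∂_i∂_i p⟩; the other comes from differentiating ⟨∂_j p, N⟩ = 0 twice along i. The
mixed terms pair tangential with normal vectors. -/
lemma dirDeriv_form (H : NormalFlowData o p N Fn w κ) (i j : Fin n) :
    dirDeriv (spaceDir j)
      (fun z => inner ℝ (dirDeriv (spaceDir i) N z) (dirDeriv (spaceDir i) p z)) o =
      inner ℝ (dirDeriv (spaceDir i) (dirDeriv (spaceDir i) N) o) (dirDeriv (spaceDir j) p o) := by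
  have hp : ∀ i, ContDiffAt ℝ ∞ (dirDeriv (spaceDir i) p) o :=
    fun i => contDiffAt_infty_dirDeriv H.smooth (spaceDir i)
  have hpp := contDiffAt_infty_dirDeriv (hp i) (spaceDir i)
  have h1 := (dirDeriv_congr (H.form_eventuallyEq (spaceDir i) (stdVec i))
    (spaceDir j)).self_of_nhds
  have h2 : dirDeriv (spaceDir j)
      (fun z => -inner ℝ (N z) (dirDeriv (spaceDir i) (dirDeriv (spaceDir i) p) z)) o =
      -inner ℝ (N o) (dirDeriv (spaceDir j) (dirDeriv (spaceDir i) (dirDeriv (spaceDir i) p)) o) := by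
    have : dirDeriv (spaceDir j)
        (fun z => -inner ℝ (N z) (dirDeriv (spaceDir i) (dirDeriv (spaceDir i) p) z)) o =
        -dirDeriv (spaceDir j)
        (fun z => inner ℝ (N z) (dirDeriv (spaceDir i) (dirDeriv (spaceDir i) p) z)) o := by
      simp only [dirDeriv]
      rw [fderiv_fun_neg]; rfl
    rw [this, dirDeriv_inner (H.smooth_normal.differentiableAt (by simp))
      (hpp.differentiableAt (by simp)), H.second, inner_neg_right, inner_smul_right,
      H.inner_dirDeriv_normal]
    simp
  have h3 := (dirDeriv_congr (dirDeriv_congr (B := fun _ => (0 : ℝ)) (H.orthogonal (stdVec j))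
    (spaceDir i)) (spaceDir i)).self_of_nhds
  rw [dirDeriv_const, dirDeriv_const] at h3
  change dirDeriv (spaceDir i) (dirDeriv (spaceDir i)
    (fun z => inner ℝ (dirDeriv (spaceDir j) p z) (N z))) o = 0 at h3
  rw [dirDeriv_dirDeriv_inner ((hp j).of_le two_le_infty) H.contDiffAt_normal_two, H.second,
    inner_neg_left, inner_smul_left, real_inner_comm _ (N o), H.inner_dirDeriv_normal,
    dirDeriv_comm₃ H.smooth] at h3
  refine h1.trans (h2.trans ?_)
  rw [real_inner_comm, real_inner_comm (dirDeriv (spaceDir j) p o)]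
  linarith

/-- The evolution of the normal. -/
lemma inner_timeDeriv_normal (H : NormalFlowData o p N Fn w κ) (j : Fin n) :
    inner ℝ (dirDeriv (timeDir n) N o) (dirDeriv (spaceDir j) p o) = dirDeriv (spaceDir j) Fn o := by
  have h1 := (H.form_eventuallyEq (timeDir n) (stdVec j)).self_of_nhds
  refine h1.trans ?_
  change -inner ℝ (N o) (dirDeriv (timeDir n) (dirDeriv (spaceDir j) p) o) = _
  have h2 : dirDeriv (spaceDir j) (fun z => -(Fn z • N z)) o =
      -(dirDeriv (spaceDir j) Fn o • N o + Fn o • dirDeriv (spaceDir j) N o) := by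
    rw [← dirDeriv_smul (H.smooth_speed.differentiableAt (by simp))
      (H.smooth_normal.differentiableAt (by simp))]
    simp only [dirDeriv]
    rw [fderiv_fun_neg]; rfl
  rw [dirDeriv_comm H.contDiffAt_two, (dirDeriv_congr H.flow _).self_of_nhds, h2, inner_neg_right,
    inner_add_right, inner_smul_right, inner_smul_right, H.unit_self, real_inner_comm,
    H.inner_dirDeriv_normal]
  ring

/-- The normal solves the linearized equation. Normal components vanish because ⟨∂_i∂_i N, N⟩ =
-κ_i²; tangentially, the gradient of the speed is the weighted sum of derivatives of h_ii, converted
by Codazzi. -/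
lemma timeDeriv_normal (H : NormalFlowData o p N Fn w κ) :
    dirDeriv (timeDir n) N o = ∑ i, w i •
      (dirDeriv (spaceDir i) (dirDeriv (spaceDir i) N) o + κ i ^ 2 • N o) := by
  refine H.ext ?_ fun j => ?_
  · rw [H.inner_dirDeriv_normal, sum_inner]
    symm
    refine Finset.sum_eq_zero fun i _ => ?_
    rw [inner_smul_left, inner_add_left, H.inner_dirDeriv_dirDeriv_normal, H.dirDeriv_normal,
      inner_smul_left, inner_smul_left, inner_smul_right, H.frame, H.unit_self]
    simp; right; ring
  · rw [H.inner_timeDeriv_normal, (H.speed_second_order j).1, sum_inner]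
    refine Finset.sum_congr rfl fun i _ => ?_
    rw [H.dirDeriv_form, inner_smul_left, inner_add_left, inner_smul_left, real_inner_comm _ (N o),
      H.orthogonal_self]
    simp

/-- The second derivatives of the coefficients of the metric. -/
lemma metric_second (H : NormalFlowData o p N Fn w κ) (a b : Fin n) :
    dirDeriv (spaceDir b) (dirDeriv (spaceDir b)
      fun z => inner ℝ (dirDeriv (spaceDir a) p z) (dirDeriv (spaceDir a) p z)) o =
      2 * (if a = b then κ a ^ 2 else 0) + 2 * inner ℝ (dirDeriv (spaceDir a) p o)
        (dirDeriv (spaceDir a) (dirDeriv (spaceDir b) (dirDeriv (spaceDir b) p)) o) := by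
  have hp := (contDiffAt_infty_dirDeriv H.smooth (spaceDir a)).of_le two_le_infty
  rw [dirDeriv_dirDeriv_inner hp hp, dirDeriv_comm₃ H.smooth, H.second,
    real_inner_comm (dirDeriv (spaceDir a) p o)]
  simp only [inner_neg_left, inner_neg_right, inner_smul_left, inner_smul_right, H.unit_self]
  by_cases h : a = b
  · subst h; simp; ring
  · simp [h, Ne.symm h]; ring

/-- The second derivatives of the coefficients of the second fundamental form. -/
lemma form_second (H : NormalFlowData o p N Fn w κ) (a b : Fin n) :
    dirDeriv (spaceDir b) (dirDeriv (spaceDir b)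
      fun z => inner ℝ (dirDeriv (spaceDir a) N z) (dirDeriv (spaceDir a) p z)) o =
      -(κ a * κ b ^ 2) - 2 * κ b * inner ℝ (dirDeriv (spaceDir b) p o)
        (dirDeriv (spaceDir b) (dirDeriv (spaceDir a) (dirDeriv (spaceDir a) p)) o) -
      inner ℝ (N o) (dirDeriv (spaceDir b) (dirDeriv (spaceDir b)
        (dirDeriv (spaceDir a) (dirDeriv (spaceDir a) p))) o) := by
  have hpp := (contDiffAt_infty_dirDeriv (contDiffAt_infty_dirDeriv H.smooth (spaceDir a))
    (spaceDir a)).of_le two_le_infty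
  have h1 := (dirDeriv_congr (dirDeriv_congr (H.form_eventuallyEq (spaceDir a) (stdVec a))
    (spaceDir b)) (spaceDir b)).self_of_nhds
  refine h1.trans ?_
  change dirDeriv (spaceDir b) (dirDeriv (spaceDir b) fun z => -inner ℝ (N z)
    (dirDeriv (spaceDir a) (dirDeriv (spaceDir a) p) z)) o = _
  have h2 := dirDeriv_dirDeriv_sub (contDiffAt_const (c := (0 : ℝ)))
    (H.contDiffAt_normal_two.inner ℝ hpp) (spaceDir b) (spaceDir b)
  simp only [zero_sub, dirDeriv_const] at h2
  rw [h2, dirDeriv_dirDeriv_inner H.contDiffAt_normal_two hpp, H.second, inner_neg_right,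
    inner_smul_right, H.inner_dirDeriv_dirDeriv_normal, H.dirDeriv_normal]
  simp only [inner_smul_left, inner_smul_right, H.frame]
  simp
  ring

/-- The time derivatives of the coefficients of the metric and the second fundamental form. -/
lemma metric_time (H : NormalFlowData o p N Fn w κ) (a : Fin n) :
    dirDeriv (timeDir n)
      (fun z => inner ℝ (dirDeriv (spaceDir a) p z) (dirDeriv (spaceDir a) p z)) o =
      -(2 * Fn o * κ a) := by
  have hp := (contDiffAt_infty_dirDeriv H.smooth (spaceDir a)).differentiableAt (by simp)
  have h2 : dirDeriv (spaceDir a) (fun z => -(Fn z • N z)) o =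
      -(dirDeriv (spaceDir a) Fn o • N o + Fn o • dirDeriv (spaceDir a) N o) := by
    rw [← dirDeriv_smul (H.smooth_speed.differentiableAt (by simp))
      (H.smooth_normal.differentiableAt (by simp))]
    simp only [dirDeriv]
    rw [fderiv_fun_neg]; rfl
  rw [dirDeriv_inner hp hp, dirDeriv_comm H.contDiffAt_two, (dirDeriv_congr H.flow _).self_of_nhds,
    h2, H.dirDeriv_normal]
  simp only [inner_neg_left, inner_neg_right, inner_add_left, inner_add_right, inner_smul_left,
    inner_smul_right, H.orthogonal_self, real_inner_comm _ (N o), H.frame]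
  simp; ring

/-- Apply ∂_t to h_aa = -⟨N, ∂_a∂_a p⟩ and insert ∂_t p = -FN. The term with ∂_t N drops out, as ∂_t
N is tangential and ∂_a∂_a p normal; ⟨∂_a∂_a N, N⟩ = -κ_a² gives the reaction term. -/
lemma form_time (H : NormalFlowData o p N Fn w κ) (a : Fin n) :
    dirDeriv (timeDir n)
      (fun z => inner ℝ (dirDeriv (spaceDir a) N z) (dirDeriv (spaceDir a) p z)) o =
      dirDeriv (spaceDir a) (dirDeriv (spaceDir a) Fn) o - Fn o * κ a ^ 2 := by
  have hpp := (contDiffAt_infty_dirDeriv (contDiffAt_infty_dirDeriv H.smooth (spaceDir a))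
    (spaceDir a)).differentiableAt (by simp)
  have h1 := (dirDeriv_congr (H.form_eventuallyEq (spaceDir a) (stdVec a))
    (timeDir n)).self_of_nhds
  refine h1.trans ?_
  change dirDeriv (timeDir n) (fun z => -inner ℝ (N z)
    (dirDeriv (spaceDir a) (dirDeriv (spaceDir a) p) z)) o = _
  have hN := H.smooth_normal.differentiableAt (by simp)
  have h2 := dirDeriv_sub (differentiableAt_const (0 : ℝ)) (hN.inner ℝ hpp) (timeDir n)
  simp only [zero_sub, dirDeriv_const] at h2
  have h3 : dirDeriv (timeDir n) (dirDeriv (spaceDir a) (dirDeriv (spaceDir a) p)) o =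
      dirDeriv (spaceDir a) (dirDeriv (spaceDir a) fun z => 0 - Fn z • N z) o := by
    rw [← dirDeriv_comm₃ H.smooth]
    have : dirDeriv (timeDir n) p =ᶠ[𝓝 o] fun z => 0 - Fn z • N z := by simpa using H.flow
    exact (dirDeriv_congr (dirDeriv_congr this _) _).self_of_nhds
  rw [h2, dirDeriv_inner hN hpp, h3, dirDeriv_dirDeriv_sub (B := fun z => Fn z • N z) contDiffAt_const
    ((H.smooth_speed.of_le two_le_infty).smul H.contDiffAt_normal_two),
    dirDeriv_dirDeriv_smul (H.smooth_speed.of_le two_le_infty) H.contDiffAt_normal_two,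
    dirDeriv_const, dirDeriv_const, H.second]
  simp only [real_inner_comm _ (N o), inner_sub_left, inner_add_left, inner_smul_left,
    inner_smul_right, inner_neg_right, inner_zero_left, H.inner_dirDeriv_normal,
    H.inner_dirDeriv_dirDeriv_normal, H.unit_self]
  simp only [H.dirDeriv_normal, inner_smul_left, inner_smul_right, H.frame]
  simp
  ring

end NormalFlowData

end NormalCoordinates

/-! ### The maximum principle at one and at two points. -/

section MaximumPrinciple

variable {n : ℕ} {o : ℝ × EuclideanSpace ℝ (Fin n)}
  {p N : ℝ × EuclideanSpace ℝ (Fin n) → EuclideanSpace ℝ (Fin (n + 1))}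
  {Fn φ : ℝ × EuclideanSpace ℝ (Fin n) → ℝ} {w κ : Fin n → ℝ}

/-- A function which has a minimum at `o` over the time slice of `o`. -/
lemma slice_min_conditions {A : ℝ × EuclideanSpace ℝ (Fin n) → ℝ} (hA : ContDiffAt ℝ 2 A o)
    (h0 : A o = 0) (hmin : ∀ᶠ z in 𝓝 o, z.1 = o.1 → 0 ≤ A z) (i : Fin n) :
    dirDeriv (spaceDir i) A o = 0 ∧ 0 ≤ dirDeriv (spaceDir i) (dirDeriv (spaceDir i) A) o := by
  refine dirDeriv_of_line_min hA ?_
  filter_upwards [(tendsto_line o (spaceDir i)).eventually hmin] with s hs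
  rw [h0]
  exact hs (by simp [spaceDir])

/-- A function which has a minimum at `o` over the past of `o`. -/
lemma past_min_conditions {A : ℝ × EuclideanSpace ℝ (Fin n) → ℝ} (hA : ContDiffAt ℝ 2 A o)
    (h0 : A o = 0) (hmin : ∀ᶠ z in 𝓝 o, z.1 ≤ o.1 → 0 ≤ A z) :
    (∀ i, dirDeriv (spaceDir i) A o = 0 ∧ 0 ≤ dirDeriv (spaceDir i) (dirDeriv (spaceDir i) A) o) ∧
      dirDeriv (timeDir n) A o ≤ 0 := by
  constructor
  · exact slice_min_conditions hA h0 (hmin.mono fun z hz h => hz h.le)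
  · refine dirDeriv_nonpos_of_left_min (hA.differentiableAt (by simp)) ?_
    filter_upwards [((tendsto_line o (timeDir n)).eventually hmin).filter_mono nhdsWithin_le_nhds,
      self_mem_nhdsWithin] with s hs hs0
    rw [h0]
    have hs0 : s < 0 := hs0
    exact hs (by simp [timeDir, hs0.le])

/-- The case where the extremal sphere touches at a second point. -/
lemma NormalFlowData.two_point (H : NormalFlowData o p N Fn w κ)
    {q : ℝ × EuclideanSpace ℝ (Fin n) → EuclideanSpace ℝ (Fin (n + 1))}
    {νy : EuclideanSpace ℝ (Fin (n + 1))} {η : Fin n → ℝ} {Fy : ℝ}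
    (hφ : ContDiffAt ℝ 2 φ o) (hq : ContDiffAt ℝ 2 q o) (hne : p o ≠ q o)
    (h0 : φ o * inner ℝ (p o - q o) (p o - q o) - 2 * inner ℝ (p o - q o) (N o) = 0)
    (hmin₁ : ∀ᶠ z in 𝓝 o, z.1 = o.1 →
      0 ≤ φ z * inner ℝ (p z - q o) (p z - q o) - 2 * inner ℝ (p z - q o) (N z))
    (hmin₂ : ∀ᶠ z in 𝓝 o, z.1 ≤ o.1 →
      0 ≤ φ z * inner ℝ (p z - q z) (p z - q z) - 2 * inner ℝ (p z - q z) (N z))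
    (hν : νy = N o - φ o • (p o - q o))
    (hqi : ∀ i, dirDeriv (spaceDir i) q o = dirDeriv (spaceDir i) p o -
      (2 * inner ℝ (dirDeriv (spaceDir i) p o) (p o - q o) /
        inner ℝ (p o - q o) (p o - q o)) • (p o - q o))
    (hqii : ∀ i, dirDeriv (spaceDir i) (dirDeriv (spaceDir i) q) o = -(η i • νy))
    (hqt : dirDeriv (timeDir n) q o = -(Fy • νy))
    (hFy : Fy ≤ ∑ i, w i * η i) (hκ : ∀ i, κ i ≤ φ o) :
    dirDeriv (timeDir n) φ o ≤
      ∑ i, w i * dirDeriv (spaceDir i) (dirDeriv (spaceDir i) φ) o +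
        (∑ i, w i * κ i ^ 2) * φ o := by
  have hp := H.contDiffAt_two
  have hN := H.contDiffAt_normal_two
  -- general formulas for the derivatives of the two point function
  have formula : ∀ q' : ℝ × EuclideanSpace ℝ (Fin n) → EuclideanSpace ℝ (Fin (n + 1)),
      ContDiffAt ℝ 2 q' o →
      ContDiffAt ℝ 2 (fun z => φ z * inner ℝ (p z - q' z) (p z - q' z) -
        2 * inner ℝ (p z - q' z) (N z)) o ∧
      (∀ v, dirDeriv v (fun z => φ z * inner ℝ (p z - q' z) (p z - q' z) -
        2 * inner ℝ (p z - q' z) (N z)) o =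
        dirDeriv v φ o * inner ℝ (p o - q' o) (p o - q' o) +
        2 * φ o * inner ℝ (p o - q' o) (dirDeriv v p o - dirDeriv v q' o) -
        2 * inner ℝ (dirDeriv v p o - dirDeriv v q' o) (N o) -
        2 * inner ℝ (p o - q' o) (dirDeriv v N o)) ∧
      (∀ v, dirDeriv v (dirDeriv v (fun z => φ z * inner ℝ (p z - q' z) (p z - q' z) -
        2 * inner ℝ (p z - q' z) (N z))) o =
        dirDeriv v (dirDeriv v φ) o * inner ℝ (p o - q' o) (p o - q' o) +
        4 * dirDeriv v φ o * inner ℝ (p o - q' o) (dirDeriv v p o - dirDeriv v q' o) +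
        2 * φ o * inner ℝ (dirDeriv v p o - dirDeriv v q' o) (dirDeriv v p o - dirDeriv v q' o) +
        2 * φ o * inner ℝ (p o - q' o)
          (dirDeriv v (dirDeriv v p) o - dirDeriv v (dirDeriv v q') o) -
        2 * inner ℝ (dirDeriv v (dirDeriv v p) o - dirDeriv v (dirDeriv v q') o) (N o) -
        4 * inner ℝ (dirDeriv v p o - dirDeriv v q' o) (dirDeriv v N o) -
        2 * inner ℝ (p o - q' o) (dirDeriv v (dirDeriv v N) o)) := by
    intro q' hq'
    have hd : ContDiffAt ℝ 2 (fun z => p z - q' z) o := hp.sub hq'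
    have hdd : ContDiffAt ℝ 2 (fun z => inner ℝ (p z - q' z) (p z - q' z)) o := hd.inner ℝ hd
    have hdN : ContDiffAt ℝ 2 (fun z => inner ℝ (p z - q' z) (N z)) o := hd.inner ℝ hN
    have h2 : ContDiffAt ℝ 2 (fun _ : ℝ × EuclideanSpace ℝ (Fin n) => (2 : ℝ)) o := contDiffAt_const
    refine ⟨(hφ.mul hdd).sub (h2.mul hdN), fun v => ?_, fun v => ?_⟩
    · rw [dirDeriv_sub ((hφ.mul hdd).differentiableAt (by simp))
        ((h2.mul hdN).differentiableAt (by simp)),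
        dirDeriv_mul (hφ.differentiableAt (by simp)) (hdd.differentiableAt (by simp)),
        dirDeriv_mul (h2.differentiableAt (by simp)) (hdN.differentiableAt (by simp)),
        dirDeriv_inner (hd.differentiableAt (by simp)) (hd.differentiableAt (by simp)),
        dirDeriv_inner (hd.differentiableAt (by simp)) (hN.differentiableAt (by simp)),
        dirDeriv_sub (hp.differentiableAt (by simp)) (hq'.differentiableAt (by simp)),
        dirDeriv_const, real_inner_comm (p o - q' o) (dirDeriv v p o - dirDeriv v q' o)]
      ring
    · rw [dirDeriv_dirDeriv_sub (hφ.mul hdd) (h2.mul hdN), dirDeriv_dirDeriv_mul hφ hdd,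
        dirDeriv_dirDeriv_mul h2 hdN, dirDeriv_dirDeriv_inner hd hd,
        dirDeriv_dirDeriv_inner hd hN,
        dirDeriv_inner (hd.differentiableAt (by simp)) (hd.differentiableAt (by simp)),
        dirDeriv_inner (hd.differentiableAt (by simp)) (hN.differentiableAt (by simp)),
        dirDeriv_dirDeriv_sub hp hq',
        dirDeriv_sub (hp.differentiableAt (by simp)) (hq'.differentiableAt (by simp)),
        dirDeriv_const, dirDeriv_const,
        real_inner_comm (p o - q' o) (dirDeriv v p o - dirDeriv v q' o),
        real_inner_comm (p o - q' o) (dirDeriv v (dirDeriv v p) o - dirDeriv v (dirDeriv v q') o)]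
      ring
  -- With the second point frozen, the first order condition determines the gradient of φ.
  obtain ⟨c1, f1, -⟩ := formula (fun _ => q o) contDiffAt_const
  -- With both points moving under the same coordinates, the second order condition is taken in the
  -- reflected directions.
  obtain ⟨c2, f2, s2⟩ := formula q hq
  have m1 := slice_min_conditions c1 h0 hmin₁
  obtain ⟨m2, t2⟩ := past_min_conditions c2 h0 hmin₂
  set d := p o - q o with hd
  set δ := inner ℝ d d with hδ
  have hδpos : (0 : ℝ) < δ := by
    rw [hδ, real_inner_self_eq_norm_sq]
    have : d ≠ 0 := sub_ne_zero.2 hne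
    positivity
  set Z := φ o with hZ
  clear_value δ d Z
  have hdN : inner ℝ d (N o) = Z * δ / 2 := by linarith
  have hNN := H.unit_self
  have hdν : inner ℝ d νy = -(Z * δ / 2) := by
    rw [hν, inner_sub_right, inner_smul_right, hdN, ← hδ]; ring
  have hνN : inner ℝ νy (N o) = 1 - Z ^ 2 * δ / 2 := by
    rw [hν, inner_sub_left, inner_smul_left, hdN, hNN]; simp; ring
  -- the time derivative
  rw [f2, hqt, H.flow.self_of_nhds, H.timeDeriv_normal] at t2
  have e1 : -(Fn o • N o) - -(Fy • νy) = Fy • νy - Fn o • N o := by abel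
  rw [e1, inner_sub_right, inner_sub_left, inner_smul_right, inner_smul_right, inner_smul_left,
    inner_smul_left, hdN, hdν, hνN, hNN, inner_sum] at t2
  simp only [inner_smul_right, inner_add_right, hdN, conj_trivial] at t2
  -- the second derivatives
  have key : ∀ i, 0 ≤ dirDeriv (spaceDir i) (dirDeriv (spaceDir i) φ) o * δ - κ i * Z ^ 2 * δ +
      2 * κ i - 2 * η i - 2 * inner ℝ d (dirDeriv (spaceDir i) (dirDeriv (spaceDir i) N) o) := by
    intro i
    have h1 := (m1 i).1
    have h2 := (m2 i).2
    set c := inner ℝ (dirDeriv (spaceDir i) p o) d with hc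
    have hdp : inner ℝ d (dirDeriv (spaceDir i) p o) = c := real_inner_comm _ _
    rw [f1, dirDeriv_const, sub_zero, H.orthogonal_self, H.dirDeriv_normal, inner_smul_right,
      hdp] at h1
    -- The reflection makes the relative velocity of the two points parallel to d.
    have e2 : dirDeriv (spaceDir i) p o - dirDeriv (spaceDir i) q o = (2 * c / δ) • d := by
      rw [hqi]; abel
    rw [s2, e2, hqii, H.second, H.dirDeriv_normal] at h2
    simp only [inner_smul_right, inner_smul_left, inner_sub_right, inner_sub_left, inner_neg_right,
      inner_neg_left, ← hδ, hdN, hdν, hνN, hNN, hdp, conj_trivial, if_true] at h2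
    have hφi : dirDeriv (spaceDir i) φ o = 2 * (κ i - Z) * c / δ := by
      rw [eq_div_iff hδpos.ne']; linarith
    rw [hφi] at h2
    -- After substituting the gradient of φ, all terms quadratic in c combine to 8(κ_i - Z)c²/δ;
    -- discarding this nonpositive quantity strengthens the inequality.
    have hle : (κ i - Z) * (c ^ 2 / δ) ≤ 0 :=
      mul_nonpos_of_nonpos_of_nonneg (by linarith [hκ i]) (by positivity)
    have e3 : dirDeriv (spaceDir i) (dirDeriv (spaceDir i) φ) o * δ - κ i * Z ^ 2 * δ +
      2 * κ i - 2 * η i - 2 * inner ℝ d (dirDeriv (spaceDir i) (dirDeriv (spaceDir i) N) o) +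
      8 * ((κ i - Z) * (c ^ 2 / δ)) ≥ 0 := by
      refine le_trans h2 (le_of_eq ?_)
      field_simp
      ring
    linarith
  have hsum : 0 ≤ ∑ i, w i * (dirDeriv (spaceDir i) (dirDeriv (spaceDir i) φ) o * δ -
      κ i * Z ^ 2 * δ + 2 * κ i - 2 * η i -
      2 * inner ℝ d (dirDeriv (spaceDir i) (dirDeriv (spaceDir i) N) o)) :=
    Finset.sum_nonneg fun i _ => mul_nonneg (H.nonneg i) (key i)
  have e4 : ∑ i, w i * (dirDeriv (spaceDir i) (dirDeriv (spaceDir i) φ) o * δ -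
      κ i * Z ^ 2 * δ + 2 * κ i - 2 * η i -
      2 * inner ℝ d (dirDeriv (spaceDir i) (dirDeriv (spaceDir i) N) o)) =
      (∑ i, w i * dirDeriv (spaceDir i) (dirDeriv (spaceDir i) φ) o) * δ +
      (∑ i, w i * κ i) * (2 - Z ^ 2 * δ) - 2 * ∑ i, w i * η i -
      2 * ∑ i, w i * inner ℝ d (dirDeriv (spaceDir i) (dirDeriv (spaceDir i) N) o) := by
    simp only [Finset.sum_mul, Finset.mul_sum, ← Finset.sum_add_distrib, ← Finset.sum_sub_distrib]
    exact Finset.sum_congr rfl fun i _ => by ring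
  have e5 : ∑ i, w i * (inner ℝ d (dirDeriv (spaceDir i) (dirDeriv (spaceDir i) N) o) +
      κ i ^ 2 * (Z * δ / 2)) =
      ∑ i, w i * inner ℝ d (dirDeriv (spaceDir i) (dirDeriv (spaceDir i) N) o) +
      (∑ i, w i * κ i ^ 2) * (Z * δ / 2) := by
    simp only [Finset.sum_mul, ← Finset.sum_add_distrib]
    exact Finset.sum_congr rfl fun i _ => by ring
  -- With F(x) = ∑ w_i κ_i its coefficient 2 - Z²δ is the same in `t2` and `hsum`, so it cancels;
  -- the terms in Fy and η are compared through `hFy`.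
  rw [e5, H.speed_eq] at t2
  rw [e4] at hsum
  refine le_of_mul_le_mul_right ?_ hδpos
  linarith

/-- The case where the extremal sphere osculates. -/
lemma NormalFlowData.one_point (H : NormalFlowData o p N Fn w κ) (a : Fin n)
    (hφ : ContDiffAt ℝ 2 φ o) (h0 : φ o = κ a)
    (hmin : ∀ᶠ z in 𝓝 o, z.1 ≤ o.1 →
      0 ≤ φ z * inner ℝ (dirDeriv (spaceDir a) p z) (dirDeriv (spaceDir a) p z) -
        inner ℝ (dirDeriv (spaceDir a) N z) (dirDeriv (spaceDir a) p z)) :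
    dirDeriv (timeDir n) φ o ≤
      ∑ i, w i * dirDeriv (spaceDir i) (dirDeriv (spaceDir i) φ) o +
        (∑ i, w i * κ i ^ 2) * φ o := by
  have hp := (contDiffAt_infty_dirDeriv H.smooth (spaceDir a)).of_le two_le_infty
  have hN := (contDiffAt_infty_dirDeriv H.smooth_normal (spaceDir a)).of_le two_le_infty
  have hg : ContDiffAt ℝ 2 (fun z => inner ℝ (dirDeriv (spaceDir a) p z)
    (dirDeriv (spaceDir a) p z)) o := hp.inner ℝ hp
  have hh : ContDiffAt ℝ 2 (fun z => inner ℝ (dirDeriv (spaceDir a) N z)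
    (dirDeriv (spaceDir a) p z)) o := hN.inner ℝ hp
  have hz : φ o * inner ℝ (dirDeriv (spaceDir a) p o) (dirDeriv (spaceDir a) p o) -
        inner ℝ (dirDeriv (spaceDir a) N o) (dirDeriv (spaceDir a) p o) = 0 := by
    rw [H.frame, H.form_self, h0]; simp
  obtain ⟨m, t⟩ := past_min_conditions ((hφ.mul hg).sub hh) hz hmin
  rw [dirDeriv_sub ((hφ.mul hg).differentiableAt (by simp)) (hh.differentiableAt (by simp)),
    dirDeriv_mul (hφ.differentiableAt (by simp)) (hg.differentiableAt (by simp)), H.metric_time,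
    H.form_time, H.frame, h0] at t
  have hF := (H.speed_second_order a).2
  -- This is the test on φ g_aa - h_aa in direction i, rewritten in terms of the derivatives of g_ii
  -- and h_ii in direction a. Fourth derivatives commute and the third order terms match on both
  -- sides; only the cubic curvature terms survive. Products of first derivatives vanish with those
  -- of the metric.
  have key : ∀ i, 0 ≤ w i * (dirDeriv (spaceDir i) (dirDeriv (spaceDir i) φ) o) +
      w i * κ i ^ 2 * κ a - w i * κ i * κ a ^ 2 -
      w i * (dirDeriv (spaceDir a) (dirDeriv (spaceDir a)
          fun z => inner ℝ (dirDeriv (spaceDir i) N z) (dirDeriv (spaceDir i) p z)) o -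
        κ i * dirDeriv (spaceDir a) (dirDeriv (spaceDir a)
          fun z => inner ℝ (dirDeriv (spaceDir i) p z) (dirDeriv (spaceDir i) p z)) o) := by
    intro i
    have h1 := (m i).2
    rw [dirDeriv_dirDeriv_sub (hφ.mul hg) hh, dirDeriv_dirDeriv_mul hφ hg, H.dirDeriv_metric,
      H.metric_second, H.form_second, H.frame, h0, if_pos rfl] at h1
    rw [H.metric_second, H.form_second, dirDeriv_comm₄ H.smooth]
    refine le_trans (mul_nonneg (H.nonneg i) h1) (le_of_eq ?_)
    by_cases hai : a = i
    · subst hai; simp only [if_true]; ring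
    · simp only [hai, Ne.symm hai, if_false]; ring
  have hsum := Finset.sum_nonneg fun i (_ : i ∈ Finset.univ) => key i
  simp only [Finset.sum_add_distrib, Finset.sum_sub_distrib, ← Finset.sum_mul] at hsum
  rw [← H.speed_eq] at hsum
  rw [h0]
  simp only [if_true] at t
  linarith

end MaximumPrinciple

/-! ### Differentials computed in charts. -/

section Charts

variable {n : ℕ} {M : Type*} [TopologicalSpace M] [ChartedSpace (EuclideanSpace ℝ (Fin n)) M]
  {W : Type*} [NormedAddCommGroup W] [NormedSpace ℝ W]

lemma differential_eq_fderiv {Y : M → W} {x : M}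
    (hY : MDifferentiableAt (𝓡 n) 𝓘(ℝ, W) Y x) :
    differential (n := n) Y x =
      fderiv ℝ (Y ∘ (extChartAt (𝓡 n) x).symm) (extChartAt (𝓡 n) x x) := by
  refine hY.mfderiv.trans ?_
  simp only [writtenInExtChartAt, extChartAt_model_space_eq_id, PartialEquiv.refl_coe,
    Function.id_comp, modelWithCornersSelf_coe, Set.range_id, fderivWithin_univ]
  rfl

lemma fderiv_comp_param {Y : M → W} {Ψ : EuclideanSpace ℝ (Fin n) → M}
    {z : EuclideanSpace ℝ (Fin n)}
    (hY : MDifferentiableAt (𝓡 n) 𝓘(ℝ, W) Y (Ψ z))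
    (hΨ : MDifferentiableAt (𝓡 n) (𝓡 n) Ψ z) (u : EuclideanSpace ℝ (Fin n)) :
    fderiv ℝ (Y ∘ Ψ) z u = differential (n := n) Y (Ψ z) (mfderiv (𝓡 n) (𝓡 n) Ψ z u) := by
  have := mfderiv_comp z hY hΨ
  rw [← mfderiv_eq_fderiv, this]
  rfl

variable [IsManifold (𝓡 n) ∞ M]

lemma contMDiffAt_extChartAt_symm (x : M) {ξ : EuclideanSpace ℝ (Fin n)}
    (hξ : ξ ∈ (extChartAt (𝓡 n) x).target) :
    ContMDiffAt (𝓡 n) (𝓡 n) ∞ (extChartAt (𝓡 n) x).symm ξ :=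
  (contMDiffOn_extChartAt_symm x).contMDiffAt ((isOpen_extChartAt_target x).mem_nhds hξ)

lemma contDiffAt_chart {Y : M → W} {k : WithTop ℕ∞} (hk : k ≤ ∞)
    {x : M} {ξ : EuclideanSpace ℝ (Fin n)}
    (hξ : ξ ∈ (extChartAt (𝓡 n) x).target)
    (hY : ContMDiffAt (𝓡 n) 𝓘(ℝ, W) k Y ((extChartAt (𝓡 n) x).symm ξ)) :
    ContDiffAt ℝ k (Y ∘ (extChartAt (𝓡 n) x).symm) ξ := by
  rw [← contMDiffAt_iff_contDiffAt]
  exact hY.comp ξ ((contMDiffAt_extChartAt_symm x hξ).of_le hk)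

lemma contDiffAt_chart_self {Y : M → W} {k : WithTop ℕ∞} (hk : k ≤ ∞) {x : M}
    (hY : ContMDiffAt (𝓡 n) 𝓘(ℝ, W) k Y x) :
    ContDiffAt ℝ k (Y ∘ (extChartAt (𝓡 n) x).symm) (extChartAt (𝓡 n) x x) :=
  contDiffAt_chart hk (mem_extChartAt_target x) (by simpa using hY)

end Charts

/-! ### Fundamental forms of an immersed hypersurface. -/

section Hypersurface

variable {n : ℕ} {M : Type*} [TopologicalSpace M] [ChartedSpace (EuclideanSpace ℝ (Fin n)) M]

/-- An immersed hypersurface with a smooth unit normal. -/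
structure IsHypersurface (Y N : M → EuclideanSpace ℝ (Fin (n + 1))) : Prop where
  smooth : ContMDiff (𝓡 n) 𝓘(ℝ, EuclideanSpace ℝ (Fin (n + 1))) ∞ Y
  smooth_normal : ContMDiff (𝓡 n) 𝓘(ℝ, EuclideanSpace ℝ (Fin (n + 1))) ∞ N
  immersion : ∀ x, Function.Injective (differential (n := n) Y x)
  norm_eq_one : ∀ x, ‖N x‖ = 1
  orthogonal : ∀ x (u : EuclideanSpace ℝ (Fin n)), inner ℝ (differential Y x u) (N x) = 0

/-- The induced metric as a bilinear form. -/
def metricForm (Y : M → EuclideanSpace ℝ (Fin (n + 1))) (x : M) :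
    LinearMap.BilinForm ℝ (EuclideanSpace ℝ (Fin n)) :=
  (innerₗ (EuclideanSpace ℝ (Fin (n + 1)))).compl₁₂ (differential (n := n) Y x).toLinearMap
    (differential (n := n) Y x).toLinearMap

/-- The second fundamental form as a bilinear form. -/
def curvatureForm (Y N : M → EuclideanSpace ℝ (Fin (n + 1))) (x : M) :
    LinearMap.BilinForm ℝ (EuclideanSpace ℝ (Fin n)) :=
  (innerₗ (EuclideanSpace ℝ (Fin (n + 1)))).compl₁₂ (differential (n := n) N x).toLinearMap
    (differential (n := n) Y x).toLinearMap

lemma inducedMetric_eq (Y : M → EuclideanSpace ℝ (Fin (n + 1))) (x : M) :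
    inducedMetric Y x = fun u v => metricForm Y x u v := rfl

lemma secondFundamentalForm_eq (Y N : M → EuclideanSpace ℝ (Fin (n + 1))) (x : M) :
    secondFundamentalForm Y N x = fun u v => curvatureForm Y N x u v := rfl

lemma metricForm_apply (Y : M → EuclideanSpace ℝ (Fin (n + 1))) (x : M)
    (u v : EuclideanSpace ℝ (Fin n)) :
    metricForm Y x u v = inner ℝ (differential Y x u) (differential Y x v) := rfl

lemma curvatureForm_apply (Y N : M → EuclideanSpace ℝ (Fin (n + 1))) (x : M)
    (u v : EuclideanSpace ℝ (Fin n)) :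
    curvatureForm Y N x u v = inner ℝ (differential N x u) (differential Y x v) := rfl

lemma IsHypersurface.exists_isFrame {Y N : M → EuclideanSpace ℝ (Fin (n + 1))}
    (hY : IsHypersurface Y N) (x : M) : ∃ e, IsFrame (metricForm Y x) e := by
  let A := (differential (n := n) Y x).toLinearMap
  have hA : Function.Injective A := hY.immersion x
  have hr : Module.finrank ℝ (LinearMap.range A) = n := by
    rw [LinearMap.finrank_range_of_inj hA]; simp
  let b := (stdOrthonormalBasis ℝ (LinearMap.range A)).reindex (finCongr hr)
  have hb : ∀ i, ∃ v, A v = b i := fun i => (b i).2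
  choose e he using hb
  refine ⟨e, fun i j => ?_⟩
  change inner ℝ (A (e i)) (A (e j)) = _
  rw [he, he]
  have := (orthonormal_iff_ite.1 b.orthonormal) i j
  exact this

lemma IsHypersurface.inner_normal {Y N : M → EuclideanSpace ℝ (Fin (n + 1))}
    (hY : IsHypersurface Y N) (x : M) : inner ℝ (N x) (N x) = (1 : ℝ) := by
  rw [real_inner_self_eq_norm_sq, hY.norm_eq_one]; norm_num

/-- Vectors are determined by their normal and tangential products. -/
lemma IsHypersurface.ext_inner {Y N : M → EuclideanSpace ℝ (Fin (n + 1))}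
    (hY : IsHypersurface Y N) {x : M} {v w : EuclideanSpace ℝ (Fin (n + 1))}
    (h0 : inner ℝ v (N x) = inner ℝ w (N x))
    (h1 : ∀ u : EuclideanSpace ℝ (Fin n),
      inner ℝ v (differential Y x u) = inner ℝ w (differential Y x u)) : v = w := by
  obtain ⟨e, he⟩ := hY.exists_isFrame x
  exact eq_of_inner_frame (hY.inner_normal x) (fun i => hY.orthogonal x (e i)) he h0
    fun i => h1 (e i)

/-- The tangential projection as a linear map. -/
def tangentialPartL (Y : M → EuclideanSpace ℝ (Fin (n + 1))) (x : M) :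
    EuclideanSpace ℝ (Fin (n + 1)) →L[ℝ] EuclideanSpace ℝ (Fin n) :=
  ((ContinuousLinearMap.adjoint (differential (n := n) Y x)).comp
    (differential (n := n) Y x)).inverse.comp
    (ContinuousLinearMap.adjoint (differential (n := n) Y x))

lemma tangentialPart_eq (Y : M → EuclideanSpace ℝ (Fin (n + 1))) (x : M)
    (w : EuclideanSpace ℝ (Fin (n + 1))) : tangentialPart Y x w = tangentialPartL Y x w := rfl

/-- For an injective differential A the operator A*A is invertible, so `inverse` takes its genuine
value and the tangential part solves the normal equation A*Av = A*w. -/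
lemma IsHypersurface.inner_tangentialPart {Y N : M → EuclideanSpace ℝ (Fin (n + 1))}
    (hY : IsHypersurface Y N) (x : M) (w : EuclideanSpace ℝ (Fin (n + 1)))
    (u : EuclideanSpace ℝ (Fin n)) :
    inner ℝ (differential Y x (tangentialPart Y x w)) (differential Y x u) =
      inner ℝ w (differential Y x u) := by
  set A := differential (n := n) Y x with hA
  have hinj : Function.Injective ((ContinuousLinearMap.adjoint A).comp A).toLinearMap := by
    rw [← LinearMap.ker_eq_bot, LinearMap.ker_eq_bot']
    intro v hv
    have h1 : inner ℝ ((ContinuousLinearMap.adjoint A) (A v)) v = (0 : ℝ) := by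
      have : (ContinuousLinearMap.adjoint A) (A v) = 0 := hv
      rw [this, inner_zero_left]
    rw [ContinuousLinearMap.adjoint_inner_left, inner_self_eq_zero] at h1
    exact hY.immersion x (by rw [← hA, h1, map_zero])
  let e := (LinearEquiv.ofInjectiveEndo _ hinj).toContinuousLinearEquiv
  have he : (e : EuclideanSpace ℝ (Fin n) →L[ℝ] EuclideanSpace ℝ (Fin n)) =
      (ContinuousLinearMap.adjoint A).comp A := by
    ext1 v; rfl
  have hsol : (ContinuousLinearMap.adjoint A) (A (tangentialPart Y x w)) =
      (ContinuousLinearMap.adjoint A) w := by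
    have : tangentialPart Y x w = e.symm ((ContinuousLinearMap.adjoint A) w) := by
      rw [tangentialPart, ← hA, ← he, ContinuousLinearMap.inverse_equiv]; rfl
    rw [this]
    have h2 := congrArg (fun L => L (e.symm ((ContinuousLinearMap.adjoint A) w))) he
    simp only [ContinuousLinearEquiv.coe_coe, ContinuousLinearEquiv.apply_symm_apply] at h2
    exact h2.symm
  rw [← ContinuousLinearMap.adjoint_inner_left, hsol, ContinuousLinearMap.adjoint_inner_left]

lemma IsHypersurface.differential_tangentialPart {Y N : M → EuclideanSpace ℝ (Fin (n + 1))}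
    (hY : IsHypersurface Y N) (x : M) (w : EuclideanSpace ℝ (Fin (n + 1))) :
    differential Y x (tangentialPart Y x w) = w - inner ℝ w (N x) • N x := by
  refine hY.ext_inner (x := x) ?_ fun u => ?_
  · rw [hY.orthogonal, inner_sub_left, inner_smul_left, hY.inner_normal]; simp
  · rw [hY.inner_tangentialPart, inner_sub_left, inner_smul_left, real_inner_comm _ (N x),
      hY.orthogonal]
    simp

lemma IsHypersurface.mdifferentiableAt {Y N : M → EuclideanSpace ℝ (Fin (n + 1))}
    (hY : IsHypersurface Y N) (x : M) :
    MDifferentiableAt (𝓡 n) 𝓘(ℝ, EuclideanSpace ℝ (Fin (n + 1))) Y x :=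
  (hY.smooth x).mdifferentiableAt (by simp)

lemma IsHypersurface.mdifferentiableAt_normal {Y N : M → EuclideanSpace ℝ (Fin (n + 1))}
    (hY : IsHypersurface Y N) (x : M) :
    MDifferentiableAt (𝓡 n) 𝓘(ℝ, EuclideanSpace ℝ (Fin (n + 1))) N x :=
  (hY.smooth_normal x).mdifferentiableAt (by simp)

variable [IsManifold (𝓡 n) ∞ M]

/-- Differentiate ⟨∂_v Y, N⟩ = 0 along u. The new expression makes the symmetry of h visible. -/
lemma IsHypersurface.curvatureForm_eq {Y N : M → EuclideanSpace ℝ (Fin (n + 1))}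
    (hY : IsHypersurface Y N) (x : M) (u v : EuclideanSpace ℝ (Fin n)) :
    curvatureForm Y N x u v = -inner ℝ (N x) (chartSecondDeriv Y x u v) := by
  set c := extChartAt (𝓡 n) x with hc
  have hYc : ContDiffAt ℝ ∞ (Y ∘ c.symm) (c x) := contDiffAt_chart_self le_rfl (hY.smooth x)
  have hNc : ContDiffAt ℝ ∞ (N ∘ c.symm) (c x) := contDiffAt_chart_self le_rfl (hY.smooth_normal x)
  have horth : (fun ξ => inner ℝ (dirDeriv v (Y ∘ c.symm) ξ) ((N ∘ c.symm) ξ)) =ᶠ[𝓝 (c x)]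
      fun _ => (0 : ℝ) := by
    filter_upwards [extChartAt_target_mem_nhds (I := 𝓡 n) x] with ξ hξ
    have hd := (contMDiffAt_extChartAt_symm x hξ).mdifferentiableAt (by simp)
    rw [dirDeriv, fderiv_comp_param (hY.mdifferentiableAt _) hd]
    exact hY.orthogonal _ _
  have h1 := (dirDeriv_congr horth u).self_of_nhds
  have hd1 := (contDiffAt_infty_dirDeriv hYc v).differentiableAt (by simp)
  rw [dirDeriv_const, dirDeriv_inner hd1 (hNc.differentiableAt (by simp))] at h1
  have h2 : dirDeriv u (dirDeriv v (Y ∘ c.symm)) (c x) = chartSecondDeriv Y x u v := by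
    have hd : DifferentiableAt ℝ (fderiv ℝ (Y ∘ c.symm)) (c x) :=
      (hYc.fderiv_right (m := ∞) (by simp)).differentiableAt (by simp)
    have := (hd.hasFDerivAt.clm_apply (hasFDerivAt_const v (c x))).fderiv
    change fderiv ℝ (fun z => fderiv ℝ (Y ∘ c.symm) z v) (c x) u =
      fderiv ℝ (fderiv ℝ (Y ∘ c.symm)) (c x) u v
    rw [this]
    simp
  have h3 : (N ∘ c.symm) (c x) = N x := by simp [hc]
  rw [h2, h3] at h1
  rw [curvatureForm_apply, differential_eq_fderiv (hY.mdifferentiableAt x),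
    differential_eq_fderiv (hY.mdifferentiableAt_normal x), ← hc, real_inner_comm,
    real_inner_comm _ (N x)]
  have h4 : inner ℝ (chartSecondDeriv Y x u v) (N x) +
    inner ℝ (fderiv ℝ (Y ∘ c.symm) (c x) v) (fderiv ℝ (N ∘ c.symm) (c x) u) = 0 := h1
  linarith

lemma chartSecondDeriv_symm {W : Type*} [NormedAddCommGroup W] [NormedSpace ℝ W] {Y : M → W}
    {x : M} (hY : ContMDiffAt (𝓡 n) 𝓘(ℝ, W) 2 Y x) (u v : EuclideanSpace ℝ (Fin n)) :
    chartSecondDeriv Y x u v = chartSecondDeriv Y x v u :=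
  ((contDiffAt_chart_self two_le_infty hY).isSymmSndFDerivAt (by simp)) u v

lemma IsHypersurface.curvatureForm_symm {Y N : M → EuclideanSpace ℝ (Fin (n + 1))}
    (hY : IsHypersurface Y N) (x : M) (u v : EuclideanSpace ℝ (Fin n)) :
    curvatureForm Y N x u v = curvatureForm Y N x v u := by
  rw [hY.curvatureForm_eq, hY.curvatureForm_eq,
    chartSecondDeriv_symm ((hY.smooth x).of_le two_le_infty)]

lemma IsHypersurface.inner_differential_normal {Y N : M → EuclideanSpace ℝ (Fin (n + 1))}
    (hY : IsHypersurface Y N) (x : M) (u : EuclideanSpace ℝ (Fin n)) :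
    inner ℝ (differential N x u) (N x) = (0 : ℝ) := by
  set c := extChartAt (𝓡 n) x with hc
  have hNc : ContDiffAt ℝ ∞ (N ∘ c.symm) (c x) := contDiffAt_chart_self le_rfl (hY.smooth_normal x)
  have hd := hNc.differentiableAt (by simp)
  have h1 := dirDeriv_inner hd hd u
  have e : (fun z => inner ℝ ((N ∘ c.symm) z) ((N ∘ c.symm) z)) = fun _ => (1 : ℝ) := by
    ext z; exact hY.inner_normal _
  rw [e, dirDeriv_const, real_inner_comm _ (dirDeriv u (N ∘ c.symm) (c x))] at h1
  have h3 : (N ∘ c.symm) (c x) = N x := by simp [hc]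
  rw [h3] at h1
  rw [differential_eq_fderiv (hY.mdifferentiableAt_normal x), ← hc, real_inner_comm]
  change inner ℝ (N x) (dirDeriv u (N ∘ c.symm) (c x)) = 0
  linarith

/-- The differential of the normal is tangential, so the Weingarten vector is mapped back to it
exactly; symmetry of h moves that vector to the second slot. -/
lemma IsHypersurface.squaredForm_eq {Y N : M → EuclideanSpace ℝ (Fin (n + 1))}
    (hY : IsHypersurface Y N) (x : M) (u v : EuclideanSpace ℝ (Fin n)) :
    squaredForm Y N x u v = inner ℝ (differential N x u) (differential N x v) := by
  have h1 : squaredForm Y N x u v = curvatureForm Y N x v (weingarten Y N x u) :=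
    hY.curvatureForm_symm x _ _
  rw [h1, curvatureForm_apply, weingarten, hY.differential_tangentialPart,
    hY.inner_differential_normal, zero_smul, sub_zero, real_inner_comm]

/-- In an eigenframe the differential of the normal is diagonal. -/
lemma IsHypersurface.differential_normal_frame {Y N : M → EuclideanSpace ℝ (Fin (n + 1))}
    (hY : IsHypersurface Y N) {x : M} {e : Fin n → EuclideanSpace ℝ (Fin n)} {κ : Fin n → ℝ}
    (he : IsFrame (metricForm Y x) e) (hd : formMatrix (curvatureForm Y N x) e = Matrix.diagonal κ)
    (i : Fin n) : differential N x (e i) = κ i • differential Y x (e i) := by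
  refine eq_of_inner_frame (hY.inner_normal x) (fun i => hY.orthogonal x (e i)) he ?_ fun j => ?_
  · rw [hY.inner_differential_normal, inner_smul_left, hY.orthogonal]; simp
  · have h1 : inner ℝ (differential N x (e i)) (differential Y x (e j)) =
        Matrix.diagonal κ i j := by rw [← hd]; rfl
    have h2 := he i j
    rw [metricForm_apply] at h2
    rw [h1, inner_smul_left, h2, Matrix.diagonal_apply]
    simp

end Hypersurface

/-! ### Chain rules, time slices and quadratic coordinate changes. -/

section Composition

variable {V V₁ W : Type*} [NormedAddCommGroup V] [NormedSpace ℝ V]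
  [NormedAddCommGroup V₁] [NormedSpace ℝ V₁] [NormedAddCommGroup W] [NormedSpace ℝ W]

lemma dirDeriv_comp {K : V₁ → W} {χ : V → V₁} {z : V} (hK : DifferentiableAt ℝ K (χ z))
    (hχ : DifferentiableAt ℝ χ z) (u : V) :
    dirDeriv u (fun z => K (χ z)) z = fderiv ℝ K (χ z) (dirDeriv u χ z) := by
  have := fderiv_comp z hK hχ
  change fderiv ℝ (K ∘ χ) z u = _
  rw [this]; rfl

lemma dirDeriv_dirDeriv_comp {K : V₁ → W} {χ : V → V₁} {z : V} (hK : ContDiffAt ℝ 2 K (χ z))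
    (hχ : ContDiffAt ℝ 2 χ z) (u v : V) :
    dirDeriv u (dirDeriv v fun z => K (χ z)) z =
      fderiv ℝ (fderiv ℝ K) (χ z) (dirDeriv u χ z) (dirDeriv v χ z) +
        fderiv ℝ K (χ z) (dirDeriv u (dirDeriv v χ) z) := by
  have h1 : (dirDeriv v fun z => K (χ z)) =ᶠ[𝓝 z]
      fun z => ContinuousLinearMap.id ℝ (V₁ →L[ℝ] W) (fderiv ℝ K (χ z)) (dirDeriv v χ z) := by
    filter_upwards [hχ.continuousAt.eventually (eventually_differentiableAt hK (by norm_num)),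
      eventually_differentiableAt hχ (by norm_num)] with y h2 h3
    exact dirDeriv_comp h2 h3 v
  have hd : DifferentiableAt ℝ (fderiv ℝ K) (χ z) :=
    (hK.fderiv_right (m := 1) (by norm_num)).differentiableAt (by simp)
  have hχd : DifferentiableAt ℝ χ z := hχ.differentiableAt (by simp)
  have hdc : DifferentiableAt ℝ (fun z => fderiv ℝ K (χ z)) z := hd.comp z hχd
  have hdv : DifferentiableAt ℝ (dirDeriv v χ) z :=
    (contDiffAt_dirDeriv hχ (m := 1) (by norm_num) v).differentiableAt (by simp)
  rw [(dirDeriv_congr h1 u).self_of_nhds,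
    dirDeriv_bilin (ContinuousLinearMap.id ℝ (V₁ →L[ℝ] W)) hdc hdv, dirDeriv_comp hd hχd]
  rfl

lemma dirDeriv_slice {A : ℝ × V → W} {t : ℝ} {z : V} (hA : DifferentiableAt ℝ A (t, z)) (u : V) :
    dirDeriv u (fun z => A (t, z)) z = dirDeriv ((0 : ℝ), u) A (t, z) := by
  have h1 : HasFDerivAt (fun z : V => (t, z)) (ContinuousLinearMap.inr ℝ ℝ V) z :=
    (hasFDerivAt_const t z).prodMk (hasFDerivAt_id z)
  have := (HasFDerivAt.comp (g := A) z hA.hasFDerivAt h1).fderiv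
  change fderiv ℝ (A ∘ fun z => (t, z)) z u = _
  rw [this]; rfl

lemma dirDeriv_dirDeriv_slice {A : ℝ × V → W} {t : ℝ} {z : V} (hA : ContDiffAt ℝ 2 A (t, z))
    (u v : V) : dirDeriv u (dirDeriv v fun z => A (t, z)) z =
      dirDeriv ((0 : ℝ), u) (dirDeriv ((0 : ℝ), v) A) (t, z) := by
  have hc : ContinuousAt (fun z : V => (t, z)) z := by fun_prop
  have h1 : (dirDeriv v fun z => A (t, z)) =ᶠ[𝓝 z] fun z => dirDeriv ((0 : ℝ), v) A (t, z) := by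
    filter_upwards [hc.eventually (eventually_differentiableAt hA (by norm_num))] with y hy
    exact dirDeriv_slice hy v
  rw [(dirDeriv_congr h1 u).self_of_nhds]
  exact dirDeriv_slice
    ((contDiffAt_dirDeriv hA (m := 1) (by norm_num) ((0 : ℝ), v)).differentiableAt (by simp)) u

lemma hasDerivAt_time {A : ℝ × V → W} {t : ℝ} {z : V} (hA : DifferentiableAt ℝ A (t, z)) :
    HasDerivAt (fun s => A (s, z)) (dirDeriv ((1 : ℝ), (0 : V)) A (t, z)) t := by
  have h1 : HasDerivAt (fun s : ℝ => (s, z)) ((1 : ℝ), (0 : V)) t :=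
    (hasDerivAt_id t).prodMk (hasDerivAt_const t z)
  exact hA.hasFDerivAt.comp_hasDerivAt t h1

/-- A quadratic map with prescribed first and second derivatives at the origin. -/
def quadMap (ξ : V) (A : V →L[ℝ] V) (B : V →L[ℝ] V →L[ℝ] V) (z : V) : V :=
  ξ + A z + (1 / 2 : ℝ) • B z z

lemma contDiff_quadMap (ξ : V) (A : V →L[ℝ] V) (B : V →L[ℝ] V →L[ℝ] V) {k : WithTop ℕ∞} :
    ContDiff ℝ k (quadMap ξ A B) := by
  unfold quadMap
  fun_prop

lemma dirDeriv_quadMap (ξ : V) (A : V →L[ℝ] V) (B : V →L[ℝ] V →L[ℝ] V) (u : V) :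
    dirDeriv u (quadMap ξ A B) = fun z => A u + (1 / 2 : ℝ) • (B u z + B z u) := by
  ext z
  have h1 : HasFDerivAt (fun z => B z z) (B.precompR V z (ContinuousLinearMap.id ℝ V) +
      B.precompL V (ContinuousLinearMap.id ℝ V) z) z :=
    B.hasFDerivAt_of_bilinear (hasFDerivAt_id z) (hasFDerivAt_id z)
  have h2 := ((A.hasFDerivAt (x := z)).const_add ξ).add (h1.const_smul (1 / 2 : ℝ))
  have h3 : HasFDerivAt (quadMap ξ A B) _ z := h2
  rw [dirDeriv, h3.fderiv]
  simp [add_comm]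

lemma dirDeriv_dirDeriv_quadMap (ξ : V) (A : V →L[ℝ] V) (B : V →L[ℝ] V →L[ℝ] V)
    (hB : ∀ u v, B u v = B v u) (u v z : V) :
    dirDeriv u (dirDeriv v (quadMap ξ A B)) z = B u v := by
  rw [dirDeriv_quadMap]
  have h2 := (((B v).hasFDerivAt (x := z)).add ((B.flip v).hasFDerivAt (x := z))).const_smul
    (1 / 2 : ℝ)
  have h3 : HasFDerivAt (fun z => A v + (1 / 2 : ℝ) • (B v z + B z v)) _ z := h2.const_add (A v)
  rw [dirDeriv, h3.fderiv]
  simp only [smul_apply, add_apply, ContinuousLinearMap.flip_apply, hB v u]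
  module

end Composition

/-! ### Normal coordinates for the induced metric. -/

section NormalParametrization

variable {n : ℕ} {M : Type*} [TopologicalSpace M] [ChartedSpace (EuclideanSpace ℝ (Fin n)) M]

/-- The linear map which sends the standard basis to the vectors `e`. -/
def frameMap (e : Fin n → EuclideanSpace ℝ (Fin n)) :
    EuclideanSpace ℝ (Fin n) →L[ℝ] EuclideanSpace ℝ (Fin n) :=
  ∑ i, (EuclideanSpace.proj i : EuclideanSpace ℝ (Fin n) →L[ℝ] ℝ).smulRight (e i)

lemma frameMap_stdVec (e : Fin n → EuclideanSpace ℝ (Fin n)) (i : Fin n) :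
    frameMap e (stdVec i) = e i := by
  simp [frameMap, stdVec_apply]

/-- The quadratic correction which makes the coordinates normal. -/
def christoffelCorrection (Y : M → EuclideanSpace ℝ (Fin (n + 1))) (x : M)
    (e : Fin n → EuclideanSpace ℝ (Fin n)) :
    EuclideanSpace ℝ (Fin n) →L[ℝ] EuclideanSpace ℝ (Fin n) →L[ℝ] EuclideanSpace ℝ (Fin n) :=
  -((ContinuousLinearMap.compL ℝ _ _ _ (tangentialPartL Y x)).comp
    ((chartSecondDeriv (n := n) Y x).bilinearComp (frameMap e) (frameMap e)))

lemma christoffelCorrection_apply (Y : M → EuclideanSpace ℝ (Fin (n + 1))) (x : M)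
    (e : Fin n → EuclideanSpace ℝ (Fin n)) (u v : EuclideanSpace ℝ (Fin n)) :
    christoffelCorrection Y x e u v =
      -tangentialPart Y x (chartSecondDeriv Y x (frameMap e u) (frameMap e v)) := by
  simp [christoffelCorrection, tangentialPart_eq]

/-- A parametrization near `x` which is normal at the origin for the metric induced by `Y`, with
coordinate directions `e`. -/
def normalParam (Y : M → EuclideanSpace ℝ (Fin (n + 1))) (x : M)
    (e : Fin n → EuclideanSpace ℝ (Fin n)) (z : EuclideanSpace ℝ (Fin n)) : M :=
  (extChartAt (𝓡 n) x).symm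
    (quadMap (extChartAt (𝓡 n) x x) (frameMap e) (christoffelCorrection Y x e) z)

lemma quadMap_zero {V : Type*} [NormedAddCommGroup V] [NormedSpace ℝ V] (ξ : V) (A : V →L[ℝ] V)
    (B : V →L[ℝ] V →L[ℝ] V) : quadMap ξ A B 0 = ξ := by
  simp [quadMap]

lemma normalParam_zero (Y : M → EuclideanSpace ℝ (Fin (n + 1))) (x : M)
    (e : Fin n → EuclideanSpace ℝ (Fin n)) : normalParam Y x e 0 = x := by
  simp [normalParam, quadMap_zero]

variable [IsManifold (𝓡 n) ∞ M]

lemma eventually_contMDiffAt_normalParam (Y : M → EuclideanSpace ℝ (Fin (n + 1))) (x : M)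
    (e : Fin n → EuclideanSpace ℝ (Fin n)) :
    ∀ᶠ z in 𝓝 (0 : EuclideanSpace ℝ (Fin n)),
      ContMDiffAt (𝓡 n) (𝓡 n) ∞ (normalParam Y x e) z := by
  have hc : ContinuousAt (quadMap (extChartAt (𝓡 n) x x) (frameMap e)
      (christoffelCorrection Y x e)) 0 := (contDiff_quadMap _ _ _ (k := 0)).continuous.continuousAt
  have hmem := hc.eventually_mem (s := (extChartAt (𝓡 n) x).target) (by
    rw [quadMap_zero]; exact extChartAt_target_mem_nhds x)
  filter_upwards [hmem] with z hz
  exact (contMDiffAt_extChartAt_symm x hz).comp z (contDiff_quadMap _ _ _).contMDiff.contMDiffAt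

/-- The quadratic term of the parametrization is minus the Christoffel symbols, so plain second
derivatives at the origin are covariant Hessians. It is used for the position, where only the normal
part remains, and for test functions. -/
lemma dirDeriv_normalParam {W : Type*} [NormedAddCommGroup W] [NormedSpace ℝ W]
    {Y : M → EuclideanSpace ℝ (Fin (n + 1))} {x : M}
    (hY : ContMDiffAt (𝓡 n) 𝓘(ℝ, EuclideanSpace ℝ (Fin (n + 1))) 2 Y x)
    (e : Fin n → EuclideanSpace ℝ (Fin n)) {K : M → W}
    (hK : ContMDiffAt (𝓡 n) 𝓘(ℝ, W) 2 K x) (i j : Fin n) :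
    dirDeriv (stdVec i) (fun z => K (normalParam Y x e z)) 0 = differential K x (e i) ∧
    dirDeriv (stdVec i) (dirDeriv (stdVec j) fun z => K (normalParam Y x e z)) 0 =
      chartSecondDeriv K x (e i) (e j) -
        differential K x (tangentialPart Y x (chartSecondDeriv Y x (e i) (e j))) := by
  set c := extChartAt (𝓡 n) x with hc
  set χ := quadMap (c x) (frameMap e) (christoffelCorrection Y x e) with hχ
  have hχs : ContDiffAt ℝ 2 χ 0 := (contDiff_quadMap _ _ _).contDiffAt
  have h0 : χ 0 = c x := quadMap_zero _ _ _
  have hKc : ContDiffAt ℝ 2 (K ∘ c.symm) (χ 0) := by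
    rw [h0]; exact contDiffAt_chart_self two_le_infty hK
  have hB : ∀ u v, christoffelCorrection Y x e u v = christoffelCorrection Y x e v u := by
    intro u v
    rw [christoffelCorrection_apply, christoffelCorrection_apply, chartSecondDeriv_symm hY]
  have d1 : ∀ i, dirDeriv (stdVec i) χ 0 = e i := by
    intro i
    rw [hχ, dirDeriv_quadMap]
    simp [frameMap_stdVec]
  have hdK : differential (n := n) K x = fderiv ℝ (K ∘ c.symm) (c x) :=
    differential_eq_fderiv (hK.mdifferentiableAt (by simp))
  constructor
  · have := dirDeriv_comp (hKc.differentiableAt (by simp)) (hχs.differentiableAt (by simp))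
      (stdVec i)
    rw [d1, h0] at this
    rw [hdK]
    exact this
  · have := dirDeriv_dirDeriv_comp hKc hχs (stdVec i) (stdVec j)
    rw [d1, d1, h0, hχ, dirDeriv_dirDeriv_quadMap _ _ _ hB, christoffelCorrection_apply,
      frameMap_stdVec, frameMap_stdVec, map_neg, ← sub_eq_add_neg] at this
    rw [hdK]
    exact this

end NormalParametrization

/-! ### The flow in space-time normal coordinates. -/

section Flow

variable {n : ℕ} {M : Type*} [TopologicalSpace M] [ChartedSpace (EuclideanSpace ℝ (Fin n)) M]

/-- A smooth solution of the flow, with the pointwise information on which the maximum principle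
argument relies. -/
structure IsSmoothFlow (Γ : Set (Fin n → ℝ)) (f : (Fin n → ℝ) → ℝ) (T : ℝ)
    (X ν : ℝ → M → EuclideanSpace ℝ (Fin (n + 1))) : Prop where
  smooth : ContMDiffOn (𝓘(ℝ, ℝ).prod (𝓡 n)) 𝓘(ℝ, EuclideanSpace ℝ (Fin (n + 1))) ∞
    (fun p : ℝ × M => X p.1 p.2) (Ico 0 T ×ˢ univ)
  smooth_normal : ContMDiffOn (𝓘(ℝ, ℝ).prod (𝓡 n)) 𝓘(ℝ, EuclideanSpace ℝ (Fin (n + 1))) ∞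
    (fun p : ℝ × M => ν p.1 p.2) (Ico 0 T ×ˢ univ)
  injective : ∀ t ∈ Ico 0 T, Function.Injective (X t)
  immersion : ∀ t ∈ Ico 0 T, ∀ x, Function.Injective (differential (n := n) (X t) x)
  norm_eq_one : ∀ t ∈ Ico 0 T, ∀ x, ‖ν t x‖ = 1
  orthogonal : ∀ t ∈ Ico 0 T, ∀ x (u : EuclideanSpace ℝ (Fin n)),
    inner ℝ (differential (X t) x u) (ν t x) = 0
  flow : ∀ t ∈ Ico 0 T, ∀ x, ∃ κ ∈ Γ,
    IsEigenvalueList (inducedMetric (X t) x) (secondFundamentalForm (X t) (ν t) x) κ ∧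
    HasDerivWithinAt (fun s => X s x) (-(f κ) • ν t x) (Ico 0 T) t

lemma contMDiff_slice {W : Type*} [NormedAddCommGroup W] [NormedSpace ℝ W] {k : WithTop ℕ∞}
    {T : ℝ} {K : ℝ → M → W} (hK : ContMDiffOn (𝓘(ℝ, ℝ).prod (𝓡 n)) 𝓘(ℝ, W) k
      (fun p : ℝ × M => K p.1 p.2) (Ico 0 T ×ˢ univ)) {t : ℝ} (ht : t ∈ Ico 0 T) :
    ContMDiff (𝓡 n) 𝓘(ℝ, W) k (K t) := by
  have h1 : ContMDiff (𝓡 n) (𝓘(ℝ, ℝ).prod (𝓡 n)) k (fun x : M => (t, x)) :=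
    contMDiff_const.prodMk contMDiff_id
  rw [← contMDiffOn_univ]
  exact ContMDiffOn.comp (g := fun p : ℝ × M => K p.1 p.2) (f := fun x : M => (t, x)) hK
    h1.contMDiffOn fun x _ => ⟨ht, mem_univ x⟩

lemma contDiffAt_spacetime {W : Type*} [NormedAddCommGroup W] [NormedSpace ℝ W] {k : WithTop ℕ∞}
    {T : ℝ} {K : ℝ → M → W} (hK : ContMDiffOn (𝓘(ℝ, ℝ).prod (𝓡 n)) 𝓘(ℝ, W) k
      (fun p : ℝ × M => K p.1 p.2) (Ico 0 T ×ˢ univ)) {t : ℝ} (ht : t ∈ Ioo 0 T)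
    {Ψ : EuclideanSpace ℝ (Fin n) → M} {z : EuclideanSpace ℝ (Fin n)}
    (hΨ : ContMDiffAt (𝓡 n) (𝓡 n) k Ψ z) :
    ContDiffAt ℝ k (fun z : ℝ × EuclideanSpace ℝ (Fin n) => K z.1 (Ψ z.2)) (t, z) := by
  rw [← contMDiffAt_iff_contDiffAt]
  have h1 : ContMDiffAt 𝓘(ℝ, ℝ × EuclideanSpace ℝ (Fin n)) (𝓘(ℝ, ℝ).prod (𝓡 n)) k
      (fun z : ℝ × EuclideanSpace ℝ (Fin n) => (z.1, Ψ z.2)) (t, z) := by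
    refine ContMDiffAt.prodMk contDiff_fst.contMDiff.contMDiffAt ?_
    exact ContMDiffAt.comp (t, z) (g := Ψ) hΨ contDiff_snd.contMDiff.contMDiffAt
  have hmem : Ico 0 T ×ˢ (univ : Set M) ∈ 𝓝 (t, Ψ z) :=
    prod_mem_nhds (Ico_mem_nhds ht.1 ht.2) univ_mem
  exact ContMDiffAt.comp (t, z) (g := fun p : ℝ × M => K p.1 p.2) (hK.contMDiffAt hmem) h1

variable {Γ : Set (Fin n → ℝ)} {f : (Fin n → ℝ) → ℝ} {T : ℝ}
  {X ν : ℝ → M → EuclideanSpace ℝ (Fin (n + 1))}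

lemma IsSmoothFlow.isHypersurface (hX : IsSmoothFlow Γ f T X ν) {t : ℝ} (ht : t ∈ Ico 0 T) :
    IsHypersurface (X t) (ν t) where
  smooth := contMDiff_slice hX.smooth ht
  smooth_normal := contMDiff_slice hX.smooth_normal ht
  immersion := hX.immersion t ht
  norm_eq_one := hX.norm_eq_one t ht
  orthogonal := hX.orthogonal t ht

/-- Derivatives in a parametrization are pulled back differentials. -/
lemma dirDeriv_space_eq {W : Type*} [NormedAddCommGroup W] [NormedSpace ℝ W] {k : WithTop ℕ∞}
    (hk : 1 ≤ k) {K : ℝ → M → W} (hK : ContMDiffOn (𝓘(ℝ, ℝ).prod (𝓡 n)) 𝓘(ℝ, W) k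
      (fun p : ℝ × M => K p.1 p.2) (Ico 0 T ×ˢ univ)) {t : ℝ} (ht : t ∈ Ioo 0 T)
    {Ψ : EuclideanSpace ℝ (Fin n) → M} {z : EuclideanSpace ℝ (Fin n)}
    (hΨ : ContMDiffAt (𝓡 n) (𝓡 n) k Ψ z) (u : EuclideanSpace ℝ (Fin n)) :
    dirDeriv ((0 : ℝ), u) (fun z : ℝ × EuclideanSpace ℝ (Fin n) => K z.1 (Ψ z.2)) (t, z) =
      differential (K t) (Ψ z) (mfderiv (𝓡 n) (𝓡 n) Ψ z u) := by
  have hk0 : k ≠ 0 := by rintro rfl; simp at hk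
  rw [← dirDeriv_slice ((contDiffAt_spacetime hK ht hΨ).differentiableAt hk0) u]
  exact fderiv_comp_param ((contMDiff_slice hK (Ioo_subset_Ico_self ht) _).mdifferentiableAt hk0)
    (hΨ.mdifferentiableAt hk0) u

lemma IsSmoothFlow.dirDeriv_time (hX : IsSmoothFlow Γ f T X ν) {t : ℝ} (ht : t ∈ Ioo 0 T)
    {Ψ : EuclideanSpace ℝ (Fin n) → M} {z : EuclideanSpace ℝ (Fin n)}
    (hΨ : ContMDiffAt (𝓡 n) (𝓡 n) ∞ Ψ z) :
    ∃ κ ∈ Γ, IsEigenvalueList (inducedMetric (X t) (Ψ z))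
      (secondFundamentalForm (X t) (ν t) (Ψ z)) κ ∧
    dirDeriv (timeDir n) (fun z : ℝ × EuclideanSpace ℝ (Fin n) => X z.1 (Ψ z.2)) (t, z) =
      -(f κ • ν t (Ψ z)) := by
  obtain ⟨κ, hκ, hl, hd⟩ := hX.flow t (Ioo_subset_Ico_self ht) (Ψ z)
  refine ⟨κ, hκ, hl, ?_⟩
  have h1 := hd.hasDerivAt (Ico_mem_nhds ht.1 ht.2)
  have h2 := hasDerivAt_time ((contDiffAt_spacetime hX.smooth ht hΨ).differentiableAt (by simp))
  rw [← neg_smul]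
  exact h2.unique h1

variable [IsManifold (𝓡 n) ∞ M]

/-- Spatial derivatives of a space-time function in normal coordinates. -/
lemma spatial_derivs {W : Type*} [NormedAddCommGroup W] [NormedSpace ℝ W]
    (hX : IsSmoothFlow Γ f T X ν) {t : ℝ} (ht : t ∈ Ioo 0 T) (x : M)
    (e : Fin n → EuclideanSpace ℝ (Fin n)) {K : ℝ → M → W}
    (hK : ContMDiffOn (𝓘(ℝ, ℝ).prod (𝓡 n)) 𝓘(ℝ, W) 2
      (fun p : ℝ × M => K p.1 p.2) (Ico 0 T ×ˢ univ)) (i j : Fin n) :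
    dirDeriv (spaceDir i) (fun z : ℝ × EuclideanSpace ℝ (Fin n) =>
      K z.1 (normalParam (X t) x e z.2)) (t, 0) = differential (K t) x (e i) ∧
    dirDeriv (spaceDir i) (dirDeriv (spaceDir j) fun z : ℝ × EuclideanSpace ℝ (Fin n) =>
      K z.1 (normalParam (X t) x e z.2)) (t, 0) = chartSecondDeriv (K t) x (e i) (e j) -
        differential (K t) x (tangentialPart (X t) x (chartSecondDeriv (X t) x (e i) (e j))) := by
  have ht' : t ∈ Ico 0 T := Ioo_subset_Ico_self ht
  have hY := hX.isHypersurface ht'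
  have hΨ := (eventually_contMDiffAt_normalParam (X t) x e).self_of_nhds.of_le two_le_infty
  have hs := contDiffAt_spacetime hK ht hΨ
  obtain ⟨h1, h2⟩ := dirDeriv_normalParam ((hY.smooth x).of_le two_le_infty) e
    (contMDiff_slice hK ht' x) i j
  rw [← h1, ← h2]
  exact ⟨(dirDeriv_slice (hs.differentiableAt (by simp)) _).symm,
    (dirDeriv_dirDeriv_slice hs _ _).symm⟩

/-- The speed is taken to be -⟨∂_t X, ν⟩: smooth because X and ν are, although f is only C¹ and the
eigenvalue lists are chosen pointwise. -/
lemma IsSmoothFlow.normalFlowData (hf : IsConcaveSpeed Γ f) (hX : IsSmoothFlow Γ f T X ν)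
    {t : ℝ} (ht : t ∈ Ioo 0 T) {x : M} {e : Fin n → EuclideanSpace ℝ (Fin n)} {κ : Fin n → ℝ}
    (he : IsFrame (metricForm (X t) x) e)
    (hd : formMatrix (curvatureForm (X t) (ν t) x) e = Matrix.diagonal κ) (hκ : κ ∈ Γ) :
    NormalFlowData (t, 0) (fun z => X z.1 (normalParam (X t) x e z.2))
      (fun z => ν z.1 (normalParam (X t) x e z.2))
      (fun z => -inner ℝ (dirDeriv (timeDir n) (fun z => X z.1 (normalParam (X t) x e z.2)) z)
        (ν z.1 (normalParam (X t) x e z.2))) (grad f κ) κ := by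
  set Ψ := normalParam (X t) x e with hΨdef
  have hΨ0 : Ψ 0 = x := normalParam_zero _ _ _
  have ht' : t ∈ Ico 0 T := Ioo_subset_Ico_self ht
  have hY := hX.isHypersurface ht'
  have hΨe := eventually_contMDiffAt_normalParam (X t) x e
  have hev : ∀ᶠ z : ℝ × EuclideanSpace ℝ (Fin n) in 𝓝 (t, 0),
      z.1 ∈ Ioo 0 T ∧ ContMDiffAt (𝓡 n) (𝓡 n) ∞ Ψ z.2 :=
    Filter.Eventually.prod_nhds (p := fun s => s ∈ Ioo 0 T) (isOpen_Ioo.mem_nhds ht) hΨe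
  have hs := contDiffAt_spacetime hX.smooth ht hΨe.self_of_nhds
  have hsN := contDiffAt_spacetime hX.smooth_normal ht hΨe.self_of_nhds
  have hnorm : ∀ z : ℝ × EuclideanSpace ℝ (Fin n), z.1 ∈ Ioo 0 T →
      inner ℝ (ν z.1 (Ψ z.2)) (ν z.1 (Ψ z.2)) = (1 : ℝ) := fun z hz =>
    (hX.isHypersurface (Ioo_subset_Ico_self hz)).inner_normal _
  have hspeed : ∀ z : ℝ × EuclideanSpace ℝ (Fin n), z.1 ∈ Ioo 0 T →
      ContMDiffAt (𝓡 n) (𝓡 n) ∞ Ψ z.2 → ∃ κ ∈ Γ, IsEigenvalueList (inducedMetric (X z.1) (Ψ z.2))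
        (secondFundamentalForm (X z.1) (ν z.1) (Ψ z.2)) κ ∧
      dirDeriv (timeDir n) (fun z => X z.1 (Ψ z.2)) z = -(f κ • ν z.1 (Ψ z.2)) ∧
      -inner ℝ (dirDeriv (timeDir n) (fun z => X z.1 (Ψ z.2)) z) (ν z.1 (Ψ z.2)) = f κ := by
    intro z hz hz'
    obtain ⟨κ, h1, h2, h3⟩ := hX.dirDeriv_time hz hz'
    refine ⟨κ, h1, h2, h3, ?_⟩
    have h3' : dirDeriv (timeDir n) (fun z => X z.1 (Ψ z.2)) z = -(f κ • ν z.1 (Ψ z.2)) := h3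
    rw [h3', inner_neg_left, inner_smul_left, hnorm z hz]
    simp
  refine ⟨hs, hsN, ?_, ?_, fun u => ?_, ?_, fun i j => ?_, fun i j => ?_, ?_, ?_,
    hf.grad_nonneg hκ⟩
  · exact ((contDiffAt_infty_dirDeriv hs (timeDir n)).inner ℝ hsN).neg
  · filter_upwards [hev] with z hz using hnorm z hz.1
  · filter_upwards [hev] with z hz
    rw [dirDeriv_space_eq (one_le_infty) hX.smooth hz.1 hz.2]
    exact hX.orthogonal z.1 (Ioo_subset_Ico_self hz.1) _ _
  · filter_upwards [hev] with z hz
    obtain ⟨κ', -, -, h3, h4⟩ := hspeed z hz.1 hz.2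
    rw [h4, h3]
  · rw [(spatial_derivs hX ht x e (hX.smooth.of_le two_le_infty) i i).1,
      (spatial_derivs hX ht x e (hX.smooth.of_le two_le_infty) j j).1]
    exact he i j
  · rw [(spatial_derivs hX ht x e (hX.smooth.of_le two_le_infty) i j).2,
      hY.differential_tangentialPart, sub_sub_cancel, ← neg_smul]
    have h1 : curvatureForm (X t) (ν t) x (e i) (e j) = Matrix.diagonal κ i j := by
      rw [← hd]; rfl
    rw [hY.curvatureForm_eq, real_inner_comm] at h1
    have h2 : inner ℝ (chartSecondDeriv (X t) x (e i) (e j)) (ν t x) =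
        -(if i = j then κ i else 0) := by
      rw [← Matrix.diagonal_apply, ← h1, neg_neg]
    rw [h2, hΨ0]
  -- Pushed forward by the parametrization, E is an orthonormal frame at the nearby point, where the
  -- tangent plane inequality with weights from κ applies.
  · filter_upwards [hev] with z hz E hE
    obtain ⟨κ', h1, h2, -, h4⟩ := hspeed z hz.1 hz.2
    rw [h4]
    have eX : ∀ u, dirDeriv ((0 : ℝ), u) (fun z => X z.1 (Ψ z.2)) z =
        differential (X z.1) (Ψ z.2) (mfderiv (𝓡 n) (𝓡 n) Ψ z.2 u) := fun u =>
      dirDeriv_space_eq one_le_infty hX.smooth hz.1 hz.2 u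
    have eN : ∀ u, dirDeriv ((0 : ℝ), u) (fun z => ν z.1 (Ψ z.2)) z =
        differential (ν z.1) (Ψ z.2) (mfderiv (𝓡 n) (𝓡 n) Ψ z.2 u) := fun u =>
      dirDeriv_space_eq one_le_infty hX.smooth_normal hz.1 hz.2 u
    simp only [eX, eN] at hE ⊢
    exact hf.le_sum_grad (g := metricForm (X z.1) (Ψ z.2))
      (h := curvatureForm (X z.1) (ν z.1) (Ψ z.2)) h2 h1 hκ
      (E := fun i => mfderiv (𝓡 n) (𝓡 n) Ψ z.2 (E i)) hE
  -- The list supplied by the flow need not be κ itself, but f takes the same value on both.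
  · obtain ⟨κ', h1, h2, -, h4⟩ := hspeed (t, 0) ht hΨe.self_of_nhds
    rw [h4, hf.euler hκ]
    rw [hΨ0] at h2
    exact (hf.eq_of_isEigenvalueList (isEigenvalueList_iff.2 ⟨e, he, hd⟩) hκ h2).2

end Flow

/-! ### Strict contact near the diagonal, in a chart. -/

section Flat

variable {V W : Type*} [NormedAddCommGroup V] [NormedSpace ℝ V]

lemma pos_of_second_deriv_pos {r r' r'' : ℝ → ℝ} (h1 : ∀ s ∈ Icc (0 : ℝ) 1, HasDerivAt r (r' s) s)
    (h2 : ∀ s ∈ Icc (0 : ℝ) 1, HasDerivAt r' (r'' s) s) (h3 : ∀ s ∈ Icc (0 : ℝ) 1, 0 < r'' s)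
    (h0 : r 0 = 0) (h0' : r' 0 = 0) : 0 < r 1 := by
  have m1 : StrictMonoOn r' (Icc 0 1) := by
    refine strictMonoOn_of_deriv_pos (convex_Icc 0 1)
      (fun s hs => (h2 s hs).continuousAt.continuousWithinAt) fun s hs => ?_
    rw [(h2 s (interior_subset hs)).deriv]
    exact h3 s (interior_subset hs)
  have m2 : StrictMonoOn r (Icc 0 1) := by
    refine strictMonoOn_of_deriv_pos (convex_Icc 0 1)
      (fun s hs => (h1 s hs).continuousAt.continuousWithinAt) fun s hs => ?_
    rw [(h1 s (interior_subset hs)).deriv]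
    rw [interior_Icc] at hs
    simpa [h0'] using m1 (left_mem_Icc.2 zero_le_one) (Ioo_subset_Icc_self hs) hs.1
  simpa [h0] using m2 (left_mem_Icc.2 zero_le_one) (right_mem_Icc.2 zero_le_one) zero_lt_one

lemma dirDeriv_dirDeriv_eq [NormedAddCommGroup W] [NormedSpace ℝ W] {A : V → W} {o : V}
    (hA : ContDiffAt ℝ 2 A o) (u v : V) :
    dirDeriv u (dirDeriv v A) o = fderiv ℝ (fderiv ℝ A) o u v := by
  have hd : DifferentiableAt ℝ (fderiv ℝ A) o :=
    (hA.fderiv_right (m := 1) (by norm_num)).differentiableAt (by simp)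
  have := (hd.hasFDerivAt.clm_apply (hasFDerivAt_const v o)).fderiv
  change fderiv ℝ (fun z => fderiv ℝ A z v) o u = _
  rw [this]; simp

/-- Spatial derivatives of a function which is smooth up to the initial time are again so. -/
lemma contDiffOn_partial_fderiv [NormedAddCommGroup W] [NormedSpace ℝ W] {K : ℝ × V → W}
    {S : Set ℝ} {U : Set V} (hS : UniqueDiffOn ℝ S) (hU : IsOpen U)
    (hK : ContDiffOn ℝ ∞ K (S ×ˢ U)) :
    ContDiffOn ℝ ∞ (fun z : ℝ × V => fderiv ℝ (fun ξ => K (z.1, ξ)) z.2) (S ×ˢ U) := by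
  -- The within-derivative restricted to spatial vectors; this remains valid at an endpoint of S,
  -- such as the initial time.
  have h1 : ContDiffOn ℝ ∞ (fun z => (fderivWithin ℝ K (S ×ˢ U) z).comp
      (ContinuousLinearMap.inr ℝ ℝ V)) (S ×ˢ U) :=
    (hK.fderivWithin (hS.prod hU.uniqueDiffOn) (m := ∞) (by simp)).clm_comp contDiffOn_const
  refine h1.congr fun z hz => ?_
  have h2 : HasFDerivWithinAt (fun ξ : V => (z.1, ξ)) (ContinuousLinearMap.inr ℝ ℝ V) U z.2 :=
    ((hasFDerivAt_const z.1 z.2).prodMk (hasFDerivAt_id z.2)).hasFDerivWithinAt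
  have h3 := (hK.differentiableOn (by simp) z hz).hasFDerivWithinAt
  have h4 : HasFDerivWithinAt (fun ξ : V => K (z.1, ξ)) _ U z.2 :=
    HasFDerivWithinAt.comp (g := K) (f := fun ξ : V => (z.1, ξ)) z.2 h3 h2
      (fun ξ hξ => ⟨hz.1, hξ⟩)
  exact (h4.hasFDerivAt (hU.mem_nhds hz.2)).fderiv

variable [NormedAddCommGroup W] [InnerProductSpace ℝ W]

/-- The derivatives of the function which measures the contact of `P` with a sphere. -/
lemma dirDeriv_contact {P : V → W} {η : V} (hP : ContDiffAt ℝ 2 P η) (a : ℝ) (b m : W) (v : V) :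
    ContDiffAt ℝ 2 (fun η => a * inner ℝ (P η - b) (P η - b) + 2 * inner ℝ (P η - b) m) η ∧
    dirDeriv v (fun η => a * inner ℝ (P η - b) (P η - b) + 2 * inner ℝ (P η - b) m) η =
      2 * (a * inner ℝ (P η - b) (fderiv ℝ P η v) + inner ℝ (fderiv ℝ P η v) m) ∧
    dirDeriv v (dirDeriv v
        fun η => a * inner ℝ (P η - b) (P η - b) + 2 * inner ℝ (P η - b) m) η =
      2 * (a * (inner ℝ (fderiv ℝ P η v) (fderiv ℝ P η v) +
        inner ℝ (P η - b) (fderiv ℝ (fderiv ℝ P) η v v)) +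
        inner ℝ (fderiv ℝ (fderiv ℝ P) η v v) m) := by
  have key : ∀ {η : V}, ContDiffAt ℝ 2 P η →
      dirDeriv v (fun η => a * inner ℝ (P η - b) (P η - b) + 2 * inner ℝ (P η - b) m) η =
      2 * (a * inner ℝ (P η - b) (dirDeriv v P η) + inner ℝ (dirDeriv v P η) m) := by
    intro η hP
    have hd : DifferentiableAt ℝ P η := hP.differentiableAt (by simp)
    have h1 : DifferentiableAt ℝ (fun η => P η - b) η := hd.sub_const b
    have e1 : dirDeriv v (fun η => P η - b) η = dirDeriv v P η := by
      simp [dirDeriv, fderiv_sub_const]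
    rw [dirDeriv_add ((h1.inner ℝ h1).const_mul a)
      ((h1.inner ℝ (differentiableAt_const m)).const_mul 2),
      dirDeriv_mul (differentiableAt_const a) (h1.inner ℝ h1),
      dirDeriv_mul (differentiableAt_const 2) (h1.inner ℝ (differentiableAt_const m)),
      dirDeriv_inner h1 h1, dirDeriv_inner h1 (differentiableAt_const m), e1, dirDeriv_const,
      dirDeriv_const, dirDeriv_const, real_inner_comm (dirDeriv v P η)]
    simp
    ring
  have hs : ContDiffAt ℝ 2 (fun η => P η - b) η := hP.sub contDiffAt_const
  refine ⟨(contDiffAt_const.mul (hs.inner ℝ hs)).add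
    (contDiffAt_const.mul (hs.inner ℝ contDiffAt_const)), key hP, ?_⟩
  have h1 : dirDeriv v (fun η => a * inner ℝ (P η - b) (P η - b) + 2 * inner ℝ (P η - b) m) =ᶠ[𝓝 η]
      fun η => 2 * (a * inner ℝ (P η - b) (dirDeriv v P η) + inner ℝ (dirDeriv v P η) m) := by
    filter_upwards [hP.eventually (by simp)] with η hη using key hη
  have hd : DifferentiableAt ℝ P η := hP.differentiableAt (by simp)
  have h2 : DifferentiableAt ℝ (fun η => P η - b) η := hd.sub_const b
  have h3 : DifferentiableAt ℝ (dirDeriv v P) η :=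
    (contDiffAt_dirDeriv hP (m := 1) (by norm_num) v).differentiableAt (by simp)
  have e1 : dirDeriv v (fun η => P η - b) η = dirDeriv v P η := by
    simp [dirDeriv, fderiv_sub_const]
  rw [(dirDeriv_congr h1 v).self_of_nhds,
    dirDeriv_mul (differentiableAt_const 2) (((h2.inner ℝ h3).const_mul a).fun_add
      (h3.inner ℝ (differentiableAt_const m))),
    dirDeriv_add ((h2.inner ℝ h3).const_mul a) (h3.inner ℝ (differentiableAt_const m)),
    dirDeriv_mul (differentiableAt_const a) (h2.inner ℝ h3),
    dirDeriv_inner h2 h3, dirDeriv_inner h3 (differentiableAt_const m), e1, dirDeriv_const,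
    dirDeriv_const, dirDeriv_const, dirDeriv_dirDeriv_eq hP]
  simp [dirDeriv]

/-- For fixed t and ξ the expression vanishes at η = ξ together with its gradient, by orthogonality
of N. Positivity of its second derivative at the base point persists nearby, so it is positive at
the far end of every short nondegenerate segment issuing from ξ. -/
lemma eventually_contact_pos [FiniteDimensional ℝ V] {P N : ℝ × V → W} {S : Set ℝ} {U : Set V}
    (hS : UniqueDiffOn ℝ S) (hU : IsOpen U) (hP : ContDiffOn ℝ ∞ P (S ×ˢ U))
    (hN : ContinuousOn N (S ×ˢ U))
    (horth : ∀ t ∈ S, ∀ ξ ∈ U, ∀ v, inner ℝ (fderiv ℝ (fun ξ => P (t, ξ)) ξ v) (N (t, ξ)) = 0)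
    {t₁ : ℝ} {ξ₁ : V} (ht₁ : t₁ ∈ S) (hξ₁ : ξ₁ ∈ U) {a : ℝ}
    (hpos : ∀ v ≠ 0, 0 < a * inner ℝ (fderiv ℝ (fun ξ => P (t₁, ξ)) ξ₁ v)
        (fderiv ℝ (fun ξ => P (t₁, ξ)) ξ₁ v) +
      inner ℝ (fderiv ℝ (fderiv ℝ fun ξ => P (t₁, ξ)) ξ₁ v v) (N (t₁, ξ₁))) :
    ∀ᶠ z : ℝ × V × V in 𝓝 (t₁, ξ₁, ξ₁), z.1 ∈ S → z.2.1 ≠ z.2.2 →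
      0 < a * inner ℝ (P (z.1, z.2.2) - P (z.1, z.2.1)) (P (z.1, z.2.2) - P (z.1, z.2.1)) +
        2 * inner ℝ (P (z.1, z.2.2) - P (z.1, z.2.1)) (N (z.1, z.2.1)) := by
  let D₁ : ℝ × V → V →L[ℝ] W := fun z => fderiv ℝ (fun ξ => P (z.1, ξ)) z.2
  let D₂ : ℝ × V → V →L[ℝ] V →L[ℝ] W := fun z => fderiv ℝ (fun ξ => D₁ (z.1, ξ)) z.2
  have hD₁ : ContDiffOn ℝ ∞ D₁ (S ×ˢ U) := contDiffOn_partial_fderiv hS hU hP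
  have hD₂ : ContDiffOn ℝ ∞ D₂ (S ×ˢ U) := contDiffOn_partial_fderiv hS hU hD₁
  let Q : (ℝ × V × V) × V → ℝ := fun z =>
    a * (inner ℝ (D₁ (z.1.1, z.1.2.2) z.2) (D₁ (z.1.1, z.1.2.2) z.2) +
        inner ℝ (P (z.1.1, z.1.2.2) - P (z.1.1, z.1.2.1)) (D₂ (z.1.1, z.1.2.2) z.2 z.2)) +
      inner ℝ (D₂ (z.1.1, z.1.2.2) z.2 z.2) (N (z.1.1, z.1.2.1))
  have hslice : ∀ t ∈ S, ∀ ξ ∈ U, ContDiffAt ℝ 2 (fun ξ => P (t, ξ)) ξ := by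
    intro t ht ξ hξ
    have h1 : ContDiffOn ℝ ∞ (fun ξ => P (t, ξ)) U :=
      ContDiffOn.comp (g := P) (f := fun ξ => (t, ξ)) hP
        (contDiff_const.prodMk contDiff_id).contDiffOn fun ξ hξ => ⟨ht, hξ⟩
    exact (h1.contDiffAt (hU.mem_nhds hξ)).of_le two_le_infty
  have hQ : ContinuousOn Q ((S ×ˢ U ×ˢ U) ×ˢ univ) := by
    have m1 : MapsTo (fun z : (ℝ × V × V) × V => (z.1.1, z.1.2.1)) ((S ×ˢ U ×ˢ U) ×ˢ univ)
        (S ×ˢ U) := fun z hz => ⟨hz.1.1, hz.1.2.1⟩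
    have m2 : MapsTo (fun z : (ℝ × V × V) × V => (z.1.1, z.1.2.2)) ((S ×ˢ U ×ˢ U) ×ˢ univ)
        (S ×ˢ U) := fun z hz => ⟨hz.1.1, hz.1.2.2⟩
    have c1 : Continuous (fun z : (ℝ × V × V) × V => (z.1.1, z.1.2.1)) := by fun_prop
    have c2 : Continuous (fun z : (ℝ × V × V) × V => (z.1.1, z.1.2.2)) := by fun_prop
    have p1 := hP.continuousOn.comp c1.continuousOn m1
    have p2 := hP.continuousOn.comp c2.continuousOn m2
    have d1 := (hD₁.continuousOn.comp c2.continuousOn m2).clm_apply continuous_snd.continuousOn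
    have d2 := ((hD₂.continuousOn.comp c2.continuousOn m2).clm_apply
      continuous_snd.continuousOn).clm_apply continuous_snd.continuousOn
    have n1 := hN.comp c1.continuousOn m1
    exact (continuousOn_const.mul ((d1.inner d1).add ((p2.sub p1).inner d2))).add (d2.inner n1)
  -- Compactness of the unit sphere gives one neighbourhood valid for all directions.
  have hsph : ∀ᶠ z in 𝓝 (t₁, ξ₁, ξ₁), ∀ v ∈ Metric.sphere (0 : V) 1,
      z ∈ S ×ˢ U ×ˢ U → 0 < Q (z, v) := by
    refine (isCompact_sphere (0 : V) 1).eventually_forall_of_forall_eventually fun v hv => ?_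
    have hv0 : v ≠ 0 := by
      rintro rfl
      simp at hv
    have h1 : 0 < Q ((t₁, ξ₁, ξ₁), v) := by
      have := hpos v hv0
      simpa [Q, D₁, D₂] using this
    have h2 := (hQ ((t₁, ξ₁, ξ₁), v) ⟨⟨ht₁, hξ₁, hξ₁⟩, mem_univ v⟩).eventually (lt_mem_nhds h1)
    rw [eventually_nhdsWithin_iff] at h2
    filter_upwards [h2] with z hz hz'
    exact hz ⟨hz', mem_univ _⟩
  have hUU : ∀ᶠ z : ℝ × V × V in 𝓝 (t₁, ξ₁, ξ₁), z.2.1 ∈ U ∧ z.2.2 ∈ U := by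
    have : U ×ˢ U ∈ 𝓝 (ξ₁, ξ₁) := prod_mem_nhds (hU.mem_nhds hξ₁) (hU.mem_nhds hξ₁)
    exact (continuous_snd.tendsto (t₁, ξ₁, ξ₁)).eventually this
  obtain ⟨ε, hε, hball⟩ := Metric.eventually_nhds_iff_ball.1 (hsph.and hUU)
  refine Metric.eventually_nhds_iff_ball.2 ⟨ε, hε, ?_⟩
  rintro ⟨t, ξ, η⟩ hz ht hne
  simp only [Metric.mem_ball, Prod.dist_eq, max_lt_iff] at hz
  set v := η - ξ with hv
  have hv0 : v ≠ 0 := sub_ne_zero.2 hne.symm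
  have hseg : ∀ s ∈ Icc (0 : ℝ) 1, (t, ξ, ξ + s • v) ∈ Metric.ball (t₁, ξ₁, ξ₁) ε := by
    intro s hs
    have : ξ + s • v ∈ Metric.ball ξ₁ ε :=
      (convex_ball ξ₁ ε).add_smul_sub_mem (Metric.mem_ball.2 hz.2.1) (Metric.mem_ball.2 hz.2.2) hs
    simp only [Metric.mem_ball, Prod.dist_eq, max_lt_iff]
    exact ⟨hz.1, hz.2.1, this⟩
  have hξU : ξ ∈ U := by simpa using (hball _ (hseg 0 (by simp))).2.1
  have hsegU : ∀ s ∈ Icc (0 : ℝ) 1, ξ + s • v ∈ U := fun s hs => (hball _ (hseg s hs)).2.2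
  have hQpos : ∀ s ∈ Icc (0 : ℝ) 1, 0 < Q ((t, ξ, ξ + s • v), v) := by
    intro s hs
    have hn : 0 < ‖v‖ := norm_pos_iff.2 hv0
    -- Q is homogeneous of degree two in the direction, so unit vectors suffice.
    have h1 := (hball _ (hseg s hs)).1 (‖v‖⁻¹ • v) (by simp [norm_smul, hn.ne'])
      ⟨ht, hξU, hsegU s hs⟩
    have h2 : Q ((t, ξ, ξ + s • v), ‖v‖⁻¹ • v) = (‖v‖⁻¹) ^ 2 * Q ((t, ξ, ξ + s • v), v) := by
      simp only [Q, map_smul, smul_apply, inner_smul_left, inner_smul_right, conj_trivial]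
      ring
    rw [h2] at h1
    exact (pos_iff_pos_of_mul_pos h1).1 (by positivity)
  set R : V → ℝ := fun η => a * inner ℝ (P (t, η) - P (t, ξ)) (P (t, η) - P (t, ξ)) +
    2 * inner ℝ (P (t, η) - P (t, ξ)) (N (t, ξ)) with hR
  have hder := fun s hs => dirDeriv_contact (hslice t ht _ (hsegU s hs)) a (P (t, ξ)) (N (t, ξ)) v
  have := pos_of_second_deriv_pos (r := fun s => R (ξ + s • v))
    (r' := fun s => dirDeriv v R (ξ + s • v))
    (r'' := fun s => dirDeriv v (dirDeriv v R) (ξ + s • v))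
    (fun s hs => hasDerivAt_line_dirDeriv ((hder s hs).1.differentiableAt (by simp)))
    (fun s hs => hasDerivAt_line_dirDeriv
      ((contDiffAt_dirDeriv (hder s hs).1 (m := 1) (by norm_num) v).differentiableAt (by simp)))
    (fun s hs => ?_) (by simp [hR]) ?_
  · simpa [hv, hR] using this
  · rw [(hder s hs).2.2]
    exact mul_pos two_pos (hQpos s hs)
  · have h0 : (0 : ℝ) ∈ Icc (0 : ℝ) 1 := by simp
    rw [(hder 0 h0).2.1]
    simp [horth t ht ξ hξU]

end Flat

/-! ### Ball curvature through the sign of the contact defect. -/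

section Contact

variable {n : ℕ} {M : Type*}

/-- The ball curvature `Z(x,y)` is compared with `a` through the sign of this expression. -/
def contactDefect (X ν : ℝ → M → EuclideanSpace ℝ (Fin (n + 1))) (a t : ℝ) (x y : M) : ℝ :=
  a * inner ℝ (X t x - X t y) (X t x - X t y) - 2 * inner ℝ (X t x - X t y) (ν t x)

variable {X ν : ℝ → M → EuclideanSpace ℝ (Fin (n + 1))} {a t : ℝ} {x y : M}

lemma contactDefect_eq (hne : X t x ≠ X t y) : contactDefect X ν a t x y =
    (a - Z X ν t x y) * ‖X t x - X t y‖ ^ 2 := by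
  have : ‖X t x - X t y‖ ^ 2 ≠ 0 := pow_ne_zero 2 (norm_ne_zero_iff.2 (sub_ne_zero.2 hne))
  rw [contactDefect, Z, real_inner_self_eq_norm_sq, sub_mul, div_mul_cancel₀ _ this]

lemma contactDefect_self : contactDefect X ν a t x x = 0 := by
  simp [contactDefect]

lemma Z_le_iff (hne : X t x ≠ X t y) : Z X ν t x y ≤ a ↔ 0 ≤ contactDefect X ν a t x y := by
  have : 0 < ‖X t x - X t y‖ ^ 2 := pow_pos (norm_pos_iff.2 (sub_ne_zero.2 hne)) 2
  rw [contactDefect_eq hne, mul_nonneg_iff_of_pos_right this, sub_nonneg]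

lemma Z_lt_iff (hne : X t x ≠ X t y) : Z X ν t x y < a ↔ 0 < contactDefect X ν a t x y := by
  have : 0 < ‖X t x - X t y‖ ^ 2 := pow_pos (norm_pos_iff.2 (sub_ne_zero.2 hne)) 2
  rw [contactDefect_eq hne, mul_pos_iff_of_pos_right this, sub_pos]

lemma Z_neg (t : ℝ) (x y : M) : Z X (fun t x => -ν t x) t x y = -Z X ν t x y := by
  rw [Z, Z, inner_neg_right]
  ring

lemma setOf_Z_neg (t : ℝ) (x : M) :
    {r | ∃ y, y ≠ x ∧ r = Z X (fun t x => -ν t x) t x y} =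
      -{r | ∃ y, y ≠ x ∧ r = Z X ν t x y} := by
  ext r
  simp only [Z_neg, Set.mem_neg, mem_ofPred_eq, neg_eq_iff_eq_neg]

/-- For real sets `sInf S` is by definition `-sSup (-S)`, so no boundedness is required. -/
lemma exteriorSphereCurvature_eq (t : ℝ) (x : M) : exteriorSphereCurvature X ν t x =
    -interiorSphereCurvature X (fun t x => -ν t x) t x := by
  rw [exteriorSphereCurvature, interiorSphereCurvature, setOf_Z_neg, Real.sInf_def]

end Contact

/-! ### Comparison of ball curvature and principal curvatures on the diagonal. -/

section Diagonal

variable {n : ℕ} {M : Type*} [TopologicalSpace M] [ChartedSpace (EuclideanSpace ℝ (Fin n)) M]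
  [IsManifold (𝓡 n) ∞ M]

/-- A hypersurface which locally lies outside of a tangent ball has curvature at most that of the
ball. -/
lemma IsHypersurface.curvatureForm_le {Y N : M → EuclideanSpace ℝ (Fin (n + 1))}
    (hY : IsHypersurface Y N) {x : M} {a : ℝ}
    (h : ∀ᶠ y in 𝓝 x, 0 ≤ a * inner ℝ (Y x - Y y) (Y x - Y y) - 2 * inner ℝ (Y x - Y y) (N x))
    (v : EuclideanSpace ℝ (Fin n)) : curvatureForm Y N x v v ≤ a * metricForm Y x v v := by
  set c := extChartAt (𝓡 n) x with hc
  have hP : ContDiffAt ℝ 2 (Y ∘ c.symm) (c x) :=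
    contDiffAt_chart_self two_le_infty ((hY.smooth x).of_le two_le_infty)
  obtain ⟨h1, -, h3⟩ := dirDeriv_contact hP a (Y x) (N x) v
  have e0 : (Y ∘ c.symm) (c x) = Y x := by simp [hc]
  have ht : Tendsto c.symm (𝓝 (c x)) (𝓝 x) := by
    have := continuousAt_extChartAt_symm (I := 𝓡 n) x
    rw [ContinuousAt, extChartAt_to_inv] at this
    exact this
  have hmin := dirDeriv_of_line_min (v := v) h1 (by
    filter_upwards [(tendsto_line (c x) v).eventually (ht.eventually h)] with s hs
    rw [e0]
    simp only [sub_self, inner_zero_left, mul_zero, add_zero]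
    rw [← neg_sub (Y x), inner_neg_neg, inner_neg_left]
    simp only [Function.comp_apply, hc] at hs ⊢
    linarith)
  have h4 := hmin.2
  rw [h3, e0, sub_self, inner_zero_left, add_zero] at h4
  rw [metricForm_apply, hY.curvatureForm_eq, differential_eq_fderiv (hY.mdifferentiableAt x),
    chartSecondDeriv, real_inner_comm]
  linarith

variable {Γ : Set (Fin n → ℝ)} {f : (Fin n → ℝ) → ℝ} {T : ℝ}
  {X ν : ℝ → M → EuclideanSpace ℝ (Fin (n + 1))}

lemma contDiffOn_chart {W : Type*} [NormedAddCommGroup W] [NormedSpace ℝ W]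
    {K : ℝ → M → W} (hK : ContMDiffOn (𝓘(ℝ, ℝ).prod (𝓡 n)) 𝓘(ℝ, W) ∞
      (fun p : ℝ × M => K p.1 p.2) (Ico 0 T ×ˢ univ)) (x : M) :
    ContDiffOn ℝ ∞ (fun z : ℝ × EuclideanSpace ℝ (Fin n) =>
      K z.1 ((extChartAt (𝓡 n) x).symm z.2)) (Ico 0 T ×ˢ (extChartAt (𝓡 n) x).target) := by
  rw [← contMDiffOn_iff_contDiffOn]
  have h1 : ContMDiffOn 𝓘(ℝ, ℝ × EuclideanSpace ℝ (Fin n)) (𝓘(ℝ, ℝ).prod (𝓡 n)) ∞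
      (fun z : ℝ × EuclideanSpace ℝ (Fin n) => (z.1, (extChartAt (𝓡 n) x).symm z.2))
      (Ico 0 T ×ˢ (extChartAt (𝓡 n) x).target) := by
    refine ContMDiffOn.prodMk contDiff_fst.contMDiff.contMDiffOn ?_
    exact ContMDiffOn.comp (g := (extChartAt (𝓡 n) x).symm)
      (f := (Prod.snd : ℝ × EuclideanSpace ℝ (Fin n) → _)) (contMDiffOn_extChartAt_symm x)
      contDiff_snd.contMDiff.contMDiffOn fun z hz => hz.2
  exact ContMDiffOn.comp (g := fun p : ℝ × M => K p.1 p.2)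
    (f := fun z : ℝ × EuclideanSpace ℝ (Fin n) => (z.1, (extChartAt (𝓡 n) x).symm z.2)) hK h1
    fun z hz => ⟨hz.1, mem_univ _⟩

lemma IsSmoothFlow.eventually_contactDefect_pos (hX : IsSmoothFlow Γ f T X ν) {t₁ : ℝ}
    (ht₁ : t₁ ∈ Ico 0 T) {x₁ : M} {a : ℝ}
    (hpos : ∀ v ≠ 0, curvatureForm (X t₁) (ν t₁) x₁ v v < a * metricForm (X t₁) x₁ v v) :
    ∀ᶠ z : ℝ × M × M in 𝓝 (t₁, x₁, x₁), z.1 ∈ Ico 0 T → z.2.1 ≠ z.2.2 →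
      0 < contactDefect X ν a z.1 z.2.1 z.2.2 := by
  set c := extChartAt (𝓡 n) x₁ with hc
  have hY := hX.isHypersurface ht₁
  have key := eventually_contact_pos (P := fun z => X z.1 (c.symm z.2))
    (N := fun z => ν z.1 (c.symm z.2)) (t₁ := t₁) (ξ₁ := c x₁) (a := a) (uniqueDiffOn_Ico 0 T)
    (isOpen_extChartAt_target x₁) (contDiffOn_chart hX.smooth x₁)
    (contDiffOn_chart hX.smooth_normal x₁).continuousOn (fun t ht ξ hξ v => ?_) ht₁
    (mem_extChartAt_target x₁) fun v hv => ?_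
  · have hcont : Tendsto (fun z : ℝ × M × M => (z.1, c z.2.1, c z.2.2)) (𝓝 (t₁, x₁, x₁))
        (𝓝 (t₁, c x₁, c x₁)) := by
      have h1 : Tendsto c (𝓝 x₁) (𝓝 (c x₁)) := continuousAt_extChartAt x₁
      simp only [nhds_prod_eq]
      exact tendsto_id.prodMap (h1.prodMap h1)
    have hsrc : ∀ᶠ z : ℝ × M × M in 𝓝 (t₁, x₁, x₁), z.2.1 ∈ c.source ∧ z.2.2 ∈ c.source := by
      have h1 : c.source ∈ 𝓝 x₁ := extChartAt_source_mem_nhds x₁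
      exact (continuous_snd.tendsto (t₁, x₁, x₁)).eventually (prod_mem_nhds h1 h1)
    filter_upwards [hcont.eventually key, hsrc] with z hz hs ht hne
    have := hz ht fun h => hne (c.injOn hs.1 hs.2 h)
    simp only [c.left_inv hs.1, c.left_inv hs.2] at this
    rw [← neg_sub (X z.1 z.2.1), inner_neg_neg, inner_neg_left] at this
    rw [contactDefect]
    linarith
  · have h1 := fderiv_comp_param ((hX.isHypersurface ht).mdifferentiableAt (c.symm ξ))
      ((contMDiffAt_extChartAt_symm x₁ hξ).mdifferentiableAt (by simp)) v
    change inner ℝ (fderiv ℝ (X t ∘ c.symm) ξ v) _ = 0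
    rw [h1]
    exact hX.orthogonal t ht _ _
  · have h1 := hpos v hv
    rw [metricForm_apply, hY.curvatureForm_eq, differential_eq_fderiv (hY.mdifferentiableAt x₁),
      chartSecondDeriv, real_inner_comm] at h1
    have e0 : c.symm (c x₁) = x₁ := by simp [hc]
    simp only [e0]
    change 0 < a * inner ℝ (fderiv ℝ (X t₁ ∘ c.symm) (c x₁) v)
      (fderiv ℝ (X t₁ ∘ c.symm) (c x₁) v) +
      inner ℝ (fderiv ℝ (fderiv ℝ (X t₁ ∘ c.symm)) (c x₁) v v) (ν t₁ x₁)
    linarith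

lemma IsFrame.form_lt {g h : LinearMap.BilinForm ℝ (EuclideanSpace ℝ (Fin n))}
    {e : Fin n → EuclideanSpace ℝ (Fin n)} {κ : Fin n → ℝ} (he : IsFrame g e)
    (hd : formMatrix h e = Matrix.diagonal κ) {a : ℝ} (hκ : ∀ i, κ i < a)
    {v : EuclideanSpace ℝ (Fin n)} (hv : v ≠ 0) : h v v < a * g v v := by
  set c : Fin n → ℝ := fun i => g (e i) v with hc
  have hexp : v = ∑ i, c i • e i := (he.expand v).symm
  have hd' : ∀ i j, h (e i) (e j) = if i = j then κ i else 0 := by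
    intro i j
    have := congrFun (congrFun hd i) j
    rwa [Matrix.diagonal_apply] at this
  have h1 : h v v = ∑ i, κ i * c i ^ 2 := by
    rw [hexp]
    simp only [map_sum, LinearMap.sum_apply, map_smul, LinearMap.smul_apply, hd', smul_eq_mul]
    refine Finset.sum_congr rfl fun i _ => ?_
    simp
    ring
  have h2 : g v v = ∑ i, c i ^ 2 := by
    rw [hexp]
    simp only [map_sum, LinearMap.sum_apply, map_smul, LinearMap.smul_apply, he _ _, smul_eq_mul]
    refine Finset.sum_congr rfl fun i _ => ?_
    simp
    ring
  rw [h1, h2, Finset.mul_sum]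
  obtain ⟨i, hi⟩ : ∃ i, c i ≠ 0 := by
    by_contra! hall
    exact hv (by rw [hexp]; simp [hall])
  exact Finset.sum_lt_sum (fun j _ => mul_le_mul_of_nonneg_right (hκ j).le (sq_nonneg _))
    ⟨i, Finset.mem_univ i, mul_lt_mul_of_pos_right (hκ i) (by positivity)⟩

end Diagonal

/-! ### Finiteness, continuity and attainment of the interior curvature. -/

section SphereCurvature

variable {n : ℕ} {M : Type*} [TopologicalSpace M] [ChartedSpace (EuclideanSpace ℝ (Fin n)) M]
  {Γ : Set (Fin n → ℝ)} {f : (Fin n → ℝ) → ℝ} {T : ℝ}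
  {X ν : ℝ → M → EuclideanSpace ℝ (Fin (n + 1))}

lemma IsSmoothFlow.continuousOn_contactDefect (hX : IsSmoothFlow Γ f T X ν) (a : ℝ) :
    ContinuousOn (fun z : ℝ × M × M => contactDefect X ν a z.1 z.2.1 z.2.2)
      (Ico 0 T ×ˢ univ) := by
  have c1 : Continuous (fun z : ℝ × M × M => (z.1, z.2.1)) := by fun_prop
  have c2 : Continuous (fun z : ℝ × M × M => (z.1, z.2.2)) := by fun_prop
  have p1 := hX.smooth.continuousOn.comp c1.continuousOn
    (s := Ico 0 T ×ˢ univ) fun z hz => ⟨hz.1, mem_univ _⟩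
  have p2 := hX.smooth.continuousOn.comp c2.continuousOn
    (s := Ico 0 T ×ˢ univ) fun z hz => ⟨hz.1, mem_univ _⟩
  have p3 := hX.smooth_normal.continuousOn.comp c1.continuousOn
    (s := Ico 0 T ×ˢ univ) fun z hz => ⟨hz.1, mem_univ _⟩
  exact (continuousOn_const.mul ((p1.sub p2).inner (p1.sub p2))).sub
    (continuousOn_const.mul ((p1.sub p2).inner p3))

lemma IsSmoothFlow.ne (hX : IsSmoothFlow Γ f T X ν) {t : ℝ} (ht : t ∈ Ico 0 T) {x y : M}
    (h : y ≠ x) : X t x ≠ X t y := fun h' => h (hX.injective t ht h').symm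

/-- In positive dimension a point of the open chart target is not isolated. The supremum is
therefore over a nonempty set. -/
lemma exists_ne_of_chart (hn : 1 ≤ n) (x : M) : ∃ y : M, y ≠ x := by
  have : Nonempty (Fin n) := ⟨⟨0, hn⟩⟩
  obtain ⟨ξ, hξ, hne⟩ := ((eventually_mem_nhdsWithin (a := extChartAt (𝓡 n) x x)
    (s := {extChartAt (𝓡 n) x x}ᶜ)).and
    (mem_nhdsWithin_of_mem_nhds (extChartAt_target_mem_nhds (I := 𝓡 n) x))).exists
  refine ⟨(extChartAt (𝓡 n) x).symm ξ, fun h => hξ ?_⟩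
  have := (extChartAt (𝓡 n) x).right_inv hne
  rw [h] at this
  exact this.symm

lemma tendsto_diag_left (t : ℝ) (x y : M) :
    Tendsto (fun y' : M => (t, x, y')) (𝓝 y) (𝓝 (t, x, y)) := by
  have : Continuous fun y' : M => (t, x, y') := by fun_prop
  exact this.tendsto y

lemma IsSmoothFlow.eventually_Z_lt_diag [IsManifold (𝓡 n) ∞ M] (hX : IsSmoothFlow Γ f T X ν) {t₁ : ℝ}
    (ht₁ : t₁ ∈ Ico 0 T) {x₁ : M} {e : Fin n → EuclideanSpace ℝ (Fin n)} {κ : Fin n → ℝ}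
    (he : IsFrame (metricForm (X t₁) x₁) e)
    (hd : formMatrix (curvatureForm (X t₁) (ν t₁) x₁) e = Matrix.diagonal κ) {a : ℝ}
    (hκ : ∀ i, κ i < a) : ∀ᶠ z : ℝ × M × M in 𝓝 (t₁, x₁, x₁), z.1 ∈ Ico 0 T → z.2.2 ≠ z.2.1 →
      Z X ν z.1 z.2.1 z.2.2 < a := by
  filter_upwards [hX.eventually_contactDefect_pos ht₁ fun v hv => he.form_lt hd hκ hv]
    with z hz ht hne
  exact (Z_lt_iff (hX.ne ht hne)).2 (hz ht hne.symm)

variable [T2Space M]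

/-- Strict inequalities `Z < a` and `a < Z` are stable away from the diagonal. -/
lemma IsSmoothFlow.eventually_Z (hX : IsSmoothFlow Γ f T X ν) {t : ℝ} (ht : t ∈ Ico 0 T)
    {x y : M} (hne : y ≠ x) {a : ℝ} :
    (Z X ν t x y < a → ∀ᶠ z : ℝ × M × M in 𝓝 (t, x, y), z.1 ∈ Ico 0 T → z.2.2 ≠ z.2.1 ∧
      Z X ν z.1 z.2.1 z.2.2 < a) ∧
    (a < Z X ν t x y → ∀ᶠ z : ℝ × M × M in 𝓝 (t, x, y), z.1 ∈ Ico 0 T → z.2.2 ≠ z.2.1 ∧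
      a < Z X ν z.1 z.2.1 z.2.2) := by
  have hc := hX.continuousOn_contactDefect a (t, x, y) ⟨ht, mem_univ _⟩
  have hn : ∀ᶠ z : ℝ × M × M in 𝓝 (t, x, y), z.2.2 ≠ z.2.1 := by
    have h1 : Continuous fun z : ℝ × M × M => z.2.2 := by fun_prop
    have h2 : Continuous fun z : ℝ × M × M => z.2.1 := by fun_prop
    exact (isOpen_ne_fun h1 h2).mem_nhds hne
  constructor <;> intro h
  · rw [Z_lt_iff (hX.ne ht hne)] at h
    have h1 := hc.eventually (lt_mem_nhds h)
    rw [eventually_nhdsWithin_iff] at h1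
    filter_upwards [h1, hn] with z hz hz' ht'
    exact ⟨hz', (Z_lt_iff (hX.ne ht' hz')).2 (hz ⟨ht', mem_univ _⟩)⟩
  · rw [← not_le, Z_le_iff (hX.ne ht hne), not_le] at h
    have h1 := hc.eventually (gt_mem_nhds h)
    rw [eventually_nhdsWithin_iff] at h1
    filter_upwards [h1, hn] with z hz hz' ht'
    refine ⟨hz', ?_⟩
    rw [← not_le, Z_le_iff (hX.ne ht' hz'), not_le]
    exact hz ⟨ht', mem_univ _⟩

variable [CompactSpace M] [IsManifold (𝓡 n) ∞ M]

/-- Local bounds and compactness: near y = x any number above the principal curvatures works, and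
away from x strict upper bounds for Z persist locally. -/
lemma IsSmoothFlow.bddAbove_Z (hX : IsSmoothFlow Γ f T X ν) {t : ℝ} (ht : t ∈ Ico 0 T) (x : M) :
    BddAbove {r | ∃ y, y ≠ x ∧ r = Z X ν t x y} := by
  obtain ⟨κ, -, hl, -⟩ := hX.flow t ht x
  rw [inducedMetric_eq, secondFundamentalForm_eq] at hl
  obtain ⟨e, he, hd⟩ := isEigenvalueList_iff.1 hl
  have key : ∃ b, ∀ y ∈ (univ : Set M), y ≠ x → Z X ν t x y ≤ b := by
    refine isCompact_univ.induction_on (p := fun s => ∃ b, ∀ y ∈ s, y ≠ x → Z X ν t x y ≤ b)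
      ⟨0, by simp⟩ ?_ ?_ ?_
    · rintro s s' hs ⟨b, hb⟩
      exact ⟨b, fun y hy => hb y (hs hy)⟩
    · rintro s s' ⟨b, hb⟩ ⟨b', hb'⟩
      refine ⟨max b b', fun y hy hne => ?_⟩
      rcases hy with hy | hy
      · exact (hb y hy hne).trans (le_max_left _ _)
      · exact (hb' y hy hne).trans (le_max_right _ _)
    · intro y _
      rw [nhdsWithin_univ]
      by_cases hy : y = x
      · subst hy
        obtain ⟨a, ha⟩ := (Set.finite_range κ).bddAbove
        have h1 := (tendsto_diag_left t y y).eventually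
          (hX.eventually_Z_lt_diag ht he hd (a := a + 1)
            fun i => (ha (mem_range_self i)).trans_lt (lt_add_one a))
        exact ⟨_, h1, a + 1, fun y' hy' hne => (hy' ht hne).le⟩
      · have h1 := (tendsto_diag_left t x y).eventually
          ((hX.eventually_Z ht hy).1 (lt_add_one _))
        exact ⟨_, h1, _, fun y' hy' hne => (hy' ht).2.le⟩
  obtain ⟨b, hb⟩ := key
  refine ⟨b, ?_⟩
  rintro r ⟨y, hy, rfl⟩
  exact hb y (mem_univ y) hy

lemma IsSmoothFlow.Z_le (hX : IsSmoothFlow Γ f T X ν) {t : ℝ} (ht : t ∈ Ico 0 T) {x y : M}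
    (h : y ≠ x) : Z X ν t x y ≤ interiorSphereCurvature X ν t x :=
  le_csSup (hX.bddAbove_Z ht x) ⟨y, h, rfl⟩

lemma IsSmoothFlow.contactDefect_nonneg (hX : IsSmoothFlow Γ f T X ν) {t : ℝ} (ht : t ∈ Ico 0 T)
    {x y : M} {a : ℝ} (ha : interiorSphereCurvature X ν t x ≤ a) :
    0 ≤ contactDefect X ν a t x y := by
  by_cases h : y = x
  · rw [h, contactDefect_self]
  · exact (Z_le_iff (hX.ne ht h)).1 ((hX.Z_le ht h).trans ha)

lemma IsSmoothFlow.curvatureForm_le (hX : IsSmoothFlow Γ f T X ν) {t : ℝ} (ht : t ∈ Ico 0 T)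
    {x : M} {a : ℝ} (ha : interiorSphereCurvature X ν t x ≤ a) (v : EuclideanSpace ℝ (Fin n)) :
    curvatureForm (X t) (ν t) x v v ≤ a * metricForm (X t) x v v :=
  (hX.isHypersurface ht).curvatureForm_le
    (Eventually.of_forall fun _ => hX.contactDefect_nonneg ht ha) v

lemma IsSmoothFlow.curvature_le (hX : IsSmoothFlow Γ f T X ν) {t : ℝ} (ht : t ∈ Ico 0 T) {x : M}
    {e : Fin n → EuclideanSpace ℝ (Fin n)} {κ : Fin n → ℝ}
    (he : IsFrame (metricForm (X t) x) e)
    (hd : formMatrix (curvatureForm (X t) (ν t) x) e = Matrix.diagonal κ) (i : Fin n) :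
    κ i ≤ interiorSphereCurvature X ν t x := by
  have h1 := hX.curvatureForm_le ht le_rfl (x := x) (e i)
  have h2 := congrFun (congrFun hd i) i
  rw [he i i, if_pos rfl, mul_one] at h1
  rw [Matrix.diagonal_apply_eq] at h2
  rw [← h2]
  exact h1

/-- The interior sphere curvature is continuous. -/
lemma IsSmoothFlow.continuousOn_interiorSphereCurvature (hn : 1 ≤ n)
    (hX : IsSmoothFlow Γ f T X ν) :
    ContinuousOn (fun p : ℝ × M => interiorSphereCurvature X ν p.1 p.2) (Ico 0 T ×ˢ univ) := by
  have hne : ∀ (t : ℝ) (x : M), {r | ∃ y, y ≠ x ∧ r = Z X ν t x y}.Nonempty := fun t x => by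
    obtain ⟨y, hy⟩ := exists_ne_of_chart hn x
    exact ⟨_, y, hy, rfl⟩
  rintro ⟨t, x⟩ ⟨ht, -⟩
  refine tendsto_order.2 ⟨fun a ha => ?_, fun a ha => ?_⟩
  -- Lower semicontinuity: a single y with Z above a keeps this property for nearby (t, x).
  · obtain ⟨r, ⟨y, hy, rfl⟩, hr⟩ := exists_lt_of_lt_csSup (hne t x) ha
    have h1 : Tendsto (fun p : ℝ × M => (p.1, p.2, y)) (𝓝 (t, x)) (𝓝 (t, x, y)) := by
      have : Continuous fun p : ℝ × M => (p.1, p.2, y) := by fun_prop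
      exact this.tendsto (t, x)
    rw [eventually_nhdsWithin_iff]
    filter_upwards [h1.eventually ((hX.eventually_Z ht hy).2 hr)] with p hp hp'
    exact (hp hp'.1).2.trans_le (hX.Z_le hp'.1 (hp hp'.1).1)
  -- Upper semicontinuity: compactness in y gives Z < b nearby, the diagonal being covered by κ_i ≤
  -- interior curvature < b. The intermediate b is needed because a supremum preserves only weak
  -- inequalities.
  · obtain ⟨b, hb, hba⟩ := exists_between ha
    obtain ⟨κ, -, hl, -⟩ := hX.flow t ht x
    rw [inducedMetric_eq, secondFundamentalForm_eq] at hl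
    obtain ⟨e, he, hd⟩ := isEigenvalueList_iff.1 hl
    have key : ∀ᶠ p : ℝ × M in 𝓝 (t, x), ∀ y ∈ (univ : Set M), p.1 ∈ Ico 0 T → y ≠ p.2 →
        Z X ν p.1 p.2 y < b := by
      refine isCompact_univ.eventually_forall_of_forall_eventually fun y _ => ?_
      have h1 : Tendsto (fun p : (ℝ × M) × M => (p.1.1, p.1.2, p.2)) (𝓝 ((t, x), y))
          (𝓝 (t, x, y)) := by
        have : Continuous fun p : (ℝ × M) × M => (p.1.1, p.1.2, p.2) := by fun_prop
        exact this.tendsto ((t, x), y)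
      by_cases hy : y = x
      · subst hy
        exact h1.eventually (hX.eventually_Z_lt_diag ht he hd
          fun i => (hX.curvature_le ht he hd i).trans_lt hb)
      · filter_upwards [h1.eventually ((hX.eventually_Z ht hy).1 ((hX.Z_le ht hy).trans_lt hb))]
          with p hp hp' _
        exact (hp hp').2
    rw [eventually_nhdsWithin_iff]
    filter_upwards [key] with p hp hp'
    refine lt_of_le_of_lt (csSup_le (hne p.1 p.2) ?_) hba
    rintro r ⟨y, hy, rfl⟩
    exact (hp y (mem_univ y) hp'.1 hy).le

/-- Either the interior sphere curvature is attained at a second point, or it is a principal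
curvature. -/
lemma IsSmoothFlow.attained_or_eq_curvature (hn : 1 ≤ n) (hX : IsSmoothFlow Γ f T X ν) {t : ℝ}
    (ht : t ∈ Ico 0 T) {x : M} {e : Fin n → EuclideanSpace ℝ (Fin n)} {κ : Fin n → ℝ}
    (he : IsFrame (metricForm (X t) x) e)
    (hd : formMatrix (curvatureForm (X t) (ν t) x) e = Matrix.diagonal κ) :
    (∃ y, y ≠ x ∧ Z X ν t x y = interiorSphereCurvature X ν t x) ∨
      ∃ i, κ i = interiorSphereCurvature X ν t x := by
  by_contra! hcon
  obtain ⟨hZ, hκ⟩ := hcon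
  set a := interiorSphereCurvature X ν t x with ha
  have hκ' : ∀ i, κ i < a := fun i => lt_of_le_of_ne (hX.curvature_le ht he hd i) (hκ i)
  have hZ' : ∀ y, y ≠ x → Z X ν t x y < a := fun y hy => lt_of_le_of_ne (hX.Z_le ht hy) (hZ y hy)
  -- If both alternatives fail, each point has a neighbourhood with a bound below a. Compactness
  -- makes the bound uniform, contradicting that a is the supremum.
  have key : ∃ b < a, ∀ y ∈ (univ : Set M), y ≠ x → Z X ν t x y ≤ b := by
    refine isCompact_univ.induction_on
      (p := fun s => ∃ b < a, ∀ y ∈ s, y ≠ x → Z X ν t x y ≤ b)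
      ⟨a - 1, by simp, by simp⟩ ?_ ?_ ?_
    · rintro s s' hs ⟨b, hba, hb⟩
      exact ⟨b, hba, fun y hy => hb y (hs hy)⟩
    · rintro s s' ⟨b, hba, hb⟩ ⟨b', hba', hb'⟩
      refine ⟨max b b', max_lt hba hba', fun y hy hne => ?_⟩
      rcases hy with hy | hy
      · exact (hb y hy hne).trans (le_max_left _ _)
      · exact (hb' y hy hne).trans (le_max_right _ _)
    · intro y _
      rw [nhdsWithin_univ]
      by_cases hy : y = x
      · subst hy
        have h1 : ∀ᶠ b in 𝓝[<] a, ∀ i, κ i < b :=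
          eventually_all.2 fun i => mem_nhdsWithin_of_mem_nhds (lt_mem_nhds (hκ' i))
        obtain ⟨b, hb, hba⟩ := (h1.and self_mem_nhdsWithin).exists
        have h1 := (tendsto_diag_left t y y).eventually (hX.eventually_Z_lt_diag ht he hd hb)
        exact ⟨_, h1, b, hba, fun y' hy' hne => (hy' ht hne).le⟩
      · obtain ⟨b, hb, hba⟩ := exists_between (hZ' y hy)
        have h1 := (tendsto_diag_left t x y).eventually ((hX.eventually_Z ht hy).1 hb)
        exact ⟨_, h1, b, hba, fun y' hy' hne => (hy' ht).2.le⟩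
  obtain ⟨b, hba, hb⟩ := key
  obtain ⟨y, hy⟩ := exists_ne_of_chart hn x
  have : a ≤ b := by
    refine csSup_le ⟨_, y, hy, rfl⟩ ?_
    rintro r ⟨y, hy, rfl⟩
    exact hb y (mem_univ y) hy
  linarith

end SphereCurvature

/-! ### The linearized operator in an eigenframe. -/

section Linearization

variable {n : ℕ} {M : Type*} [TopologicalSpace M] [ChartedSpace (EuclideanSpace ℝ (Fin n)) M]

/-- The Hessian as a bilinear form. -/
def hessianForm (Y : M → EuclideanSpace ℝ (Fin (n + 1))) (φ : M → ℝ) (x : M) :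
    LinearMap.BilinForm ℝ (EuclideanSpace ℝ (Fin n)) :=
  LinearMap.mk₂ ℝ (hessian Y φ x)
    (fun u u' v => by simp [hessian, tangentialPart_eq]; ring)
    (fun c u v => by simp [hessian, tangentialPart_eq]; ring)
    (fun u v v' => by simp [hessian, tangentialPart_eq]; ring)
    (fun c u v => by simp [hessian, tangentialPart_eq]; ring)

lemma hessian_eq (Y : M → EuclideanSpace ℝ (Fin (n + 1))) (φ : M → ℝ) (x : M) :
    hessian Y φ x = fun u v => hessianForm Y φ x u v := rfl

variable [IsManifold (𝓡 n) ∞ M]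

lemma IsHypersurface.hessian_symm {Y N : M → EuclideanSpace ℝ (Fin (n + 1))}
    (hY : IsHypersurface Y N) {φ : M → ℝ} {x : M} (hφ : ContMDiffAt (𝓡 n) 𝓘(ℝ, ℝ) 2 φ x)
    (u v : EuclideanSpace ℝ (Fin n)) : hessian Y φ x u v = hessian Y φ x v u := by
  rw [hessian, hessian, chartSecondDeriv_symm hφ u v,
    chartSecondDeriv_symm ((hY.smooth x).of_le two_le_infty) u v]

lemma IsHypersurface.squaredForm_eq_metricForm {Y N : M → EuclideanSpace ℝ (Fin (n + 1))}
    (hY : IsHypersurface Y N) (x : M) : squaredForm Y N x = fun u v => metricForm N x u v := by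
  funext u v
  exact hY.squaredForm_eq x u v

variable {Γ : Set (Fin n → ℝ)} {f : (Fin n → ℝ) → ℝ} {T : ℝ}
  {X ν : ℝ → M → EuclideanSpace ℝ (Fin (n + 1))}

/-- The linearized flow in an eigenframe. -/
lemma IsSmoothFlow.linearizedFlow_eq (hf : IsConcaveSpeed Γ f) (hX : IsSmoothFlow Γ f T X ν)
    {t : ℝ} (ht : t ∈ Ico 0 T) {x : M} {e : Fin n → EuclideanSpace ℝ (Fin n)} {κ : Fin n → ℝ}
    (he : IsFrame (metricForm (X t) x) e)
    (hd : formMatrix (curvatureForm (X t) (ν t) x) e = Matrix.diagonal κ) (hκ : κ ∈ Γ)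
    {φ : M → ℝ} (hφ : ContMDiffAt (𝓡 n) 𝓘(ℝ, ℝ) 2 φ x) :
    linearizedFlow f X ν t φ x = ∑ i, grad f κ i * hessian (X t) φ x (e i) (e i) +
      (∑ i, grad f κ i * κ i ^ 2) * φ x := by
  have hY := hX.isHypersurface ht
  rw [linearizedFlow, inducedMetric_eq, secondFundamentalForm_eq, hY.squaredForm_eq_metricForm,
    hessian_eq, hf.spectralDeriv_eq (hY.curvatureForm_symm x) (hY.hessian_symm hφ) he hd hκ,
    hf.spectralDeriv_eq (hY.curvatureForm_symm x) (fun u v => by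
      rw [metricForm_apply, metricForm_apply, real_inner_comm]) he hd hκ]
  congr 2
  refine Finset.sum_congr rfl fun i _ => ?_
  rw [metricForm_apply, hY.differential_normal_frame he hd, inner_smul_left, inner_smul_right,
    ← metricForm_apply, he i i, if_pos rfl, conj_trivial]
  ring

end Linearization

/-! ### Reflection between the two tangent spaces. -/

section Reflection

variable {W : Type*} [NormedAddCommGroup W] [InnerProductSpace ℝ W]

lemma inner_reflection (d a b : W) (hd : d ≠ 0) :
    inner ℝ (a - (2 * inner ℝ a d / inner ℝ d d) • d) (b - (2 * inner ℝ b d / inner ℝ d d) • d) =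
      inner ℝ a b := by
  have h : (inner ℝ d d : ℝ) ≠ 0 := inner_self_ne_zero.2 hd
  simp only [inner_sub_left, inner_sub_right, inner_smul_left, inner_smul_right, conj_trivial,
    real_inner_comm b d]
  field_simp
  ring

/-- The relation z|d|² = 2⟨d, ν⟩ says that ν - z d is the reflection of ν, and reflections preserve
orthogonality. -/
lemma inner_reflection_normal (d a ν : W) (hd : d ≠ 0) {z : ℝ} (ha : inner ℝ a ν = 0)
    (hz : z * inner ℝ d d - 2 * inner ℝ d ν = 0) :
    inner ℝ (a - (2 * inner ℝ a d / inner ℝ d d) • d) (ν - z • d) = 0 := by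
  have h : (inner ℝ d d : ℝ) ≠ 0 := inner_self_ne_zero.2 hd
  have hdν : inner ℝ d ν = z * inner ℝ d d / 2 := by linarith
  simp only [inner_sub_left, inner_sub_right, inner_smul_left, inner_smul_right, conj_trivial,
    ha, hdν]
  field_simp
  ring

end Reflection

/-! ### The viscosity inequality for a concave speed. -/

section Viscosity

variable {n : ℕ} {M : Type*} [TopologicalSpace M] [ChartedSpace (EuclideanSpace ℝ (Fin n)) M]
  [IsManifold (𝓡 n) ∞ M] {Γ : Set (Fin n → ℝ)} {f : (Fin n → ℝ) → ℝ} {T : ℝ}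
  {X ν : ℝ → M → EuclideanSpace ℝ (Fin (n + 1))}

lemma tendsto_normalParam {t : ℝ} (Y : M → EuclideanSpace ℝ (Fin (n + 1))) (x : M)
    (e : Fin n → EuclideanSpace ℝ (Fin n)) :
    Tendsto (fun z : ℝ × EuclideanSpace ℝ (Fin n) => (z.1, normalParam Y x e z.2))
      (𝓝 (t, 0)) (𝓝 (t, x)) := by
  have h1 := (eventually_contMDiffAt_normalParam Y x e).self_of_nhds.continuousAt
  rw [ContinuousAt, normalParam_zero] at h1
  rw [nhds_prod_eq, nhds_prod_eq]
  exact tendsto_id.prodMap h1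

/-- Normal coordinates at y are built on the reflected principal frame of x; a common parameter then
moves both points, as the two-point argument requires. -/
lemma IsSmoothFlow.subsolution_of_attained (hf : IsConcaveSpeed Γ f)
    (hX : IsSmoothFlow Γ f T X ν) {t : ℝ} (ht : t ∈ Ioo 0 T) {x y : M}
    {e : Fin n → EuclideanSpace ℝ (Fin n)} {κ : Fin n → ℝ}
    (he : IsFrame (metricForm (X t) x) e)
    (hd : formMatrix (curvatureForm (X t) (ν t) x) e = Matrix.diagonal κ) (hκ : κ ∈ Γ)
    {φ : ℝ × EuclideanSpace ℝ (Fin n) → ℝ} (hφ : ContDiffAt ℝ 2 φ (t, 0)) (hne : y ≠ x)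
    (hmin : ∀ᶠ z in 𝓝 ((t, 0) : ℝ × EuclideanSpace ℝ (Fin n)), z.1 ≤ t → ∀ y,
      0 ≤ contactDefect X ν (φ z) z.1 (normalParam (X t) x e z.2) y)
    (h0 : Z X ν t x y = φ (t, 0)) (hκφ : ∀ i, κ i ≤ φ (t, 0))
    (htouch : ν t y = ν t x - Z X ν t x y • (X t x - X t y)) :
    dirDeriv (timeDir n) φ (t, 0) ≤
      ∑ i, grad f κ i * dirDeriv (spaceDir i) (dirDeriv (spaceDir i) φ) (t, 0) +
        (∑ i, grad f κ i * κ i ^ 2) * φ (t, 0) := by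
  have ht' : t ∈ Ico 0 T := Ioo_subset_Ico_self ht
  have hY := hX.isHypersurface ht'
  have H := hX.normalFlowData hf ht he hd hκ
  set Ψ := normalParam (X t) x e with hΨ
  have hΨ0 : Ψ 0 = x := normalParam_zero _ _ _
  have hXne := hX.ne ht' hne
  have hdne : X t x - X t y ≠ 0 := sub_ne_zero.2 hXne
  have hz0 : contactDefect X ν (φ (t, 0)) t x y = 0 := by
    rw [contactDefect_eq hXne, h0, sub_self, zero_mul]
  set d := X t x - X t y with hddef
  set R : Fin n → EuclideanSpace ℝ (Fin (n + 1)) := fun i => differential (X t) x (e i) -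
    (2 * inner ℝ (differential (X t) x (e i)) d / inner ℝ d d) • d with hR
  set e' : Fin n → EuclideanSpace ℝ (Fin n) := fun i => tangentialPart (X t) y (R i) with he'
  -- The reflected vector is orthogonal to ν(y) by the tangency hypothesis, so taking its tangential
  -- part loses nothing.
  have hde' : ∀ i, differential (X t) y (e' i) = R i := by
    intro i
    rw [he', hY.differential_tangentialPart, htouch, h0, inner_reflection_normal _ _ _ hdne
      (hY.orthogonal x (e i)) hz0, zero_smul, sub_zero]
  have hframe' : IsFrame (metricForm (X t) y) e' := by
    intro i j
    rw [metricForm_apply, hde', hde', inner_reflection _ _ _ hdne]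
    exact he i j
  set Φ := normalParam (X t) y e' with hΦ
  have hΦ0 : Φ 0 = y := normalParam_zero _ _ _
  have hΦs := (eventually_contMDiffAt_normalParam (X t) y e').self_of_nhds
  have hp := fun i => (spatial_derivs hX ht x e (hX.smooth.of_le two_le_infty) i i).1
  have hq := fun i => spatial_derivs hX ht y e' (hX.smooth.of_le two_le_infty) i i
  obtain ⟨κ', hκ'Γ, hκ'l, hqt⟩ := hX.dirDeriv_time ht hΦs
  rw [← hΦ] at hqt
  rw [← hΦ, hΦ0] at hκ'l
  refine H.two_point (q := fun z => X z.1 (Φ z.2)) (νy := ν t y)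
    (η := fun i => curvatureForm (X t) (ν t) y (e' i) (e' i)) (Fy := f κ') hφ
    ((contDiffAt_spacetime hX.smooth ht hΦs).of_le two_le_infty) ?_ ?_ ?_ ?_ ?_ ?_ ?_ ?_ ?_ hκφ
  · simpa only [hΨ0, hΦ0] using hXne
  · simp only [hΨ0, hΦ0]
    exact hz0
  · filter_upwards [hmin] with z hz hzt
    have hzt : z.1 = t := hzt
    have := hz hzt.le y
    simp only [hΦ0]
    rw [contactDefect] at this
    rw [hzt] at this ⊢
    exact this
  · filter_upwards [hmin] with z hz hzt
    exact hz hzt (Φ z.2)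
  · simp only [hΨ0, hΦ0]
    rw [htouch, h0]
  · intro i
    rw [(hq i).1, hp i]
    simp only [hΨ0, hΦ0]
    exact hde' i
  · intro i
    rw [(hq i).2, hY.differential_tangentialPart, sub_sub_cancel, hY.curvatureForm_eq,
      real_inner_comm, neg_smul, neg_neg]
  · rw [hqt, hΦ0]
  · exact hf.le_sum_grad (g := metricForm (X t) y) (h := curvatureForm (X t) (ν t) y)
      hκ'l hκ'Γ hκ hframe'

variable [T2Space M] [CompactSpace M]

/-- The bound of the sphere curvature by φ gives h ≤ φ g at nearby past points; it is tested on the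
coordinate vector extending the a-th principal direction. -/
lemma IsSmoothFlow.subsolution_of_eq_curvature (hf : IsConcaveSpeed Γ f)
    (hX : IsSmoothFlow Γ f T X ν) {t : ℝ} (ht : t ∈ Ioo 0 T) {x : M}
    {e : Fin n → EuclideanSpace ℝ (Fin n)} {κ : Fin n → ℝ}
    (he : IsFrame (metricForm (X t) x) e)
    (hd : formMatrix (curvatureForm (X t) (ν t) x) e = Matrix.diagonal κ) (hκ : κ ∈ Γ)
    {φ : ℝ × EuclideanSpace ℝ (Fin n) → ℝ} (hφ : ContDiffAt ℝ 2 φ (t, 0)) {a : Fin n}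
    (hmin : ∀ᶠ z in 𝓝 ((t, 0) : ℝ × EuclideanSpace ℝ (Fin n)), z.1 ≤ t →
      interiorSphereCurvature X ν z.1 (normalParam (X t) x e z.2) ≤ φ z)
    (h0 : φ (t, 0) = κ a) :
    dirDeriv (timeDir n) φ (t, 0) ≤
      ∑ i, grad f κ i * dirDeriv (spaceDir i) (dirDeriv (spaceDir i) φ) (t, 0) +
        (∑ i, grad f κ i * κ i ^ 2) * φ (t, 0) := by
  have hev : ∀ᶠ z : ℝ × EuclideanSpace ℝ (Fin n) in 𝓝 (t, 0),
      z.1 ∈ Ioo 0 T ∧ ContMDiffAt (𝓡 n) (𝓡 n) ∞ (normalParam (X t) x e) z.2 :=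
    Filter.Eventually.prod_nhds (p := fun s => s ∈ Ioo 0 T) (isOpen_Ioo.mem_nhds ht)
      (eventually_contMDiffAt_normalParam (X t) x e)
  refine (hX.normalFlowData hf ht he hd hκ).one_point a hφ h0 ?_
  filter_upwards [hmin, hev] with z hz hz' hzt
  have h1 := hX.curvatureForm_le (Ioo_subset_Ico_self hz'.1) (hz hzt)
    (mfderiv (𝓡 n) (𝓡 n) (normalParam (X t) x e) z.2 (stdVec a))
  rw [spaceDir, dirDeriv_space_eq one_le_infty hX.smooth hz'.1 hz'.2,
    dirDeriv_space_eq one_le_infty hX.smooth_normal hz'.1 hz'.2]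
  exact sub_nonneg.2 h1

/-- The interior sphere curvature is a viscosity subsolution of the linearized flow, provided that
the extremal interior spheres are tangent to the hypersurface from the inside. -/
theorem IsSmoothFlow.isViscositySubsolution (hn : 1 ≤ n) (hf : IsConcaveSpeed Γ f)
    (hX : IsSmoothFlow Γ f T X ν)
    (htouch : ∀ t ∈ Ico 0 T, ∀ x y, y ≠ x → Z X ν t x y = interiorSphereCurvature X ν t x →
      ν t y = ν t x - Z X ν t x y • (X t x - X t y)) :
    IsViscositySubsolution n T (linearizedFlow f X ν) (interiorSphereCurvature X ν) := by
  refine ⟨hX.continuousOn_interiorSphereCurvature hn, fun t ht x φ hφ h0 hmin => ?_⟩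
  have ht' : t ∈ Ico 0 T := Ioo_subset_Ico_self ht
  obtain ⟨κ, hκ, hl, -⟩ := hX.flow t ht' x
  rw [inducedMetric_eq, secondFundamentalForm_eq] at hl
  obtain ⟨e, he, hd⟩ := isEigenvalueList_iff.1 hl
  set Ψ := normalParam (X t) x e with hΨ
  have hΨ0 : Ψ 0 = x := normalParam_zero _ _ _
  have hΨs := (eventually_contMDiffAt_normalParam (X t) x e).self_of_nhds.of_le two_le_infty
  set φ' : ℝ × EuclideanSpace ℝ (Fin n) → ℝ := fun z => φ z.1 (Ψ z.2) with hφ'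
  have hφs : ContDiffAt ℝ 2 φ' (t, 0) := contDiffAt_spacetime hφ ht hΨs
  have hφ0 : φ' (t, 0) = φ t x := by simp only [hφ', hΨ0]
  have hmin' : ∀ᶠ z in 𝓝 ((t, 0) : ℝ × EuclideanSpace ℝ (Fin n)), z.1 ≤ t →
      interiorSphereCurvature X ν z.1 (Ψ z.2) ≤ φ' z := by
    rw [eventually_nhdsWithin_iff] at hmin
    filter_upwards [(tendsto_normalParam (X t) x e).eventually hmin] with z hz hzt
    exact hz ⟨hzt, mem_univ _⟩
  have hdef : ∀ᶠ z in 𝓝 ((t, 0) : ℝ × EuclideanSpace ℝ (Fin n)), z.1 ≤ t → ∀ y,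
      0 ≤ contactDefect X ν (φ' z) z.1 (Ψ z.2) y := by
    have hIco : ∀ᶠ z in 𝓝 ((t, 0) : ℝ × EuclideanSpace ℝ (Fin n)), z.1 ∈ Ico 0 T :=
      (continuous_fst.tendsto (t, (0 : EuclideanSpace ℝ (Fin n)))).eventually
        (Ico_mem_nhds ht.1 ht.2)
    filter_upwards [hmin', hIco] with z hz hz' hzt y
    exact hX.contactDefect_nonneg hz' (hz hzt)
  have hdt : deriv (fun s => φ s x) t = dirDeriv (timeDir n) φ' (t, 0) := by
    have := (hasDerivAt_time (hφs.differentiableAt (by simp))).deriv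
    simp only [hφ', hΨ0] at this
    exact this
  have hsecond : ∀ i, dirDeriv (spaceDir i) (dirDeriv (spaceDir i) φ') (t, 0) =
      hessian (X t) (φ t) x (e i) (e i) := fun i => (spatial_derivs hX ht x e hφ i i).2
  rw [hX.linearizedFlow_eq hf ht' he hd hκ (contMDiff_slice hφ ht' x), hdt, ← hφ0]
  simp only [← hsecond]
  rcases hX.attained_or_eq_curvature hn ht' he hd with ⟨y, hy, hZ⟩ | ⟨a, ha⟩
  · exact hX.subsolution_of_attained hf ht he hd hκ hφs hy hdef (by rw [hφ0, h0, hZ])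
      (fun i => by rw [hφ0, h0]; exact hX.curvature_le ht' he hd i) (htouch t ht' x y hy hZ)
  · exact hX.subsolution_of_eq_curvature hf ht he hd hκ hφs hmin' (a := a)
      (by rw [hφ0, h0, ha])

end Viscosity

/-! ### The sign of the normal at the second contact point. -/

section Touching

lemma subset_of_isPreconnected {V : Type*} [TopologicalSpace V] {C Ω : Set V}
    (hC : IsPreconnected C) (hΩ : IsOpen Ω) (hd : ∀ p ∈ C, p ∉ frontier Ω)
    (hne : ∃ p ∈ C, p ∈ Ω) : C ⊆ Ω := by
  refine hC.subset_left_of_subset_union hΩ isClosed_closure.isOpen_compl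
    (disjoint_compl_right.mono_left subset_closure |>.mono_right (compl_subset_compl.2 le_rfl))
    (fun p hp => ?_) hne
  by_cases h : p ∈ closure Ω
  · left
    by_contra h'
    exact hd p hp (by rw [hΩ.frontier_eq]; exact ⟨h, h'⟩)
  · right; exact h

variable {W : Type*} [NormedAddCommGroup W] [InnerProductSpace ℝ W]

/-- A ray which starts in a bounded open set leaves it through the boundary. -/
lemma not_mem_of_ray {Ω : Set W} (hΩ : IsOpen Ω) (hb : Bornology.IsBounded Ω) {p u : W}
    (hu : inner ℝ u u = (1 : ℝ)) (hd : ∀ s : ℝ, 0 < s → p + s • u ∉ frontier Ω) {s : ℝ}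
    (hs : 0 < s) : p + s • u ∉ Ω := by
  intro hmem
  have hc : Continuous fun s : ℝ => p + s • u := by fun_prop
  have hsub : Set.image (fun s : ℝ => p + s • u) (Ioi 0) ⊆ Ω := by
    refine subset_of_isPreconnected (isPreconnected_Ioi.image _ hc.continuousOn) hΩ ?_
      ⟨_, mem_image_of_mem _ hs, hmem⟩
    rintro _ ⟨r, hr, rfl⟩
    exact hd r hr
  obtain ⟨C, hC⟩ := isBounded_iff_forall_norm_le.1 hb
  have hn : ‖u‖ = 1 := by
    rw [real_inner_self_eq_norm_sq] at hu
    nlinarith [norm_nonneg u]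
  have hr : 0 < |C| + ‖p‖ + 1 := by positivity
  have h1 := hC _ (hsub (mem_image_of_mem _ hr))
  have h2 : ‖(|C| + ‖p‖ + 1) • u‖ ≤ ‖p + (|C| + ‖p‖ + 1) • u‖ + ‖p‖ := by
    have := norm_sub_le (p + (|C| + ‖p‖ + 1) • u) p
    rwa [add_sub_cancel_left] at this
  rw [norm_smul, hn, mul_one, Real.norm_of_nonneg hr.le] at h2
  linarith [le_abs_self C]

/-- The open ball (or half space) which touches at the origin. -/
lemma convex_contact {a : ℝ} (ha : 0 ≤ a) (b m : W) :
    Convex ℝ {p : W | a * inner ℝ (b - p) (b - p) - 2 * inner ℝ (b - p) m < 0} := by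
  intro p hp q hq s r hs hr hsr
  simp only [mem_ofPred_eq] at hp hq ⊢
  have e : b - (s • p + r • q) = s • (b - p) + r • (b - q) := by
    have : b = (s + r) • b := by rw [hsr, one_smul]
    conv_lhs => rw [this]
    module
  rw [e]
  set P := b - p
  set Q := b - q
  have h1 : 0 ≤ inner ℝ (P - Q) (P - Q) := real_inner_self_nonneg
  simp only [inner_sub_left, inner_sub_right, real_inner_comm P Q] at h1
  simp only [inner_add_left, inner_add_right, inner_smul_left, inner_smul_right, conj_trivial,
    real_inner_comm P Q]
  have hr' : r = 1 - s := by linarith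
  -- The convexity deficit of the quadratic expression is a s r |P - Q|².
  have key : a * (s * (s * inner ℝ P P) + s * (r * inner ℝ P Q) +
      (r * (s * inner ℝ P Q) + r * (r * inner ℝ Q Q))) -
      2 * (s * inner ℝ P m + r * inner ℝ Q m) =
      s * (a * inner ℝ P P - 2 * inner ℝ P m) + r * (a * inner ℝ Q Q - 2 * inner ℝ Q m) -
      a * (s * r) * (inner ℝ P P - inner ℝ P Q - (inner ℝ P Q - inner ℝ Q Q)) := by
    rw [hr']; ring
  have h2 : 0 ≤ a * (s * r) * (inner ℝ P P - inner ℝ P Q - (inner ℝ P Q - inner ℝ Q Q)) := by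
    refine mul_nonneg (mul_nonneg ha (mul_nonneg hs hr)) ?_
    linarith
  have h3 : s * (a * inner ℝ P P - 2 * inner ℝ P m) + r * (a * inner ℝ Q Q - 2 * inner ℝ Q m)
      < 0 := by
    rcases hs.eq_or_lt with h | h
    · rw [← h, hr', ← h]; linarith
    · have := mul_neg_of_pos_of_neg h hp
      have := mul_nonpos_of_nonneg_of_nonpos hr hq.le
      linarith
  linarith

/-- A sphere which touches the boundary of `Ω` at two points, and does not cross it, lies on one
side of the boundary. -/
lemma not_opposite_contact {Ω : Set W} (hΩ : IsOpen Ω) (hb : Bornology.IsBounded Ω) {a : ℝ}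
    {p q m k : W} (hm : inner ℝ m m = (1 : ℝ))
    (hR : ∀ b ∈ frontier Ω, 0 ≤ a * inner ℝ (p - b) (p - b) - 2 * inner ℝ (p - b) m)
    (h0 : a * inner ℝ (p - q) (p - q) - 2 * inner ℝ (p - q) m = 0)
    (hk : k = -(m - a • (p - q)))
    (hside : (∀ᶠ s : ℝ in 𝓝[>] 0, p - s • m ∈ Ω ∧ q + s • k ∉ Ω) ∨
      (∀ᶠ s : ℝ in 𝓝[>] 0, p - s • m ∉ Ω ∧ q + s • k ∈ Ω)) : False := by
  have hkk : inner ℝ k k = (1 : ℝ) := by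
    rw [hk, inner_neg_neg]
    generalize p - q = d at h0
    simp only [inner_sub_left, inner_sub_right, inner_smul_left, inner_smul_right, conj_trivial,
      hm, real_inner_comm d m] at h0 ⊢
    linear_combination a * h0
  set R := {b : W | a * inner ℝ (p - b) (p - b) - 2 * inner ℝ (p - b) m < 0} with hRdef
  have hRf : ∀ b ∈ R, b ∉ frontier Ω := fun b hb hb' => not_lt.2 (hR b hb') hb
  -- Along p - s m the defect is s(as - 2), so for a > 0 the points run through the ball up to the
  -- antipode of p; the same formula holds along q + s k.
  have r1 : ∀ s : ℝ, 0 < s → a * s < 2 → p - s • m ∈ R := by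
    intro s hs has
    rw [hRdef, mem_ofPred_eq, sub_sub_cancel]
    simp only [inner_smul_left, inner_smul_right, conj_trivial, hm]
    nlinarith
  have r2 : ∀ s : ℝ, 0 < s → a * s < 2 → q + s • k ∈ R := by
    intro s hs has
    have e : p - (q + s • k) = (p - q) + s • (m - a • (p - q)) := by rw [hk]; module
    rw [hRdef, mem_ofPred_eq, e]
    have h1 : a * inner ℝ ((p - q) + s • (m - a • (p - q))) ((p - q) + s • (m - a • (p - q))) -
        2 * inner ℝ ((p - q) + s • (m - a • (p - q))) m = s * (a * s - 2) := by
      generalize p - q = d at h0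
      simp only [inner_add_left, inner_add_right, inner_sub_left, inner_sub_right,
        inner_smul_left, inner_smul_right, conj_trivial, hm, real_inner_comm d m] at h0 ⊢
      linear_combination (1 + a ^ 2 * s ^ 2 - 2 * a * s) * h0
    rw [h1]
    exact mul_neg_of_pos_of_neg hs (by linarith)
  have hsmall : ∀ᶠ s : ℝ in 𝓝[>] 0, 0 < s ∧ a * s < 2 := by
    have : Tendsto (fun s : ℝ => a * s) (𝓝 0) (𝓝 0) := by
      have h : Continuous fun s : ℝ => a * s := by fun_prop
      simpa using h.tendsto 0
    filter_upwards [self_mem_nhdsWithin,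
      (this.eventually (gt_mem_nhds two_pos)).filter_mono nhdsWithin_le_nhds] with s h1 h2
    exact ⟨h1, h2⟩
  -- For a < 0 the set R is the exterior of a closed ball, which convexity does not handle. It
  -- contains an entire ray from each contact point, and such a ray would stay in the bounded set Ω.
  rcases lt_or_ge a 0 with ha | ha
  · have hall : ∀ s : ℝ, 0 < s → a * s < 2 := fun s hs => by nlinarith
    rcases hside with h | h
    · obtain ⟨s, ⟨h1, -⟩, h2, -⟩ := (h.and hsmall).exists
      refine not_mem_of_ray hΩ hb (p := p) (u := -m) (by rw [inner_neg_neg, hm])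
        (fun s hs => ?_) h2 (by rwa [smul_neg, ← sub_eq_add_neg])
      rw [smul_neg, ← sub_eq_add_neg]
      exact hRf _ (r1 s hs (hall s hs))
    · obtain ⟨s, ⟨-, h1⟩, h2, -⟩ := (h.and hsmall).exists
      exact not_mem_of_ray hΩ hb hkk (fun s hs => hRf _ (r2 s hs (hall s hs))) h2 h1
  -- For a ≥ 0 the ball or half space R misses the boundary of Ω, so it cannot contain points both
  -- inside and outside Ω.
  · have hC : IsPreconnected R := (convex_contact ha p m).isPreconnected
    rcases hside with h | h
    · obtain ⟨s, ⟨h1, h1'⟩, h2, h3⟩ := (h.and hsmall).exists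
      exact h1' (subset_of_isPreconnected hC hΩ hRf ⟨_, r1 s h2 h3, h1⟩ (r2 s h2 h3))
    · obtain ⟨s, ⟨h1, h1'⟩, h2, h3⟩ := (h.and hsmall).exists
      exact h1 (subset_of_isPreconnected hC hΩ hRf ⟨_, r2 s h2 h3, h1'⟩ (r1 s h2 h3))

variable {n : ℕ} {M : Type*} [TopologicalSpace M] [ChartedSpace (EuclideanSpace ℝ (Fin n)) M]
  [IsManifold (𝓡 n) ∞ M]

/-- A sphere which touches a hypersurface is tangent to it. -/
lemma IsHypersurface.normal_of_contact {Y N : M → EuclideanSpace ℝ (Fin (n + 1))}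
    (hY : IsHypersurface Y N) {x y : M} {a : ℝ}
    (hmin : ∀ y, 0 ≤ a * inner ℝ (Y x - Y y) (Y x - Y y) - 2 * inner ℝ (Y x - Y y) (N x))
    (h0 : a * inner ℝ (Y x - Y y) (Y x - Y y) - 2 * inner ℝ (Y x - Y y) (N x) = 0) :
    N y = N x - a • (Y x - Y y) ∨ N y = -(N x - a • (Y x - Y y)) := by
  set c := extChartAt (𝓡 n) y with hc
  set w := N x - a • (Y x - Y y) with hw
  have hP : ContDiffAt ℝ 2 (Y ∘ c.symm) (c y) :=
    contDiffAt_chart_self two_le_infty ((hY.smooth y).of_le two_le_infty)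
  have e0 : (Y ∘ c.symm) (c y) = Y y := by simp [hc]
  have hval : ∀ q, a * inner ℝ (Y x - q) (Y x - q) - 2 * inner ℝ (Y x - q) (N x) =
      a * inner ℝ (q - Y x) (q - Y x) + 2 * inner ℝ (q - Y x) (N x) := by
    intro q
    rw [← neg_sub q, inner_neg_neg, inner_neg_left]
    ring
  -- The defect has its minimum 0 at y, so its differential vanishes there and w is orthogonal to
  -- the tangent space.
  have horth : ∀ v : EuclideanSpace ℝ (Fin n), inner ℝ w (differential Y y v) = 0 := by
    intro v
    obtain ⟨h1, h2, -⟩ := dirDeriv_contact hP a (Y x) (N x) v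
    have h3 := (dirDeriv_of_line_min (v := v) h1 (by
      refine Eventually.of_forall fun s => ?_
      rw [e0, ← hval, ← hval, h0]
      exact hmin _)).1
    rw [h2, e0, ← differential_eq_fderiv (hY.mdifferentiableAt y)] at h3
    rw [hw, inner_sub_left, inner_smul_left, ← neg_sub (Y y), inner_neg_left, conj_trivial,
      real_inner_comm]
    linarith
  -- The contact equation makes w the reflection of the unit vector N x.
  have hww : inner ℝ w w = (1 : ℝ) := by
    have h1 := hY.inner_normal x
    generalize Y x - Y y = d at hw h0
    rw [hw]
    simp only [inner_sub_left, inner_sub_right, inner_smul_left, inner_smul_right, conj_trivial,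
      h1, real_inner_comm d (N x)] at h0 ⊢
    linear_combination a * h0
  have hwN : w = inner ℝ w (N y) • N y := by
    refine hY.ext_inner (x := y) ?_ fun u => ?_
    · rw [inner_smul_left, hY.inner_normal]; simp
    · rw [horth, inner_smul_left, real_inner_comm _ (N y), hY.orthogonal]; simp
  have hsq : (inner ℝ w (N y) : ℝ) * inner ℝ w (N y) = 1 := by
    rw [hwN, inner_smul_left, inner_smul_right, hY.inner_normal] at hww
    simp only [conj_trivial, mul_one] at hww
    exact hww
  rcases mul_self_eq_one_iff.1 hsq with h | h
  · left; rw [hwN, h, one_smul]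
  · right; rw [hwN, h, neg_smul, one_smul, neg_neg]

/-- The sign of the normal at the second contact point. -/
lemma IsHypersurface.normal_eq_of_contact {Y N : M → EuclideanSpace ℝ (Fin (n + 1))}
    (hY : IsHypersurface Y N) {Ω : Set (EuclideanSpace ℝ (Fin (n + 1)))} (hΩ : IsOpen Ω)
    (hb : Bornology.IsBounded Ω) (hfr : frontier Ω = range Y)
    (hside : (∀ x, ∀ᶠ s : ℝ in 𝓝[>] 0, Y x - s • N x ∈ Ω ∧ Y x + s • N x ∉ Ω) ∨
      (∀ x, ∀ᶠ s : ℝ in 𝓝[>] 0, Y x - s • N x ∉ Ω ∧ Y x + s • N x ∈ Ω)) {x y : M} {a : ℝ}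
    (hmin : ∀ y, 0 ≤ a * inner ℝ (Y x - Y y) (Y x - Y y) - 2 * inner ℝ (Y x - Y y) (N x))
    (h0 : a * inner ℝ (Y x - Y y) (Y x - Y y) - 2 * inner ℝ (Y x - Y y) (N x) = 0) :
    N y = N x - a • (Y x - Y y) := by
  refine (hY.normal_of_contact hmin h0).resolve_right fun h => ?_
  refine not_opposite_contact hΩ hb (hY.inner_normal x) ?_ h0 h ?_
  · rw [hfr]
    rintro _ ⟨y, rfl⟩
    exact hmin y
  · refine hside.imp (fun hs => ?_) fun hs => ?_ <;>
    · filter_upwards [hs x, hs y] with s h1 h2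
      exact ⟨h1.1, h2.2⟩

end Touching

/-! ### Duality by reversing the normal, and conclusion. -/

section Assembly

variable {n : ℕ} {Γ : ConvexCone ℝ (Fin n → ℝ)} {f : (Fin n → ℝ) → ℝ}

lemma IsSpeed.isConcaveSpeed (hf : IsSpeed Γ f) (hc : ConcaveOn ℝ (Γ : Set (Fin n → ℝ)) f) :
    IsConcaveSpeed (Γ : Set (Fin n → ℝ)) f where
  isOpen := hf.isOpen
  perm_mem := hf.perm_mem
  symm := hf.symm
  contDiffOn := hf.contDiffOn
  homogeneous := hf.homogeneous
  monotoneOn := hf.monotoneOn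
  concaveOn := hc

/-- The dual speed of a convex speed is concave. -/
lemma IsSpeed.isConcaveSpeed_dual (hf : IsSpeed Γ f)
    (hc : ConvexOn ℝ (Γ : Set (Fin n → ℝ)) f) :
    IsConcaveSpeed (-(Γ : Set (Fin n → ℝ))) (fun κ => -f (-κ)) where
  isOpen := hf.isOpen.neg
  perm_mem σ κ hκ := hf.perm_mem σ (-κ) hκ
  symm σ κ hκ := congrArg Neg.neg (hf.symm σ (-κ) hκ)
  contDiffOn := (hf.contDiffOn.comp contDiff_neg.contDiffOn fun _ h => h).neg
  homogeneous c hc κ hκ := by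
    rw [← smul_neg, hf.homogeneous c hc (-κ) hκ]; ring
  monotoneOn κ hκ κ' hκ' h := neg_le_neg (hf.monotoneOn hκ' hκ (neg_le_neg h))
  concaveOn := by
    refine ⟨hc.1.neg, fun κ hκ κ' hκ' a b ha hb hab => ?_⟩
    have := hc.2 hκ hκ' ha hb hab
    simp only [neg_add, ← smul_neg, smul_eq_mul, mul_neg] at this ⊢
    linarith

lemma IsEigenvalueList.neg {g h : EuclideanSpace ℝ (Fin n) → EuclideanSpace ℝ (Fin n) → ℝ}
    {κ : Fin n → ℝ} (hκ : IsEigenvalueList g h κ) :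
    IsEigenvalueList g (fun u v => -h u v) (-κ) := by
  obtain ⟨e, he, hd⟩ := hκ
  refine ⟨e, he, fun i j => ?_⟩
  simp only [hd]
  split_ifs <;> simp

/-- The derivative of the spectral function of the dual speed. -/
lemma IsConcaveSpeed.spectralDeriv_dual {Γ : Set (Fin n → ℝ)} {f : (Fin n → ℝ) → ℝ}
    (hf : IsConcaveSpeed Γ f) {g h B : LinearMap.BilinForm ℝ (EuclideanSpace ℝ (Fin n))}
    (hs : ∀ u v, h u v = h v u) (hB : ∀ u v, B u v = B v u)
    {e : Fin n → EuclideanSpace ℝ (Fin n)} {κ : Fin n → ℝ} (he : IsFrame g e)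
    (hd : formMatrix h e = Matrix.diagonal κ) (hΓ : κ ∈ Γ) :
    spectralDeriv (fun κ => -f (-κ)) (fun u v => g u v) (fun u v => -h u v) (fun u v => B u v) =
      ∑ i, grad f κ i * B (e i) (e i) := by
  obtain ⟨h1, h2⟩ := hf.spectral_perturbation hs hB he hd hΓ
  rw [← h1, spectralDeriv, spectralDeriv]
  set G : ℝ → ℝ := fun s => spectralFun f (fun u v => g u v) (fun u v => h u v + s * B u v)
    with hG
  -- The curve for the dual speed is -G(-s), but only near 0, where the eigenvalues of h - sB lie in
  -- Γ and f does not depend on the chosen list.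
  have h3 : (fun s : ℝ => spectralFun (fun κ => -f (-κ)) (fun u v => g u v)
      (fun u v => -h u v + s * B u v)) =ᶠ[𝓝 0] fun s => -G (-s) := by
    have hneg : Tendsto (fun s : ℝ => -s) (𝓝 0) (𝓝 0) := by simpa using (tendsto_neg (0 : ℝ))
    filter_upwards [hneg.eventually h2] with s hs
    obtain ⟨κ', hκ', hl⟩ := hs
    have e1 : (fun u v => -h u v + s * B u v) = fun u v => -(h + -s • B) u v := by
      funext u v; simp; ring
    have e2 : (fun u v => h u v + -s * B u v) = fun u v => (h + -s • B) u v := by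
      funext u v; simp
    have hl' := (Classical.epsilon_spec ⟨_, hl.neg⟩ : IsEigenvalueList (fun u v => g u v)
      (fun u v => -(h + -s • B) u v) (eigenvalueList _ _)).neg
    simp only [neg_neg] at hl'
    rw [hG]
    simp only
    rw [e2, hf.spectralFun_eq hl hκ', spectralFun, e1, eigenvalueList,
      (hf.eq_of_isEigenvalueList hl hκ' hl').2]
  rw [h3.deriv_eq, deriv.fun_neg, deriv_comp_neg, neg_neg, neg_zero]

variable {M : Type*} [TopologicalSpace M] [ChartedSpace (EuclideanSpace ℝ (Fin n)) M]

lemma differential_neg {W : Type*} [NormedAddCommGroup W] [NormedSpace ℝ W] (Y : M → W) (x : M) :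
    differential (n := n) (fun x => -Y x) x = -differential Y x :=
  mfderiv_neg (I := 𝓡 n) (f := Y) (x := x)

lemma chartSecondDeriv_neg {W : Type*} [NormedAddCommGroup W] [NormedSpace ℝ W] (Y : M → W)
    (x : M) : chartSecondDeriv (n := n) (fun x => -Y x) x = -chartSecondDeriv Y x := by
  have h1 : fderiv ℝ ((fun x => -Y x) ∘ (extChartAt (𝓡 n) x).symm) =
      fun ξ => -fderiv ℝ (Y ∘ (extChartAt (𝓡 n) x).symm) ξ := by
    funext ξ
    exact fderiv_neg
  rw [chartSecondDeriv, h1, fderiv_fun_neg, chartSecondDeriv]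

lemma hessian_neg (Y : M → EuclideanSpace ℝ (Fin (n + 1))) (φ : M → ℝ) (x : M)
    (u v : EuclideanSpace ℝ (Fin n)) :
    hessian Y (fun x => -φ x) x u v = -hessian Y φ x u v := by
  rw [hessian, hessian, chartSecondDeriv_neg, differential_neg]
  simp
  ring

lemma secondFundamentalForm_neg (Y N : M → EuclideanSpace ℝ (Fin (n + 1))) (x : M) :
    secondFundamentalForm (n := n) Y (fun x => -N x) x =
      fun u v => -secondFundamentalForm Y N x u v := by
  funext u v
  rw [secondFundamentalForm, differential_neg, secondFundamentalForm, neg_apply, inner_neg_left]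

lemma contMDiffOn_neg {k : WithTop ℕ∞} {W : Type*} [NormedAddCommGroup W] [NormedSpace ℝ W]
    {K : ℝ × M → W} {s : Set (ℝ × M)}
    (hK : ContMDiffOn (𝓘(ℝ, ℝ).prod (𝓡 n)) 𝓘(ℝ, W) k K s) :
    ContMDiffOn (𝓘(ℝ, ℝ).prod (𝓡 n)) 𝓘(ℝ, W) k (fun p => -K p) s :=
  (contDiff_neg.contMDiff (n := k)).comp_contMDiffOn hK

variable {T : ℝ} {X ν : ℝ → M → EuclideanSpace ℝ (Fin (n + 1))}

/-- Reversing the normal. -/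
lemma IsSmoothFlow.neg {Γ : Set (Fin n → ℝ)} {f : (Fin n → ℝ) → ℝ}
    (hX : IsSmoothFlow Γ f T X ν) :
    IsSmoothFlow (-Γ) (fun κ => -f (-κ)) T X (fun t x => -ν t x) where
  smooth := hX.smooth
  smooth_normal := contMDiffOn_neg hX.smooth_normal
  injective := hX.injective
  immersion := hX.immersion
  norm_eq_one t ht x := by rw [norm_neg, hX.norm_eq_one t ht x]
  orthogonal t ht x u := by rw [inner_neg_right, hX.orthogonal t ht x u, neg_zero]
  flow t ht x := by
    obtain ⟨κ, hκ, hl, hd⟩ := hX.flow t ht x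
    refine ⟨-κ, by simpa using hκ, ?_, ?_⟩
    · rw [secondFundamentalForm_neg]
      exact hl.neg
    · simpa using hd

variable [IsManifold (𝓡 n) ∞ M]

/-- The principal curvatures are an arbitrary choice, so the spectral theorem is needed to know that
an eigenvalue list exists and that the choice is one. -/
lemma IsEmbeddedSolution.isSmoothFlow (hX : IsEmbeddedSolution Γ f T X ν) :
    IsSmoothFlow (Γ : Set (Fin n → ℝ)) f T X ν where
  smooth := hX.smooth
  smooth_normal := hX.smooth_normal
  injective t ht := (hX.embedding t ht).injective
  immersion := hX.immersion
  norm_eq_one t ht := (hX.normal t ht).norm_eq_one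
  orthogonal t ht := (hX.normal t ht).orthogonal
  flow t ht x := by
    refine ⟨_, hX.curvatures_mem t ht x, ?_, hX.flow t ht x⟩
    have hY : IsHypersurface (X t) (ν t) := ⟨contMDiff_slice hX.smooth ht,
      contMDiff_slice hX.smooth_normal ht, hX.immersion t ht, (hX.normal t ht).norm_eq_one,
      (hX.normal t ht).orthogonal⟩
    obtain ⟨e, he⟩ := hY.exists_isFrame x
    obtain ⟨E, κ, hE, hd⟩ := he.exists_eigenframe (hY.curvatureForm_symm x)
    exact Classical.epsilon_spec (p := IsEigenvalueList (inducedMetric (X t) x)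
      (secondFundamentalForm (X t) (ν t) x)) ⟨κ, isEigenvalueList_iff.2 ⟨E, hE, hd⟩⟩

/-- The linearized flow does not depend on the choice of the normal. -/
lemma IsSmoothFlow.linearizedFlow_dual {Γ : Set (Fin n → ℝ)} {f : (Fin n → ℝ) → ℝ}
    (hf : IsConcaveSpeed Γ f) (hX : IsSmoothFlow Γ f T X ν) {t : ℝ} (ht : t ∈ Ico 0 T) {x : M}
    {φ : M → ℝ} (hφ : ContMDiffAt (𝓡 n) 𝓘(ℝ, ℝ) 2 φ x) :
    linearizedFlow (fun κ => -f (-κ)) X (fun t x => -ν t x) t φ x =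
      linearizedFlow f X ν t φ x := by
  have hY := hX.isHypersurface ht
  have hY' := hX.neg.isHypersurface ht
  obtain ⟨κ, hκ, hl, -⟩ := hX.flow t ht x
  rw [inducedMetric_eq, secondFundamentalForm_eq] at hl
  obtain ⟨e, he, hd⟩ := isEigenvalueList_iff.1 hl
  have hsq : squaredForm (X t) (fun x => -ν t x) x = squaredForm (X t) (ν t) x := by
    funext u v
    rw [hY.squaredForm_eq, hY'.squaredForm_eq, differential_neg, neg_apply, neg_apply,
      inner_neg_neg]
  have hsym : ∀ u v, metricForm (ν t) x u v = metricForm (ν t) x v u := fun u v => by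
    rw [metricForm_apply, metricForm_apply, real_inner_comm]
  rw [linearizedFlow, linearizedFlow, secondFundamentalForm_neg, hsq, inducedMetric_eq,
    secondFundamentalForm_eq, hY.squaredForm_eq_metricForm, hessian_eq,
    hf.spectralDeriv_dual (hY.curvatureForm_symm x) (hY.hessian_symm hφ) he hd hκ,
    hf.spectralDeriv_dual (hY.curvatureForm_symm x) hsym he hd hκ,
    hf.spectralDeriv_eq (hY.curvatureForm_symm x) (hY.hessian_symm hφ) he hd hκ,
    hf.spectralDeriv_eq (hY.curvatureForm_symm x) hsym he hd hκ]

/-- Linearity in φ is visible only after passing to an eigenframe, since `spectralDeriv` is defined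
by a derivative of a function of eigenvalues. -/
lemma IsSmoothFlow.linearizedFlow_neg {Γ : Set (Fin n → ℝ)} {f : (Fin n → ℝ) → ℝ}
    (hf : IsConcaveSpeed Γ f) (hX : IsSmoothFlow Γ f T X ν) {t : ℝ} (ht : t ∈ Ico 0 T) {x : M}
    {φ : M → ℝ} (hφ : ContMDiffAt (𝓡 n) 𝓘(ℝ, ℝ) 2 φ x) :
    linearizedFlow f X ν t (fun x => -φ x) x = -linearizedFlow f X ν t φ x := by
  obtain ⟨κ, hκ, hl, -⟩ := hX.flow t ht x
  rw [inducedMetric_eq, secondFundamentalForm_eq] at hl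
  obtain ⟨e, he, hd⟩ := isEigenvalueList_iff.1 hl
  have hφ' : ContMDiffAt (𝓡 n) 𝓘(ℝ, ℝ) 2 (fun x => -φ x) x :=
    (contDiff_neg.contMDiff (n := 2)).contMDiffAt.comp x hφ
  rw [hX.linearizedFlow_eq hf ht he hd hκ hφ, hX.linearizedFlow_eq hf ht he hd hκ hφ']
  simp only [hessian_neg, mul_neg, Finset.sum_neg_distrib]
  ring

/-- The contact condition at extremal spheres, for either choice of the normal. -/
lemma IsSmoothFlow.normal_of_attained {Γ : Set (Fin n → ℝ)} {f : (Fin n → ℝ) → ℝ}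
    [T2Space M] [CompactSpace M] (hX : IsSmoothFlow Γ f T X ν) {t : ℝ} (ht : t ∈ Ico 0 T)
    {Ω : Set (EuclideanSpace ℝ (Fin (n + 1)))} (hΩ : IsOpen Ω)
    (hb : Bornology.IsBounded Ω) (hfr : frontier Ω = range (X t))
    (hside : (∀ x, ∀ᶠ s : ℝ in 𝓝[>] 0, X t x - s • ν t x ∈ Ω ∧ X t x + s • ν t x ∉ Ω) ∨
      (∀ x, ∀ᶠ s : ℝ in 𝓝[>] 0, X t x - s • ν t x ∉ Ω ∧ X t x + s • ν t x ∈ Ω)) {x y : M}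
    (hy : y ≠ x) (hZ : Z X ν t x y = interiorSphereCurvature X ν t x) :
    ν t y = ν t x - Z X ν t x y • (X t x - X t y) := by
  refine (hX.isHypersurface ht).normal_eq_of_contact hΩ hb hfr hside
    (fun y => hX.contactDefect_nonneg ht hZ.ge) ?_
  have := contactDefect_eq (ν := ν) (a := Z X ν t x y) (hX.ne ht hy)
  rwa [sub_self, zero_mul] at this

/-- The exterior sphere curvature of a flow by a convex speed. -/
theorem IsEmbeddedSolution.exterior_supersolution [T2Space M] [CompactSpace M] (hn : 1 ≤ n)
    (hf : IsSpeed Γ f) (hX : IsEmbeddedSolution Γ f T X ν)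
    (hc : ConvexOn ℝ (Γ : Set (Fin n → ℝ)) f) :
    (∀ t ∈ Ico 0 T, ∀ x : M, BddBelow {r | ∃ y, y ≠ x ∧ r = Z X ν t x y}) ∧
      IsViscositySupersolution n T (linearizedFlow f X ν) (exteriorSphereCurvature X ν) := by
  have hf' := hf.isConcaveSpeed_dual hc
  have hS' := hX.isSmoothFlow.neg
  refine ⟨fun t ht x => ?_, ?_⟩
  · have := hS'.bddAbove_Z ht x
    rwa [setOf_Z_neg, bddAbove_neg] at this
  -- The reversed normal points into Ω, so the second alternative of the side condition holds.
  have hv := hS'.isViscositySubsolution hn hf' fun t ht x y hy hZ => by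
    obtain ⟨Ω, h1, h2, h3, h4⟩ := (hX.normal t ht).outward
    refine hS'.normal_of_attained ht h1 h2 h3 (Or.inr fun x => ?_) hy hZ
    filter_upwards [h4 x] with s hs
    rw [smul_neg, sub_neg_eq_add, ← sub_eq_add_neg]
    exact ⟨fun h => hs.2 (subset_closure h), hs.1⟩
  have hext : exteriorSphereCurvature X ν =
      fun t x => -interiorSphereCurvature X (fun t x => -ν t x) t x := by
    funext t x
    exact exteriorSphereCurvature_eq t x
  rw [hext]
  refine ⟨hv.1.neg, fun t ht x φ hφ h0 hmin => ?_⟩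
  have ht' := Ioo_subset_Ico_self ht
  have hφx := contMDiff_slice hφ ht' x
  have h1 := hv.2 t ht x (fun t x => -φ t x) (contMDiffOn_neg hφ) (by rw [h0, neg_neg])
    (hmin.mono fun p hp => le_neg_of_le_neg hp)
  -- Dualizing the dual speed returns f and ν, so the operator in the inequality for -φ is the
  -- original one.
  have hdual := hS'.linearizedFlow_dual hf' ht' hφx
  simp only [neg_neg] at hdual
  rw [hS'.linearizedFlow_neg hf' ht' hφx, ← hdual, deriv.fun_neg] at h1
  exact neg_le_neg_iff.1 h1

/-- The interior sphere curvature of a flow by a concave speed. -/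
theorem IsEmbeddedSolution.interior_subsolution [T2Space M] [CompactSpace M] (hn : 1 ≤ n)
    (hf : IsSpeed Γ f) (hX : IsEmbeddedSolution Γ f T X ν)
    (hc : ConcaveOn ℝ (Γ : Set (Fin n → ℝ)) f) :
    (∀ t ∈ Ico 0 T, ∀ x : M, BddAbove {r | ∃ y, y ≠ x ∧ r = Z X ν t x y}) ∧
      IsViscositySubsolution n T (linearizedFlow f X ν) (interiorSphereCurvature X ν) := by
  have hS := hX.isSmoothFlow
  refine ⟨fun t ht x => hS.bddAbove_Z ht x, ?_⟩
  refine hS.isViscositySubsolution hn (hf.isConcaveSpeed hc) fun t ht x y hy hZ => ?_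
  obtain ⟨Ω, h1, h2, h3, h4⟩ := (hX.normal t ht).outward
  refine hS.normal_of_attained ht h1 h2 h3 (Or.inl fun x => ?_) hy hZ
  filter_upwards [h4 x] with s hs
  exact ⟨hs.1, fun h => hs.2 (subset_closure h)⟩

end Assembly

end NonCollapsing

end

theorem theorem1 {n : ℕ} (hn : 1 ≤ n) {M : Type*} [TopologicalSpace M] [T2Space M]
    [CompactSpace M] [ChartedSpace (EuclideanSpace ℝ (Fin n)) M] [IsManifold (𝓡 n) ∞ M]
    (Γ : ConvexCone ℝ (Fin n → ℝ)) (f : (Fin n → ℝ) → ℝ) (hf : NonCollapsing.IsSpeed Γ f)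
    (T : ℝ) (X ν : ℝ → M → EuclideanSpace ℝ (Fin (n + 1)))
    (hX : NonCollapsing.IsEmbeddedSolution Γ f T X ν) :
    (ConvexOn ℝ (Γ : Set (Fin n → ℝ)) f →
      (∀ t ∈ Set.Ico 0 T, ∀ x : M, BddBelow {r | ∃ y, y ≠ x ∧ r = NonCollapsing.Z X ν t x y}) ∧
      NonCollapsing.IsViscositySupersolution n T (NonCollapsing.linearizedFlow f X ν)
        (NonCollapsing.exteriorSphereCurvature X ν)) ∧
    (ConcaveOn ℝ (Γ : Set (Fin n → ℝ)) f →
      (∀ t ∈ Set.Ico 0 T, ∀ x : M, BddAbove {r | ∃ y, y ≠ x ∧ r = NonCollapsing.Z X ν t x y}) ∧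
      NonCollapsing.IsViscositySubsolution n T (NonCollapsing.linearizedFlow f X ν)
        (NonCollapsing.interiorSphereCurvature X ν)) :=
  ⟨hX.exterior_supersolution hn hf, hX.interior_subsolution hn hf⟩
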